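/- **Conventions.** All graphs are finite, simple and have at least one vertex; $\mathrm{Adj}(G)$ is the adjacency matrix of $G$. A graph is *2-connected* if it is connected and stays connected after deletion of any one vertex (so $K_1$ and $K_2$ are 2-connected, the empty graph being regarded as connected). A *block* of a graph is a maximal 2-connected subgraph, and a *block graph* is a graph all of whose blocks are complete. The family of *block-cographs* is the smallest isomorphism-closed family of graphs that contains all block graphs and is closed under complement and under disjoint union. A *magic unitary* with coefficients in a unital complex $*$-algebra is a matrix $U=(u_{ij})_{i\in I,j\in J}$ ($I,J$ finite) such that $u_{ij}^2=u_{ij}=u_{ij}^*$, $u_{ij}u_{ik}=0$ for $j\neq k$, $u_{ij}u_{kj}=0$ for $i\ne k$, and $\sum_{k}u_{kj}=1=\sum_k u_{ik}$ for all $i,j$. Graphs $G$ and $H$ are *quantum isomorphic* if there is a magic unitary $U$, indexed by $V(H)\times V(G)$, with coefficients in a nonzero unital $C^*$-algebra, such that $U\,\mathrm{Adj}(G)=\mathrm{Adj}(H)\,U$. A *quantum permutation group* is a pair $(A,U)$ of a unital $*$-algebra $A$ and a magic unitary $U=(u_{ij})_{i,j\in I}$ ($I$ finite, nonempty) whose coefficients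 generate $A$, such that there is a unital $*$-homomorphism $\Delta\colon A\to A\otimes A$ (algebraic tensor product) with $\Delta(u_{ij})=\sum_k u_{ik}\otimes u_{kj}$. Two of them are *isomorphic* if there is a $*$-isomorphism of their algebras intertwining the comultiplications $\Delta$. The *quantum automorphism group* $\mathrm{Qu}(G)$ of a graph $G$ is the quantum permutation group $(A,U)$ where $A$ is the universal unital $*$-algebra generated by the coefficients of a magic unitary $U=(u_{xy})_{x,y\in V(G)}$ with $U\,\mathrm{Adj}(G)=\mathrm{Adj}(G)\,U$. For $n\ge 1$, $S_n^+=\mathrm{Qu}(G)$ for $G$ the edgeless graph on $n$ vertices. A graph $G$ has *quantum symmetry* if the algebra of $\mathrm{Qu}(G)$ is not commutative. A family $\mathcal F$ of graphs is *superrigid tractable* if it satisfies both * (SA) a graph $G\in\mathcal F$ has quantum symmetry if and only if $G$ has two nontrivial automorphisms with disjoint supports; * (SR) whenever a graph $H$ is quantum isomorphic to a graph $G\in\mathcal F$, $H$ is isomorphic to $G$. The *free product* of two quantum permutation groups $(A,U)$ and $(B,V)$ has as its algebra the free product (coproduct) $A*B$ of unital $*$-algebras, with the comultiplication extending those of $A$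 and $B$ (and fundamental representation $\mathrm{Diag}(U,V)$). The *free wreath product* of $(A,U)$ by $S_n^+=(B,(s_{ij}))$ has as its algebra the quotient of $A^{*n}*B$ by the relations $\nu_i(a)s_{ij}=s_{ij}\nu_i(a)$, where $\nu_i\colon A\to A^{*n}$ is the $i$-th copy, with the comultiplication given by $\Delta(s_{ij})=\sum_k s_{ik}\otimes s_{kj}$ and $\Delta(\nu_i(a))=\sum_k(\nu_i\otimes\nu_k)(\Delta_A(a))\,(s_{ik}\otimes1)$ (and fundamental representation $(s_{ij}\nu_i(u_{xy}))_{(i,x),(j,y)}$). Let $\mathrm{Jor}(1)$ be the smallest isomorphism-closed family of groups that contains the trivial group and is closed under direct products $\Gamma\times\Lambda$ and wreath products $\Gamma\wr S_n=\Gamma^n\rtimes S_n$ with the symmetric groups, $n\ge1$. Let $\mathrm{Jor}^+(\mathbb C)$ be the smallest isomorphism-closed family of quantum permutation groups that contains the trivial one (with algebra $\mathbb C$) and is closed under free products and free wreath products with $S_n^+$, $n\ge1$. **Theorem.** The family of block-cographs is superrigid tractable. Moreover, up to isomorphism, the groups that are automorphism groups of block-cographs are exactly the groups in $\mathrm{Jor}(1)$,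 and the quantum permutation groups that are quantum automorphism groups of block-cographs are exactly those in $\mathrm{Jor}^+(\mathbb C)$. -/

import Mathlib

open scoped TensorProduct

universe w

noncomputable section

/-! ### Universal unital complex star-algebras given by generators and relations -/

/-- Formal unital star-algebra expressions over `ℂ` in generators from `X`. -/
inductive StarTerm (X : Type) : Type
  | gen (x : X)
  | scalar (c : ℂ)
  | add (a b : StarTerm X)
  | mul (a b : StarTerm X)
  | star (a : StarTerm X)

namespace StarTerm

/-- The formal sum of a finite family of expressions. -/
def sum {X I : Type} [Fintype I] (f : I → StarTerm X) : StarTerm X :=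
  (Finset.univ.toList.map f).foldr add (scalar 0)

/-- The value of an expression in a unital star-algebra, for given values of the generators. -/
def eval {X : Type} {B : Type*} [Ring B] [StarRing B] [Algebra ℂ B] (f : X → B) :
    StarTerm X → B
  | gen x => f x
  | scalar c => algebraMap ℂ B c
  | add a b => eval f a + eval f b
  | mul a b => eval f a * eval f b
  | star a => Star.star (eval f a)

theorem eval_sum {X I : Type} [Fintype I] {B : Type*} [Ring B] [StarRing B] [Algebra ℂ B]
    (f : X → B) (t : I → StarTerm X) : eval f (sum t) = ∑ i, eval f (t i) := by
  have h : ∀ l : List I,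
      eval f ((l.map t).foldr add (scalar 0)) = (l.map fun i => eval f (t i)).sum := by
    intro l
    induction l with
    | nil => simp [eval]
    | cons a l ih => simp [eval, ih]
  rw [sum, h, Finset.sum_map_toList]

/-- The congruence on expressions generated by the axioms of unital complex star-algebras
and by the relations `r`. -/
inductive Cong {X : Type} (r : StarTerm X → StarTerm X → Prop) :
    StarTerm X → StarTerm X → Prop
  | rel {a b} : r a b → Cong r a b
  | refl (a) : Cong r a a
  | symm {a b} : Cong r a b → Cong r b a
  | trans {a b c} : Cong r a b → Cong r b c → Cong r a c
  | add_congr {a a' b b'} : Cong r a a' → Cong r b b' → Cong r (add a b) (add a' b')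
  | mul_congr {a a' b b'} : Cong r a a' → Cong r b b' → Cong r (mul a b) (mul a' b')
  | star_congr {a a'} : Cong r a a' → Cong r (star a) (star a')
  | add_assoc (a b c) : Cong r (add (add a b) c) (add a (add b c))
  | add_comm (a b) : Cong r (add a b) (add b a)
  | zero_add (a) : Cong r (add (scalar 0) a) a
  | neg_add (a) : Cong r (add (mul (scalar (-1)) a) a) (scalar 0)
  | mul_assoc (a b c) : Cong r (mul (mul a b) c) (mul a (mul b c))
  | one_mul (a) : Cong r (mul (scalar 1) a) a
  | left_distrib (a b c) : Cong r (mul a (add b c)) (add (mul a b) (mul a c))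
  | right_distrib (a b c) : Cong r (mul (add a b) c) (add (mul a c) (mul b c))
  | scalar_add (c d) : Cong r (scalar (c + d)) (add (scalar c) (scalar d))
  | scalar_mul (c d) : Cong r (scalar (c * d)) (mul (scalar c) (scalar d))
  | scalar_comm (c a) : Cong r (mul (scalar c) a) (mul a (scalar c))
  | star_star (a) : Cong r (star (star a)) a
  | star_add (a b) : Cong r (star (add a b)) (add (star a) (star b))
  | star_mul (a b) : Cong r (star (mul a b)) (mul (star b) (star a))
  | star_scalar (c) : Cong r (star (scalar c)) (scalar (starRingEnd ℂ c))

end StarTerm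

/-- The universal unital star-algebra with generators `X` and relations `r`. -/
def UnivStarAlg {X : Type} (r : StarTerm X → StarTerm X → Prop) : Type :=
  Quot (StarTerm.Cong r)

namespace UnivStarAlg

open StarTerm

variable {X : Type} {r : StarTerm X → StarTerm X → Prop}

instance : Zero (UnivStarAlg r) := ⟨Quot.mk _ (scalar 0)⟩

instance : One (UnivStarAlg r) := ⟨Quot.mk _ (scalar 1)⟩

instance : Add (UnivStarAlg r) := ⟨Quot.map₂ add (fun a _ _ h => .add_congr (.refl a) h)
  (fun _ _ b h => .add_congr h (.refl b))⟩

instance : Mul (UnivStarAlg r) := ⟨Quot.map₂ mul (fun a _ _ h => .mul_congr (.refl a) h)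
  (fun _ _ b h => .mul_congr h (.refl b))⟩

instance : Neg (UnivStarAlg r) :=
  ⟨Quot.map (mul (scalar (-1))) (fun _ _ h => .mul_congr (.refl _) h)⟩

instance : Ring (UnivStarAlg r) where
  nsmul := nsmulRec
  zsmul := zsmulRec
  add_assoc := by rintro ⟨a⟩ ⟨b⟩ ⟨c⟩; exact Quot.sound (.add_assoc a b c)
  add_comm := by rintro ⟨a⟩ ⟨b⟩; exact Quot.sound (.add_comm a b)
  zero_add := by rintro ⟨a⟩; exact Quot.sound (.zero_add a)
  add_zero := by rintro ⟨a⟩; exact Quot.sound (.trans (.add_comm _ _) (.zero_add a))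
  neg_add_cancel := by rintro ⟨a⟩; exact Quot.sound (.neg_add a)
  mul_assoc := by rintro ⟨a⟩ ⟨b⟩ ⟨c⟩; exact Quot.sound (.mul_assoc a b c)
  one_mul := by rintro ⟨a⟩; exact Quot.sound (.one_mul a)
  mul_one := by
    rintro ⟨a⟩; exact Quot.sound (.trans (.symm (.scalar_comm _ _)) (.one_mul a))
  left_distrib := by rintro ⟨a⟩ ⟨b⟩ ⟨c⟩; exact Quot.sound (.left_distrib a b c)
  right_distrib := by rintro ⟨a⟩ ⟨b⟩ ⟨c⟩; exact Quot.sound (.right_distrib a b c)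
  zero_mul := by
    rintro ⟨a⟩
    refine Quot.sound ?_
    have h0 : Cong r (scalar 0) (add (scalar (-1)) (scalar 1)) := by
      have := Cong.scalar_add (r := r) (-1) 1
      rwa [neg_add_cancel] at this
    exact .trans (.mul_congr h0 (.refl a)) (.trans (.right_distrib _ _ _)
      (.trans (.add_congr (.refl _) (.one_mul a)) (.neg_add a)))
  mul_zero := by
    rintro ⟨a⟩
    refine Quot.sound (.trans (.symm (.scalar_comm 0 a)) ?_)
    have h0 : Cong r (scalar 0) (add (scalar (-1)) (scalar 1)) := by
      have := Cong.scalar_add (r := r) (-1) 1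
      rwa [neg_add_cancel] at this
    exact .trans (.mul_congr h0 (.refl a)) (.trans (.right_distrib _ _ _)
      (.trans (.add_congr (.refl _) (.one_mul a)) (.neg_add a)))

instance : Algebra ℂ (UnivStarAlg r) where
  smul c a := (show UnivStarAlg r from Quot.mk _ (scalar c)) * a
  algebraMap :=
    { toFun := fun c => Quot.mk _ (scalar c)
      map_one' := rfl
      map_zero' := rfl
      map_add' := fun c d => Quot.sound (.scalar_add c d)
      map_mul' := fun c d => Quot.sound (.scalar_mul c d) }
  commutes' := by rintro c ⟨a⟩; exact Quot.sound (.scalar_comm c a)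
  smul_def' := fun _ _ => rfl

instance : StarRing (UnivStarAlg r) where
  star := Quot.map StarTerm.star (fun _ _ h => .star_congr h)
  star_involutive := by rintro ⟨a⟩; exact Quot.sound (.star_star a)
  star_mul := by rintro ⟨a⟩ ⟨b⟩; exact Quot.sound (.star_mul a b)
  star_add := by rintro ⟨a⟩ ⟨b⟩; exact Quot.sound (.star_add a b)

theorem star_algebraMap (c : ℂ) :
    star (algebraMap ℂ (UnivStarAlg r) c) = algebraMap ℂ _ (starRingEnd ℂ c) :=
  Quot.sound (.star_scalar c)

instance : StarModule ℂ (UnivStarAlg r) where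
  star_smul c a := by
    rw [Algebra.smul_def, star_mul, star_algebraMap, Algebra.smul_def, Algebra.commutes]
    rfl

/-- The generators. -/
def of (r : StarTerm X → StarTerm X → Prop) (x : X) : UnivStarAlg r := Quot.mk _ (gen x)

theorem eval_of (t : StarTerm X) : eval (of r) t = Quot.mk _ t := by
  induction t with
  | gen x => rfl
  | scalar c => rfl
  | add a b iha ihb => rw [eval, iha, ihb]; rfl
  | mul a b iha ihb => rw [eval, iha, ihb]; rfl
  | star a iha => rw [eval, iha]; rfl

theorem eval_rel {a b : StarTerm X} (h : r a b) : eval (of r) a = eval (of r) b := by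
  rw [eval_of, eval_of]; exact Quot.sound (.rel h)

theorem adjoin_of : StarAlgebra.adjoin ℂ (Set.range (of r)) = ⊤ := by
  refine eq_top_iff.2 ?_
  rintro ⟨t⟩ -
  rw [← eval_of]
  induction t with
  | gen x => exact StarAlgebra.subset_adjoin ℂ _ ⟨x, rfl⟩
  | scalar c => exact algebraMap_mem _ c
  | add a b iha ihb => exact add_mem iha ihb
  | mul a b iha ihb => exact mul_mem iha ihb
  | star a iha => exact star_mem iha

section lift

variable {B : Type*} [Ring B] [StarRing B] [Algebra ℂ B] [StarModule ℂ B]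

theorem eval_cong (f : X → B) (hf : ∀ a b, r a b → eval f a = eval f b) {a b : StarTerm X}
    (h : Cong r a b) : eval f a = eval f b := by
  induction h with
  | rel h => exact hf _ _ h
  | refl a => rfl
  | symm _ ih => exact ih.symm
  | trans _ _ ih₁ ih₂ => exact ih₁.trans ih₂
  | add_congr _ _ ih₁ ih₂ => simp only [eval, ih₁, ih₂]
  | mul_congr _ _ ih₁ ih₂ => simp only [eval, ih₁, ih₂]
  | star_congr _ ih => simp only [eval, ih]
  | add_assoc a b c => simp only [eval, _root_.add_assoc]
  | add_comm a b => simp only [eval, _root_.add_comm]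
  | zero_add a => simp [eval]
  | neg_add a => simp [eval]
  | mul_assoc a b c => simp only [eval, _root_.mul_assoc]
  | one_mul a => simp [eval]
  | left_distrib a b c => simp only [eval, mul_add]
  | right_distrib a b c => simp only [eval, add_mul]
  | scalar_add c d => simp [eval]
  | scalar_mul c d => simp [eval]
  | scalar_comm c a => simp only [eval, Algebra.commutes]
  | star_star a => simp [eval]
  | star_add a b => simp [eval]
  | star_mul a b => simp [eval]
  | star_scalar c => exact (algebraMap_star_comm c).symm

/-- The universal property: values of the generators satisfying the relations extend to a
unital star-homomorphism. -/
def lift (f : X → B) (hf : ∀ a b, r a b → eval f a = eval f b) : UnivStarAlg r →⋆ₐ[ℂ] B where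
  toFun := Quot.lift (eval f) fun _ _ h => eval_cong f hf h
  map_one' := by change algebraMap ℂ B 1 = 1; simp
  map_zero' := by change algebraMap ℂ B 0 = 0; simp
  map_mul' := by rintro ⟨a⟩ ⟨b⟩; rfl
  map_add' := by rintro ⟨a⟩ ⟨b⟩; rfl
  commutes' := fun _ => rfl
  map_star' := by rintro ⟨a⟩; rfl

@[simp]
theorem lift_of (f : X → B) (hf : ∀ a b, r a b → eval f a = eval f b) (x : X) :
    lift f hf (of r x) = f x := rfl

end lift

end UnivStarAlg

/-! ### Magic unitaries -/

/-- Magic unitaries with coefficients in a unital star-algebra. -/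
structure IsMagicUnitary {I J A : Type*} [Fintype I] [Fintype J] [Ring A] [StarRing A]
    (u : Matrix I J A) : Prop where
  idem : ∀ i j, u i j * u i j = u i j
  selfAdj : ∀ i j, star (u i j) = u i j
  row_orth : ∀ i j k, k ≠ j → u i j * u i k = 0
  col_orth : ∀ i j k, k ≠ i → u i j * u k j = 0
  col_sum : ∀ j, ∑ k, u k j = 1
  row_sum : ∀ i, ∑ k, u i k = 1

/-- The matrix with entries `∑ k, u i k ⊗ v k j`. -/
def tensorMul {I K J A B : Type*} [Fintype K] [Ring A] [Algebra ℂ A] [Ring B] [Algebra ℂ B]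
    (u : Matrix I K A) (v : Matrix K J B) : Matrix I J (A ⊗[ℂ] B) :=
  fun i j => ∑ k, u i k ⊗ₜ[ℂ] v k j

theorem IsMagicUnitary.tensor {I K J A B : Type*} [Fintype I] [Fintype K] [Fintype J]
    [Ring A] [StarRing A] [Algebra ℂ A] [StarModule ℂ A]
    [Ring B] [StarRing B] [Algebra ℂ B] [StarModule ℂ B]
    {u : Matrix I K A} {v : Matrix K J B} (hu : IsMagicUnitary u) (hv : IsMagicUnitary v) :
    IsMagicUnitary (tensorMul u v) := by
  classical
  have key1 : ∀ i j l, tensorMul u v i j * tensorMul u v i l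
      = ∑ k, u i k ⊗ₜ[ℂ] (v k j * v k l) := by
    intro i j l
    simp only [tensorMul, Finset.sum_mul_sum, Algebra.TensorProduct.tmul_mul_tmul]
    refine Finset.sum_congr rfl fun k _ => ?_
    rw [Finset.sum_eq_single k]
    · rw [hu.idem]
    · intro m _ hm; rw [hu.row_orth i k m hm, TensorProduct.zero_tmul]
    · simp
  have key2 : ∀ i j l, tensorMul u v i j * tensorMul u v l j
      = ∑ k, (u i k * u l k) ⊗ₜ[ℂ] v k j := by
    intro i j l
    simp only [tensorMul, Finset.sum_mul_sum, Algebra.TensorProduct.tmul_mul_tmul]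
    refine Finset.sum_congr rfl fun k _ => ?_
    rw [Finset.sum_eq_single k]
    · rw [hv.idem]
    · intro m _ hm; rw [hv.col_orth k j m hm, TensorProduct.tmul_zero]
    · simp
  refine ⟨?_, ?_, ?_, ?_, ?_, ?_⟩
  · intro i j; rw [key1]; simp only [hv.idem]; rfl
  · intro i j
    simp only [tensorMul, star_sum, TensorProduct.star_tmul, hu.selfAdj, hv.selfAdj]
  · intro i j l h
    rw [key1]
    exact Finset.sum_eq_zero fun k _ => by rw [hv.row_orth k j l h, TensorProduct.tmul_zero]
  · intro i j l h
    rw [key2]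
    exact Finset.sum_eq_zero fun k _ => by rw [hu.col_orth i k l h, TensorProduct.zero_tmul]
  · intro j
    simp only [tensorMul]
    rw [Finset.sum_comm]
    simp only [← TensorProduct.sum_tmul, hu.col_sum]
    rw [← TensorProduct.tmul_sum, hv.col_sum]; rfl
  · intro i
    simp only [tensorMul]
    rw [Finset.sum_comm]
    simp only [← TensorProduct.tmul_sum, hv.row_sum]
    rw [← TensorProduct.sum_tmul, hu.row_sum]; rfl

/-! ### Quantum permutation groups -/

/-- Quantum permutation groups `(A, u)`. -/
structure QPermGroup where
  /-- the finite nonempty set of indices -/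
  I : Type
  [fintypeI : Fintype I]
  [nonemptyI : Nonempty I]
  /-- the underlying unital star-algebra -/
  A : Type
  [ring : Ring A]
  [starRing : StarRing A]
  [algebra : Algebra ℂ A]
  [starModule : StarModule ℂ A]
  /-- the fundamental representation -/
  u : Matrix I I A
  magic : IsMagicUnitary u
  adjoin_u : StarAlgebra.adjoin ℂ (Set.range fun p : I × I => u p.1 p.2) = ⊤
  /-- the comultiplication -/
  Δ : A →⋆ₐ[ℂ] A ⊗[ℂ] A
  Δ_u : ∀ i j, Δ (u i j) = ∑ k, u i k ⊗ₜ[ℂ] u k j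

namespace QPermGroup

attribute [instance] fintypeI nonemptyI ring starRing algebra starModule

/-- Isomorphism of quantum groups: a star-isomorphism of the underlying algebras intertwining
the comultiplications (it need not map one fundamental representation to the other). -/
def Isomorphic (P Q : QPermGroup) : Prop :=
  ∃ φ : P.A ≃⋆ₐ[ℂ] Q.A, ∀ a : P.A,
    Algebra.TensorProduct.map (φ : P.A →⋆ₐ[ℂ] Q.A).toAlgHom (φ : P.A →⋆ₐ[ℂ] Q.A).toAlgHom (P.Δ a)
      = Q.Δ (φ a)

/-- The trivial quantum group, with algebra `ℂ`. -/
def trivial : QPermGroup where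
  I := Unit
  A := ℂ
  u := fun _ _ => 1
  magic := by constructor <;> simp
  adjoin_u := by
    refine eq_top_iff.2 fun c _ => ?_
    exact algebraMap_mem (StarAlgebra.adjoin ℂ _) c
  Δ :=
    { Algebra.ofId ℂ (ℂ ⊗[ℂ] ℂ) with
      map_star' := fun c => by
        change algebraMap ℂ (ℂ ⊗[ℂ] ℂ) (star c) = star (algebraMap ℂ (ℂ ⊗[ℂ] ℂ) c)
        exact algebraMap_star_comm c }
  Δ_u := by
    intro i j
    change algebraMap ℂ (ℂ ⊗[ℂ] ℂ) 1 = _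
    simp

end QPermGroup

/-- The relations saying that `e : A → X` becomes a unital star-homomorphism from the
star-algebra `A` to the star-algebra presented by generators `X`. -/
inductive StarHomRel {A X : Type} [Ring A] [StarRing A] [Algebra ℂ A] (e : A → X) :
    StarTerm X → StarTerm X → Prop
  | scalar (c : ℂ) : StarHomRel e (.gen (e (algebraMap ℂ A c))) (.scalar c)
  | add (a b : A) : StarHomRel e (.gen (e (a + b))) (.add (.gen (e a)) (.gen (e b)))
  | mul (a b : A) : StarHomRel e (.gen (e (a * b))) (.mul (.gen (e a)) (.gen (e b)))
  | star (a : A) : StarHomRel e (.gen (e (star a))) (.star (.gen (e a)))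

/-- If the relations `StarHomRel e` are imposed, the generators `e a` come from a
star-homomorphism. -/
def StarHomRel.hom {A X : Type} [Ring A] [StarRing A] [Algebra ℂ A] {e : A → X}
    {r : StarTerm X → StarTerm X → Prop} (h : ∀ a b, StarHomRel e a b → r a b) :
    A →⋆ₐ[ℂ] UnivStarAlg r where
  toFun a := .of r (e a)
  map_one' := by
    have := UnivStarAlg.eval_rel (h _ _ (.scalar 1))
    simpa only [StarTerm.eval, map_one] using this
  map_zero' := by
    have := UnivStarAlg.eval_rel (h _ _ (.scalar 0))
    simpa only [StarTerm.eval, map_zero] using this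
  map_mul' a b := UnivStarAlg.eval_rel (h _ _ (.mul a b))
  map_add' a b := UnivStarAlg.eval_rel (h _ _ (.add a b))
  commutes' c := UnivStarAlg.eval_rel (h _ _ (.scalar c))
  map_star' a := UnivStarAlg.eval_rel (h _ _ (.star a))

theorem StarHomRel.eval_eq {A X : Type} [Ring A] [StarRing A] [Algebra ℂ A] {e : A → X}
    {B : Type*} [Ring B] [StarRing B] [Algebra ℂ B] {f : X → B} (g : A →⋆ₐ[ℂ] B)
    (hg : ∀ a, f (e a) = g a) {a b : StarTerm X} (h : StarHomRel e a b) :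
    StarTerm.eval f a = StarTerm.eval f b := by
  cases h with
  | scalar c => simp only [StarTerm.eval, hg]; exact AlgHomClass.commutes g c
  | add a b => simp only [StarTerm.eval, hg, map_add]
  | mul a b => simp only [StarTerm.eval, hg, map_mul]
  | star a => simp only [StarTerm.eval, hg, map_star]

/-- The tensor product of two unital star-homomorphisms. -/
def tensorMap {A A' B B' : Type} [Ring A] [StarRing A] [Algebra ℂ A] [StarModule ℂ A]
    [Ring A'] [StarRing A'] [Algebra ℂ A'] [StarModule ℂ A']
    [Ring B] [StarRing B] [Algebra ℂ B] [StarModule ℂ B]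
    [Ring B'] [StarRing B'] [Algebra ℂ B'] [StarModule ℂ B']
    (f : A →⋆ₐ[ℂ] A') (g : B →⋆ₐ[ℂ] B') : A ⊗[ℂ] B →⋆ₐ[ℂ] A' ⊗[ℂ] B' :=
  { Algebra.TensorProduct.map f.toAlgHom g.toAlgHom with
    map_star' := fun t => by
      change Algebra.TensorProduct.map f.toAlgHom g.toAlgHom (star t)
        = star (Algebra.TensorProduct.map f.toAlgHom g.toAlgHom t)
      induction t with
      | zero => simp
      | tmul a b => simp [map_star]
      | add x y hx hy => simp only [star_add, map_add, hx, hy] }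

@[simp]
theorem tensorMap_tmul {A A' B B' : Type} [Ring A] [StarRing A] [Algebra ℂ A] [StarModule ℂ A]
    [Ring A'] [StarRing A'] [Algebra ℂ A'] [StarModule ℂ A']
    [Ring B] [StarRing B] [Algebra ℂ B] [StarModule ℂ B]
    [Ring B'] [StarRing B'] [Algebra ℂ B'] [StarModule ℂ B']
    (f : A →⋆ₐ[ℂ] A') (g : B →⋆ₐ[ℂ] B') (a : A) (b : B) :
    tensorMap f g (a ⊗ₜ b) = f a ⊗ₜ g b := rfl

namespace QPermGroup

/-! ### Free products -/

/-- The relations of the free product (coproduct) of the two unital star-algebras. -/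
inductive FreeProdRel (P Q : QPermGroup) :
    StarTerm (P.A ⊕ Q.A) → StarTerm (P.A ⊕ Q.A) → Prop
  | left {a b} : StarHomRel (Sum.inl : P.A → P.A ⊕ Q.A) a b → FreeProdRel P Q a b
  | right {a b} : StarHomRel (Sum.inr : Q.A → P.A ⊕ Q.A) a b → FreeProdRel P Q a b

section freeProd

variable (P Q : QPermGroup)

def freeProdInl : P.A →⋆ₐ[ℂ] UnivStarAlg (FreeProdRel P Q) := StarHomRel.hom fun _ _ => .left

def freeProdInr : Q.A →⋆ₐ[ℂ] UnivStarAlg (FreeProdRel P Q) := StarHomRel.hom fun _ _ => .right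

/-- The free product of two quantum permutation groups: the coproduct of the algebras, with
fundamental representation `Diag(u, v)` and the comultiplication extending the two given
ones. -/
def freeProd : QPermGroup where
  I := P.I ⊕ Q.I
  A := UnivStarAlg (FreeProdRel P Q)
  u := Matrix.fromBlocks (P.u.map (freeProdInl P Q)) 0 0 (Q.u.map (freeProdInr P Q))
  magic := by
    refine ⟨?_, ?_, ?_, ?_, ?_, ?_⟩
    · rintro (i | i) (j | j) <;> simp [← map_mul, P.magic.idem, Q.magic.idem]
    · rintro (i | i) (j | j) <;> simp [← map_star, P.magic.selfAdj, Q.magic.selfAdj]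
    · rintro (i | i) (j | j) (k | k) h <;> simp [← map_mul]
      · rw [P.magic.row_orth i j k (fun e => h (by rw [e])), map_zero]
      · rw [Q.magic.row_orth i j k (fun e => h (by rw [e])), map_zero]
    · rintro (i | i) (j | j) (k | k) h <;> simp [← map_mul]
      · rw [P.magic.col_orth i j k (fun e => h (by rw [e])), map_zero]
      · rw [Q.magic.col_orth i j k (fun e => h (by rw [e])), map_zero]
    · rintro (j | j) <;> simp [← map_sum, P.magic.col_sum, Q.magic.col_sum]
    · rintro (j | j) <;> simp [← map_sum, P.magic.row_sum, Q.magic.row_sum]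
  adjoin_u := by
    rw [eq_top_iff, ← UnivStarAlg.adjoin_of]
    refine StarAlgebra.adjoin_le ?_
    rintro _ ⟨a | a, rfl⟩
    · have h : a ∈ StarAlgebra.adjoin ℂ (Set.range fun p : P.I × P.I => P.u p.1 p.2) := by
        rw [P.adjoin_u]; exact StarSubalgebra.mem_top
      have h2 := (StarSubalgebra.mem_map (f := freeProdInl P Q)).2 ⟨a, h, rfl⟩
      rw [StarAlgHom.map_adjoin] at h2
      refine StarAlgebra.adjoin_mono ?_ h2
      rintro _ ⟨_, ⟨p, rfl⟩, rfl⟩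
      exact ⟨(.inl p.1, .inl p.2), rfl⟩
    · have h : a ∈ StarAlgebra.adjoin ℂ (Set.range fun p : Q.I × Q.I => Q.u p.1 p.2) := by
        rw [Q.adjoin_u]; exact StarSubalgebra.mem_top
      have h2 := (StarSubalgebra.mem_map (f := freeProdInr P Q)).2 ⟨a, h, rfl⟩
      rw [StarAlgHom.map_adjoin] at h2
      refine StarAlgebra.adjoin_mono ?_ h2
      rintro _ ⟨_, ⟨p, rfl⟩, rfl⟩
      exact ⟨(.inr p.1, .inr p.2), rfl⟩
  Δ := UnivStarAlg.lift
    (Sum.elim (fun a => tensorMap (freeProdInl P Q) (freeProdInl P Q) (P.Δ a))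
      (fun a => tensorMap (freeProdInr P Q) (freeProdInr P Q) (Q.Δ a)))
    (by
      rintro a b (h | h)
      · refine StarHomRel.eval_eq (e := Sum.inl) ((tensorMap (freeProdInl P Q) (freeProdInl P Q)).comp P.Δ)
          (fun _ => rfl) h
      · refine StarHomRel.eval_eq (e := Sum.inr) ((tensorMap (freeProdInr P Q) (freeProdInr P Q)).comp Q.Δ)
          (fun _ => rfl) h)
  Δ_u := by
    rintro (i | i) (j | j)
    · change tensorMap (freeProdInl P Q) (freeProdInl P Q) (P.Δ (P.u i j)) = _
      simp [P.Δ_u]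
    · simp
    · simp
    · change tensorMap (freeProdInr P Q) (freeProdInr P Q) (Q.Δ (Q.u i j)) = _
      simp [Q.Δ_u]

end freeProd

end QPermGroup

/-! ### Finite graphs, quantum isomorphisms and quantum automorphism groups -/

/-- Finite simple graphs with at least one vertex. -/
structure FinGraph where
  V : Type
  [fintypeV : Fintype V]
  [nonemptyV : Nonempty V]
  graph : SimpleGraph V

attribute [instance] FinGraph.fintypeV FinGraph.nonemptyV

namespace FinGraph

open scoped Classical in
/-- The adjacency matrix, with coefficients in `R`. -/
def adj (G : FinGraph) (R : Type*) [Ring R] : Matrix G.V G.V R :=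
  fun x y => if G.graph.Adj x y then 1 else 0

/-- Quantum isomorphism: there is a magic unitary, with coefficients in a nonzero unital
C⋆-algebra, intertwining the adjacency matrices. -/
def QuantumIsomorphic (G H : FinGraph) : Prop :=
  ∃ (X : Type w) (_ : CStarAlgebra X) (_ : Nontrivial X) (U : Matrix H.V G.V X),
    IsMagicUnitary U ∧ U * G.adj X = H.adj X * U

/-- The relations defining the quantum automorphism group of `G`, in generators `(x, y)`:
the matrix of generators is a magic unitary and commutes with the adjacency matrix. -/
inductive QuRel (G : FinGraph) : StarTerm (G.V × G.V) → StarTerm (G.V × G.V) → Prop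
  | idem (x y : G.V) : QuRel G (.mul (.gen (x, y)) (.gen (x, y))) (.gen (x, y))
  | selfAdj (x y : G.V) : QuRel G (.star (.gen (x, y))) (.gen (x, y))
  | row_orth (x y z : G.V) : z ≠ y → QuRel G (.mul (.gen (x, y)) (.gen (x, z))) (.scalar 0)
  | col_orth (x y z : G.V) : z ≠ x → QuRel G (.mul (.gen (x, y)) (.gen (z, y))) (.scalar 0)
  | col_sum (y : G.V) : QuRel G (.sum fun z => .gen (z, y)) (.scalar 1)
  | row_sum (x : G.V) : QuRel G (.sum fun z => .gen (x, z)) (.scalar 1)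
  | comm (x y : G.V) : QuRel G (.sum fun z => .mul (.gen (x, z)) (.scalar (G.adj ℂ z y)))
      (.sum fun z => .mul (.scalar (G.adj ℂ x z)) (.gen (z, y)))

theorem algebraMap_adj (G : FinGraph) (B : Type*) [Ring B] [Algebra ℂ B] (x y : G.V) :
    algebraMap ℂ B (G.adj ℂ x y) = G.adj B x y := by
  unfold adj; split_ifs <;> simp

theorem QuRel.eval_eq {G : FinGraph} {B : Type*} [Ring B] [StarRing B] [Algebra ℂ B]
    {W : Matrix G.V G.V B} (hW : IsMagicUnitary W) (hc : W * G.adj B = G.adj B * W)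
    {a b : StarTerm (G.V × G.V)} (h : QuRel G a b) :
    StarTerm.eval (fun p => W p.1 p.2) a = StarTerm.eval (fun p => W p.1 p.2) b := by
  cases h with
  | idem x y => exact hW.idem x y
  | selfAdj x y => exact hW.selfAdj x y
  | row_orth x y z h => simpa [StarTerm.eval] using hW.row_orth x y z h
  | col_orth x y z h => simpa [StarTerm.eval] using hW.col_orth x y z h
  | col_sum y => simpa [StarTerm.eval, StarTerm.eval_sum] using hW.col_sum y
  | row_sum x => simpa [StarTerm.eval, StarTerm.eval_sum] using hW.row_sum x
  | comm x y =>
    have := congrFun (congrFun hc x) y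
    simpa [StarTerm.eval, StarTerm.eval_sum, algebraMap_adj, Matrix.mul_apply] using this

/-- The matrix of generators. -/
def quMatrix (G : FinGraph) : Matrix G.V G.V (UnivStarAlg (QuRel G)) :=
  fun x y => .of _ (x, y)

theorem quMatrix_magic (G : FinGraph) : IsMagicUnitary G.quMatrix where
  idem x y := UnivStarAlg.eval_rel (QuRel.idem x y)
  selfAdj x y := UnivStarAlg.eval_rel (QuRel.selfAdj x y)
  row_orth x y z h := by
    simpa [quMatrix, StarTerm.eval] using UnivStarAlg.eval_rel (QuRel.row_orth x y z h)
  col_orth x y z h := by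
    simpa [quMatrix, StarTerm.eval] using UnivStarAlg.eval_rel (QuRel.col_orth x y z h)
  col_sum y := by
    simpa [quMatrix, StarTerm.eval, StarTerm.eval_sum] using UnivStarAlg.eval_rel (QuRel.col_sum y)
  row_sum x := by
    simpa [quMatrix, StarTerm.eval, StarTerm.eval_sum] using UnivStarAlg.eval_rel (QuRel.row_sum x)

theorem quMatrix_comm (G : FinGraph) : G.quMatrix * G.adj _ = G.adj _ * G.quMatrix := by
  ext x y
  have := UnivStarAlg.eval_rel (QuRel.comm x y)
  simpa [quMatrix, StarTerm.eval, StarTerm.eval_sum, algebraMap_adj, Matrix.mul_apply] using this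

theorem tensorMul_comm (G : FinGraph) {A B : Type*} [Ring A] [Algebra ℂ A] [Ring B]
    [Algebra ℂ B] {u : Matrix G.V G.V A} {v : Matrix G.V G.V B}
    (hu : u * G.adj A = G.adj A * u) (hv : v * G.adj B = G.adj B * v) :
    tensorMul u v * G.adj _ = G.adj _ * tensorMul u v := by
  let l : A →ₐ[ℂ] A ⊗[ℂ] B := Algebra.TensorProduct.includeLeft
  let k : B →ₐ[ℂ] A ⊗[ℂ] B := Algebra.TensorProduct.includeRight
  have e : tensorMul u v = u.map l * v.map k := by
    ext x y
    simp [tensorMul, Matrix.mul_apply, l, k]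
  have hl : (G.adj A).map l = G.adj (A ⊗[ℂ] B) := by
    ext x y; rw [Matrix.map_apply, ← algebraMap_adj, AlgHom.commutes, algebraMap_adj]
  have hk : (G.adj B).map k = G.adj (A ⊗[ℂ] B) := by
    ext x y; rw [Matrix.map_apply, ← algebraMap_adj, AlgHom.commutes, algebraMap_adj]
  rw [e, Matrix.mul_assoc, ← hk, ← Matrix.map_mul, hv, Matrix.map_mul, hk, ← Matrix.mul_assoc,
    ← hl, ← Matrix.map_mul, hu, Matrix.map_mul, hl, Matrix.mul_assoc]

/-- The quantum automorphism group of a graph. -/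
def qu (G : FinGraph) : QPermGroup where
  I := G.V
  A := UnivStarAlg (QuRel G)
  u := G.quMatrix
  magic := G.quMatrix_magic
  adjoin_u := UnivStarAlg.adjoin_of
  Δ := UnivStarAlg.lift (fun p => tensorMul G.quMatrix G.quMatrix p.1 p.2) fun _ _ h =>
    h.eval_eq (G.quMatrix_magic.tensor G.quMatrix_magic)
      (G.tensorMul_comm G.quMatrix_comm G.quMatrix_comm)
  Δ_u := fun _ _ => rfl

end FinGraph

namespace QPermGroup

/-! ### Free wreath products with the quantum permutation groups `S_n⁺` -/

/-- The quantum permutation group `S_n⁺`, `n ≥ 1`: the quantum automorphism group of the graph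
with `n` vertices and no edges. -/
def symPlus (n : ℕ) [NeZero n] : QPermGroup := FinGraph.qu ⟨Fin n, ⊥⟩

/-- The relations of the free wreath product of `P` by `S_n⁺`: the generators `(i, a)` form `n`
free copies `ν i` of the algebra of `P`, the other generators form a free copy of the algebra of
`S_n⁺`, and `ν i a` commutes with `s i j`. -/
inductive FreeWreathRel (P : QPermGroup) (n : ℕ) [NeZero n] :
    StarTerm ((Fin n × P.A) ⊕ (symPlus n).A) → StarTerm ((Fin n × P.A) ⊕ (symPlus n).A) → Prop
  | copy (i : Fin n) {a b} :
      StarHomRel (fun a : P.A => (Sum.inl (i, a) : (Fin n × P.A) ⊕ (symPlus n).A)) a b →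
      FreeWreathRel P n a b
  | perm {a b} :
      StarHomRel (Sum.inr : (symPlus n).A → (Fin n × P.A) ⊕ (symPlus n).A) a b →
      FreeWreathRel P n a b
  | comm (i j : Fin n) (a : P.A) :
      FreeWreathRel P n (.mul (.gen (.inl (i, a))) (.gen (.inr ((symPlus n).u i j))))
        (.mul (.gen (.inr ((symPlus n).u i j))) (.gen (.inl (i, a))))

section freeWreath

variable (P : QPermGroup) (n : ℕ) [NeZero n]

/-- The `i`-th copy of the algebra of `P` in the free wreath product. -/
def wreathCopy (i : Fin n) : P.A →⋆ₐ[ℂ] UnivStarAlg (FreeWreathRel P n) :=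
  StarHomRel.hom fun _ _ => .copy i

/-- The copy of the algebra of `S_n⁺` in the free wreath product. -/
def wreathPerm : (symPlus n).A →⋆ₐ[ℂ] UnivStarAlg (FreeWreathRel P n) :=
  StarHomRel.hom fun _ _ => .perm

/-- The image of the fundamental representation of `S_n⁺`. -/
def wreathS (i j : Fin n) : UnivStarAlg (FreeWreathRel P n) := wreathPerm P n ((symPlus n).u i j)

variable {P n}

theorem wreath_comm (i j : Fin n) (a : P.A) :
    wreathCopy P n i a * wreathS P n i j = wreathS P n i j * wreathCopy P n i a :=
  UnivStarAlg.eval_rel (FreeWreathRel.comm i j a)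

theorem wreathS_magic :
    IsMagicUnitary (wreathS P n : Matrix (Fin n) (Fin n) (UnivStarAlg (FreeWreathRel P n))) where
  idem i j := by rw [wreathS, ← map_mul, (symPlus n).magic.idem i j]
  selfAdj i j := by rw [wreathS, ← map_star, (symPlus n).magic.selfAdj i j]
  row_orth i j k h := by
    rw [wreathS, wreathS, ← map_mul, (symPlus n).magic.row_orth i j k h, map_zero]
  col_orth i j k h := by
    rw [wreathS, wreathS, ← map_mul, (symPlus n).magic.col_orth i j k h, map_zero]
  col_sum j := by
    have := congrArg (wreathPerm P n) ((symPlus n).magic.col_sum j)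
    rwa [map_sum, map_one] at this
  row_sum i := by
    have := congrArg (wreathPerm P n) ((symPlus n).magic.row_sum i)
    rwa [map_sum, map_one] at this

theorem tensor_wreath_comm (i k : Fin n) (t : P.A ⊗[ℂ] P.A) :
    tensorMap (wreathCopy P n i) (wreathCopy P n k) t * (wreathS P n i k ⊗ₜ 1)
      = (wreathS P n i k ⊗ₜ 1) * tensorMap (wreathCopy P n i) (wreathCopy P n k) t := by
  induction t with
  | zero => simp
  | tmul a b => simp [wreath_comm]
  | add x y hx hy => rw [map_add, add_mul, mul_add, hx, hy]

theorem wreathS_tmul_mul (i k l : Fin n) :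
    (wreathS P n i k ⊗ₜ[ℂ] (1 : UnivStarAlg (FreeWreathRel P n)))
        * (wreathS P n i l ⊗ₜ[ℂ] (1 : UnivStarAlg (FreeWreathRel P n)))
      = if k = l then wreathS P n i k ⊗ₜ[ℂ] 1 else 0 := by
  split_ifs with h
  · subst h; simp [wreathS_magic.idem]
  · simp [wreathS_magic.row_orth i k l (Ne.symm h)]

variable (P n)

/-- The comultiplication on the `i`-th copy:
`ν i a ↦ ∑ k, (ν i ⊗ ν k)(Δ a) (s i k ⊗ 1)`. -/
def wreathCopyΔ (i : Fin n) :
    P.A →⋆ₐ[ℂ] UnivStarAlg (FreeWreathRel P n) ⊗[ℂ] UnivStarAlg (FreeWreathRel P n) where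
  toFun a := ∑ k, tensorMap (wreathCopy P n i) (wreathCopy P n k) (P.Δ a)
    * (wreathS P n i k ⊗ₜ 1)
  map_one' := by
    simp only [map_one, one_mul]
    rw [← TensorProduct.sum_tmul, wreathS_magic.row_sum]; rfl
  map_zero' := by simp
  map_mul' a b := by
    rw [Finset.sum_mul_sum]
    refine Finset.sum_congr rfl fun k _ => ?_
    rw [Finset.sum_eq_single k]
    · rw [mul_assoc, ← mul_assoc (wreathS P n i k ⊗ₜ 1), ← tensor_wreath_comm,
        mul_assoc _ (wreathS P n i k ⊗ₜ 1), wreathS_tmul_mul, if_pos rfl, ← mul_assoc, ← map_mul,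
        ← map_mul]
    · intro l _ hl
      rw [tensor_wreath_comm i l, mul_assoc, ← mul_assoc (wreathS P n i k ⊗ₜ 1), wreathS_tmul_mul,
        if_neg (Ne.symm hl), zero_mul, mul_zero]
    · simp
  map_add' a b := by simp only [map_add, add_mul, Finset.sum_add_distrib]
  commutes' c := by
    simp only [AlgHomClass.commutes]
    rw [← Finset.mul_sum, ← TensorProduct.sum_tmul, wreathS_magic.row_sum]
    exact mul_one _
  map_star' a := by
    rw [star_sum]
    refine Finset.sum_congr rfl fun k _ => ?_
    rw [star_mul, TensorProduct.star_tmul, wreathS_magic.selfAdj, star_one, map_star, map_star,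
      ← map_star, ← map_star, tensor_wreath_comm]

/-- The comultiplication on the copy of `S_n⁺`. -/
def wreathPermΔ : (symPlus n).A →⋆ₐ[ℂ]
    UnivStarAlg (FreeWreathRel P n) ⊗[ℂ] UnivStarAlg (FreeWreathRel P n) :=
  (tensorMap (wreathPerm P n) (wreathPerm P n)).comp (symPlus n).Δ

theorem wreathPermΔ_u (i j : Fin n) :
    wreathPermΔ P n ((symPlus n).u i j) = ∑ k, wreathS P n i k ⊗ₜ wreathS P n k j := by
  have h : (symPlus n).Δ ((symPlus n).u i j)
    = ∑ k : Fin n, (symPlus n).u i k ⊗ₜ (symPlus n).u k j := (symPlus n).Δ_u i j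
  rw [wreathPermΔ, StarAlgHom.comp_apply, h, map_sum]
  rfl

theorem wreathΔ_comm (i j : Fin n) (a : P.A) :
    wreathCopyΔ P n i a * wreathPermΔ P n ((symPlus n).u i j)
      = wreathPermΔ P n ((symPlus n).u i j) * wreathCopyΔ P n i a := by
  have key : ∀ (k : Fin n) (t : P.A ⊗[ℂ] P.A),
      tensorMap (wreathCopy P n i) (wreathCopy P n k) t * (wreathS P n i k ⊗ₜ wreathS P n k j)
      = (wreathS P n i k ⊗ₜ wreathS P n k j)
        * tensorMap (wreathCopy P n i) (wreathCopy P n k) t := by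
    intro k t
    induction t with
    | zero => simp
    | tmul a b => simp [wreath_comm]
    | add x y hx hy => rw [map_add, add_mul, mul_add, hx, hy]
  have e1 : ∀ k l : Fin n, (wreathS P n i k ⊗ₜ[ℂ] (1 : UnivStarAlg (FreeWreathRel P n)))
      * (wreathS P n i l ⊗ₜ[ℂ] wreathS P n l j)
      = if k = l then wreathS P n i k ⊗ₜ[ℂ] wreathS P n k j else 0 := by
    intro k l
    split_ifs with h
    · subst h; simp [wreathS_magic.idem]
    · simp [wreathS_magic.row_orth i k l (Ne.symm h)]
  have e2 : ∀ k l : Fin n, (wreathS P n i l ⊗ₜ[ℂ] wreathS P n l j)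
      * (wreathS P n i k ⊗ₜ[ℂ] (1 : UnivStarAlg (FreeWreathRel P n)))
      = if k = l then wreathS P n i k ⊗ₜ[ℂ] wreathS P n k j else 0 := by
    intro k l
    split_ifs with h
    · subst h; simp [wreathS_magic.idem]
    · simp [wreathS_magic.row_orth i l k h]
  rw [wreathPermΔ_u]
  change (∑ k, tensorMap (wreathCopy P n i) (wreathCopy P n k) (P.Δ a) * (wreathS P n i k ⊗ₜ 1))
      * _ = _ * (∑ k, tensorMap (wreathCopy P n i) (wreathCopy P n k) (P.Δ a)
        * (wreathS P n i k ⊗ₜ 1))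
  rw [Finset.sum_mul_sum, Finset.sum_mul_sum, Finset.sum_comm (s := Finset.univ (α := Fin n))]
  refine Finset.sum_congr rfl fun l _ => Finset.sum_congr rfl fun k _ => ?_
  rw [mul_assoc, e1]
  conv_rhs => rw [tensor_wreath_comm, ← mul_assoc, e2]
  split_ifs with h
  · subst h; exact key k _
  · simp

/-- The free wreath product of `P` by `S_n⁺`. Its fundamental representation has the
coefficients `s i j * ν i (u x y)`, and its comultiplication is determined by
`Δ (ν i a) = ∑ k, (ν i ⊗ ν k)(Δ a) (s i k ⊗ 1)` and `Δ (s i j) = ∑ k, s i k ⊗ s k j`. -/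
def freeWreath : QPermGroup where
  I := Fin n × P.I
  A := UnivStarAlg (FreeWreathRel P n)
  u := fun p q => wreathS P n p.1 q.1 * wreathCopy P n p.1 (P.u p.2 q.2)
  magic := by
    have aux : ∀ (i j k : Fin n) (a b : P.A),
        (wreathS P n i j * wreathCopy P n i a) * (wreathS P n i k * wreathCopy P n i b)
          = (wreathS P n i j * wreathS P n i k) * wreathCopy P n i (a * b) := by
      intro i j k a b
      rw [mul_assoc, ← mul_assoc (wreathCopy P n i a), wreath_comm, map_mul]
      simp only [mul_assoc]
    refine ⟨?_, ?_, ?_, ?_, ?_, ?_⟩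
    · rintro ⟨i, x⟩ ⟨j, y⟩
      simp only [aux, wreathS_magic.idem, P.magic.idem]
    · rintro ⟨i, x⟩ ⟨j, y⟩
      simp only [star_mul, ← map_star, P.magic.selfAdj, wreathS_magic.selfAdj, wreath_comm]
    · rintro ⟨i, x⟩ ⟨j, y⟩ ⟨k, z⟩ h
      simp only [aux]
      by_cases hk : k = j
      · subst hk
        rw [P.magic.row_orth x y z (fun e => h (by rw [e])), map_zero, mul_zero]
      · rw [wreathS_magic.row_orth i j k hk, zero_mul]
    · rintro ⟨i, x⟩ ⟨j, y⟩ ⟨k, z⟩ h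
      by_cases hk : k = i
      · subst hk
        simp only [aux]
        rw [P.magic.col_orth x y z (fun e => h (by rw [e])), map_zero, mul_zero]
      · simp only
        rw [← wreath_comm, mul_assoc, ← mul_assoc (wreathS P n i j),
          wreathS_magic.col_orth i j k hk, zero_mul, mul_zero]
    · rintro ⟨j, y⟩
      simp only [Fintype.sum_prod_type, ← Finset.mul_sum, ← map_sum, P.magic.col_sum, map_one,
        mul_one, wreathS_magic.col_sum]
    · rintro ⟨i, x⟩
      simp only [Fintype.sum_prod_type, ← Finset.mul_sum, ← map_sum, P.magic.row_sum, map_one,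
        mul_one, wreathS_magic.row_sum]
  adjoin_u := by
    set S := StarAlgebra.adjoin ℂ (Set.range fun p : (Fin n × P.I) × (Fin n × P.I) =>
      wreathS P n p.1.1 p.2.1 * wreathCopy P n p.1.1 (P.u p.1.2 p.2.2)) with hS
    have hmem : ∀ i j x y, wreathS P n i j * wreathCopy P n i (P.u x y) ∈ S := fun i j x y =>
      StarAlgebra.subset_adjoin ℂ _ ⟨((i, x), (j, y)), rfl⟩
    have hs : ∀ i j, wreathS P n i j ∈ S := by
      intro i j
      obtain ⟨x⟩ := P.nonemptyI
      have h : ∑ y, wreathS P n i j * wreathCopy P n i (P.u x y) = wreathS P n i j := by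
        rw [← Finset.mul_sum, ← map_sum, P.magic.row_sum, map_one, mul_one]
      rw [← h]
      exact sum_mem fun y _ => hmem i j x y
    have hu : ∀ i x y, wreathCopy P n i (P.u x y) ∈ S := by
      intro i x y
      have h : ∑ j, wreathS P n i j * wreathCopy P n i (P.u x y) = wreathCopy P n i (P.u x y) := by
        rw [← Finset.sum_mul, wreathS_magic.row_sum, one_mul]
      rw [← h]
      exact sum_mem fun j _ => hmem i j x y
    rw [eq_top_iff, ← UnivStarAlg.adjoin_of]
    refine StarAlgebra.adjoin_le ?_
    rintro _ ⟨⟨i, a⟩ | a, rfl⟩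
    · have h : a ∈ StarAlgebra.adjoin ℂ (Set.range fun p : P.I × P.I => P.u p.1 p.2) := by
        rw [P.adjoin_u]; exact StarSubalgebra.mem_top
      have h2 := (StarSubalgebra.mem_map (f := wreathCopy P n i)).2 ⟨a, h, rfl⟩
      rw [StarAlgHom.map_adjoin] at h2
      refine StarAlgebra.adjoin_le ?_ h2
      rintro _ ⟨_, ⟨p, rfl⟩, rfl⟩
      exact hu i p.1 p.2
    · have h : a ∈ StarAlgebra.adjoin ℂ
          (Set.range fun p : (symPlus n).I × (symPlus n).I => (symPlus n).u p.1 p.2) := by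
        rw [(symPlus n).adjoin_u]; exact StarSubalgebra.mem_top
      have h2 := (StarSubalgebra.mem_map (f := wreathPerm P n)).2 ⟨a, h, rfl⟩
      rw [StarAlgHom.map_adjoin] at h2
      refine StarAlgebra.adjoin_le ?_ h2
      rintro _ ⟨_, ⟨p, rfl⟩, rfl⟩
      exact hs p.1 p.2
  Δ := UnivStarAlg.lift (Sum.elim (fun p => wreathCopyΔ P n p.1 p.2) (wreathPermΔ P n)) (by
    rintro a b (⟨i, h⟩ | h | ⟨i, j, a⟩)
    · refine StarHomRel.eval_eq (e := fun a => Sum.inl (i, a)) (wreathCopyΔ P n i) (fun _ => rfl) h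
    · refine StarHomRel.eval_eq (e := Sum.inr) (wreathPermΔ P n) (fun _ => rfl) h
    · exact wreathΔ_comm P n i j a)
  Δ_u := by
    rintro ⟨i, x⟩ ⟨j, y⟩
    rw [map_mul]
    change wreathPermΔ P n ((symPlus n).u i j) * wreathCopyΔ P n i (P.u x y) = _
    rw [← wreathΔ_comm, wreathPermΔ_u]
    change (∑ k, tensorMap (wreathCopy P n i) (wreathCopy P n k) (P.Δ (P.u x y))
      * (wreathS P n i k ⊗ₜ 1)) * _ = _
    rw [Finset.sum_mul_sum, Fintype.sum_prod_type]
    refine Finset.sum_congr rfl fun k _ => ?_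
    rw [Finset.sum_eq_single k]
    · rw [mul_assoc, Algebra.TensorProduct.tmul_mul_tmul, wreathS_magic.idem, one_mul, P.Δ_u,
        map_sum, Finset.sum_mul]
      refine Finset.sum_congr rfl fun z _ => ?_
      simp [wreath_comm]
    · intro l _ hl
      rw [mul_assoc, Algebra.TensorProduct.tmul_mul_tmul, wreathS_magic.row_orth i k l hl,
        TensorProduct.zero_tmul, mul_zero]
    · simp

end freeWreath

end QPermGroup

/-- The closure of a family of quantum permutation groups under (isomorphism and) free products
and free wreath products with the quantum permutation groups `S_n⁺`, `n ≥ 1`. -/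
inductive JorPlus (F : Set QPermGroup) : QPermGroup → Prop
  | of {P : QPermGroup} : P ∈ F → JorPlus F P
  | iso {P Q : QPermGroup} : P.Isomorphic Q → JorPlus F P → JorPlus F Q
  | freeProd {P Q : QPermGroup} : JorPlus F P → JorPlus F Q → JorPlus F (P.freeProd Q)
  | freeWreath {P : QPermGroup} (n : ℕ) [NeZero n] : JorPlus F P → JorPlus F (P.freeWreath n)

/-- The wreath product of a group by the symmetric group `S_n` acting on `{1, …, n}`:
`n`-tuples of elements of the group, semidirect the group of all permutations of the
coordinates. -/
abbrev WreathSym (Γ : Type) [Group Γ] (n : ℕ) : Type :=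
  (Fin n → Γ) ⋊[mulAutArrow] Equiv.Perm (Fin n)

/-- The closure of a family of groups under (isomorphism and) cartesian products and wreath
products with the symmetric groups `S_n`, `n ≥ 1`. -/
inductive Jor (E : Set GrpCat.{0}) : GrpCat.{0} → Prop
  | of {Γ : GrpCat.{0}} : Γ ∈ E → Jor E Γ
  | iso {Γ Λ : GrpCat.{0}} : Nonempty (Γ ≃* Λ) → Jor E Γ → Jor E Λ
  | prod {Γ Λ : GrpCat.{0}} : Jor E Γ → Jor E Λ → Jor E (GrpCat.of (Γ × Λ))
  | wreath {Γ : GrpCat.{0}} (n : ℕ) [NeZero n] : Jor E Γ → Jor E (GrpCat.of (WreathSym Γ n))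

namespace FinGraph

/-! ### Block graphs and block-cographs -/

/-- A graph is 2-connected if it is connected and stays connected when any one vertex is removed
(graphs with one vertex, and the complete graph on two vertices, count as 2-connected). -/
def IsTwoConnected {V : Type} (G : SimpleGraph V) : Prop :=
  G.Preconnected ∧ ∀ v : V, (G.induce {v}ᶜ).Preconnected

/-- A block is a maximal 2-connected subgraph. -/
def IsBlock {V : Type} {G : SimpleGraph V} (B : G.Subgraph) : Prop :=
  Maximal (fun H : G.Subgraph => IsTwoConnected H.coe) B

/-- Block graphs: all blocks are complete. -/
def blockGraphs : Set FinGraph :=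
  {G | ∀ B : G.graph.Subgraph, IsBlock B → B.coe = ⊤}

/-- The smallest family containing `F` and stable by (isomorphism,) complement and disjoint
union. -/
inductive Cographs (F : Set FinGraph) : FinGraph → Prop
  | of {G : FinGraph} : G ∈ F → Cographs F G
  | iso {G H : FinGraph} : Nonempty (G.graph ≃g H.graph) → Cographs F G → Cographs F H
  | compl {G : FinGraph} : Cographs F G → Cographs F ⟨G.V, G.graphᶜ⟩
  | sum {G H : FinGraph} : Cographs F G → Cographs F H → Cographs F ⟨G.V ⊕ H.V, G.graph ⊕g H.graph⟩

/-- Block-cographs. -/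
def blockCographs : Set FinGraph := {G | Cographs blockGraphs G}

/-! ### Superrigid tractable families -/

/-- Quantum symmetry: the algebra of the quantum automorphism group is not commutative. -/
def HasQuantumSymmetry (G : FinGraph) : Prop := ¬ ∀ a b : G.qu.A, a * b = b * a

/-- Schmidt's criterion: there are two nontrivial automorphisms with disjoint supports. -/
def SchmidtCriterion (G : FinGraph) : Prop :=
  ∃ f g : G.graph ≃g G.graph, f ≠ 1 ∧ g ≠ 1 ∧ ∀ x, f x = x ∨ g x = x

/-- Schmidt's alternative (SA). -/
def SchmidtAlternative (F : Set FinGraph) : Prop :=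
  ∀ G ∈ F, G.HasQuantumSymmetry ↔ G.SchmidtCriterion

/-- Superrigidity (SR): a graph that is quantum isomorphic to a graph in the family is
isomorphic to it. -/
def Superrigid (F : Set FinGraph) : Prop :=
  ∀ G ∈ F, ∀ H : FinGraph, QuantumIsomorphic.{w} G H → Nonempty (G.graph ≃g H.graph)

/-- Superrigid tractable families: (SA) and (SR). -/
def SuperrigidTractable (F : Set FinGraph) : Prop :=
  SchmidtAlternative F ∧ Superrigid.{w} F

/-- The automorphism groups of the graphs in a family, up to isomorphism. -/
def autGroups (F : Set FinGraph) : Set GrpCat.{0} :=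
  {Γ | ∃ G ∈ F, Nonempty ((G.graph ≃g G.graph) ≃* Γ)}

/-- The quantum automorphism groups of the graphs in a family, up to isomorphism. -/
def quGroups (F : Set FinGraph) : Set QPermGroup :=
  {Q | ∃ G ∈ F, G.qu.Isomorphic Q}

end FinGraph

end

/-! For a magic matrix `u`, commutation with two 0-1 matrices `R`, `S` means that `S x y ↔ R a b`
whenever `u x a * u y b ≠ 0` (`QMagic.intertwine`, `Rel2.intertwine`). Pairs of relations matched in
this sense are closed under Boolean operations, composition and quantifiers. Hence everything built
from adjacency by such operations is preserved by quantum isomorphisms: distances, components,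
centres, and the components left after deleting edges between prescribed invariant colours.

In a connected graph with complete blocks, an interior vertex of a geodesic separates its ends, and
it follows that the centre is a clique. If the centre has several vertices, deleting the edges
inside it separates them; if it is a single vertex, deleting the edges at it isolates it. Either way
(`SimpleGraph.exists_cut`) the vertices are split into several classes by an invariant equivalence
relation, and adjacency across classes depends only on invariant colours. A disconnected graph is
split by its components. The property `SimpleGraph.IsGood`, which gives such a splitting for the
graph or its complement, is hereditary and holds for all block-cographs.

All results then follow by induction on the number of vertices, for coloured graphs (the colours
remember how a class is attached to the others) and for magic matrices whose rows and columns sum to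
an arbitrary `p` instead of 1. The blocks of `u` along the splitting are again of this kind, and
their sums form a magic matrix indexed by the classes. Superrigidity (`SimpleGraph.IsGood.cIso`): a
nonzero block is a quantum isomorphism of two smaller graphs, hence these are isomorphic. Summing
the entries of the matrix of block sums by rows and by columns shows that each isomorphism type of
class occurs equally often on both sides, so the isomorphisms of classes can be glued.

Superrigidity also shows that quantum automorphisms only mix isomorphic classes. So a good coloured
graph with several vertices is either an invariant sum of two smaller ones or consists of `n ≥ 2`
copies of a smaller one (`SimpleGraph.IsGood.induction`). The first case gives direct products and
free products of the automorphism groups, the second one wreath products and free wreath products.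
Conversely, disjoint unions of nonisomorphic connected graphs and copies of connected graphs realise
these operations; complements, which change neither group, make graphs connected and, with an added
vertex, nonisomorphic.

For Schmidt's alternative, the same induction shows that a graph without nontrivial automorphisms
has no nontrivial quantum ones, and that the coefficients commute when no two nontrivial
automorphisms are disjoint (`SimpleGraph.IsGood.alternative`); the base fact is that magic matrices
of size at most three commute. In the other direction, two disjoint automorphisms can be switched on
independently by two noncommuting projections (`mixMatrix_qIso`). -/

noncomputable section

/-! ### Magic matrices whose rows and columns sum to a given element -/

section Magic

variable {V W X : Type*} [Ring X]

/-- Matrices of idempotents, with orthogonal rows and columns, all of which have sum `p`. -/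
structure QMagic [Fintype V] [Fintype W] (p : X) (u : W → V → X) : Prop where
  idem : ∀ x a, u x a * u x a = u x a
  row_orth : ∀ x a b, a ≠ b → u x a * u x b = 0
  col_orth : ∀ x y a, x ≠ y → u x a * u y a = 0
  row_sum : ∀ x, ∑ a, u x a = p
  col_sum : ∀ a, ∑ x, u x a = p

theorem IsMagicUnitary.qMagic [StarRing X] [Fintype V] [Fintype W] {u : Matrix W V X}
    (h : IsMagicUnitary u) : QMagic 1 u where
  idem := h.idem
  row_orth x a b hab := h.row_orth x a b hab.symm
  col_orth x y a hxy := h.col_orth x a y hxy.symm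
  row_sum := h.row_sum
  col_sum := h.col_sum

/-- The relation `R` on the columns corresponds to the relation `S` on the rows. -/
def Rel2 (u : W → V → X) (R : V → V → Prop) (S : W → W → Prop) : Prop :=
  ∀ x y a b, u x a * u y b ≠ 0 → (S x y ↔ R a b)

/-- The predicate `P` on the columns corresponds to the predicate `Q` on the rows. -/
def Rel1 (u : W → V → X) (P : V → Prop) (Q : W → Prop) : Prop :=
  ∀ x a, u x a ≠ 0 → (Q x ↔ P a)

namespace QMagic

variable [Fintype V] [Fintype W] {p : X} {u : W → V → X}

theorem one_mul (h : QMagic p u) (x : W) (a : V) : p * u x a = u x a := by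
  classical
  rw [← h.row_sum x, Finset.sum_mul, Finset.sum_eq_single a]
  · exact h.idem x a
  · exact fun b _ hb => h.row_orth x b a hb
  · simp

theorem mul_one (h : QMagic p u) (x : W) (a : V) : u x a * p = u x a := by
  classical
  rw [← h.row_sum x, Finset.mul_sum, Finset.sum_eq_single a]
  · exact h.idem x a
  · exact fun b _ hb => h.row_orth x a b hb.symm
  · simp

theorem transpose (h : QMagic p u) : QMagic p (fun a x => u x a) where
  idem a x := h.idem x a
  row_orth a x y := h.col_orth x y a
  col_orth a b x := h.row_orth x a b
  row_sum := h.col_sum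
  col_sum := h.row_sum

theorem exists_row (h : QMagic p u) (hp : p ≠ 0) (a : V) : ∃ x, u x a ≠ 0 := by
  by_contra! H
  exact hp (by rw [← h.col_sum a]; simp [H])

theorem exists_col (h : QMagic p u) (hp : p ≠ 0) (x : W) : ∃ a, u x a ≠ 0 :=
  h.transpose.exists_row hp x

theorem exists_row_mul (h : QMagic p u) {x : W} {a : V} (hu : u x a ≠ 0) (b : V) :
    ∃ y, u x a * u y b ≠ 0 := by
  by_contra! H
  exact hu (by rw [← h.mul_one x a, ← h.col_sum b, Finset.mul_sum]; simp [H])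

theorem exists_col_mul (h : QMagic p u) {x : W} {a : V} (hu : u x a ≠ 0) (y : W) :
    ∃ b, u x a * u y b ≠ 0 :=
  h.transpose.exists_row_mul hu y

/-- Inserting `p = ∑ z, u z c` between the two factors leaves some nonzero term. This supplies the
intermediate vertex when relations are composed. -/
theorem exists_row_mul_mul (h : QMagic p u) {x y : W} {a b : V} (hu : u x a * u y b ≠ 0) (c : V) :
    ∃ z, u x a * u z c ≠ 0 ∧ u z c * u y b ≠ 0 := by
  by_contra! H
  apply hu
  rw [← h.mul_one x a, ← h.col_sum c, Finset.mul_sum, Finset.sum_mul]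
  refine Finset.sum_eq_zero fun z _ => ?_
  by_cases hz : u x a * u z c = 0
  · rw [hz, zero_mul]
  · rw [mul_assoc, H z hz, mul_zero]

theorem exists_col_mul_mul (h : QMagic p u) {x y : W} {a b : V} (hu : u x a * u y b ≠ 0) (z : W) :
    ∃ c, u x a * u z c ≠ 0 ∧ u z c * u y b ≠ 0 :=
  h.transpose.exists_row_mul_mul hu z

theorem exists_rows (h : QMagic p u) (hp : p ≠ 0) (a b : V) : ∃ x y, u x a * u y b ≠ 0 := by
  obtain ⟨x, hx⟩ := h.exists_row hp a
  exact ⟨x, h.exists_row_mul hx b⟩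

theorem exists_cols (h : QMagic p u) (hp : p ≠ 0) (x y : W) : ∃ a b, u x a * u y b ≠ 0 :=
  h.transpose.exists_rows hp x y

theorem rel2_eq (h : QMagic p u) : Rel2 u (· = ·) (· = ·) := by
  intro x y a b hu
  constructor
  · rintro rfl; by_contra hab; exact hu (h.row_orth x a b hab)
  · rintro rfl; by_contra hab; exact hu (h.col_orth x y a hab)

end QMagic

namespace Rel1

variable {u : W → V → X} {P : V → Prop} {Q : W → Prop}

theorem right (h : Rel1 u P Q) : Rel2 u (fun _ b => P b) (fun _ y => Q y) :=
  fun x y a b hu => h y b fun e => hu (by rw [e, mul_zero])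

theorem exists_iff [Fintype V] [Fintype W] {p : X} (h : Rel1 u P Q) (hm : QMagic p u)
    (hp : p ≠ 0) : (∃ x, Q x) ↔ ∃ a, P a := by
  constructor
  · rintro ⟨x, hx⟩
    obtain ⟨a, ha⟩ := hm.exists_col hp x
    exact ⟨a, (h x a ha).1 hx⟩
  · rintro ⟨a, ha⟩
    obtain ⟨x, hx⟩ := hm.exists_row hp a
    exact ⟨x, (h x a hx).2 ha⟩

end Rel1

namespace Rel2

variable {u : W → V → X} {R R' : V → V → Prop} {S S' : W → W → Prop}

theorem and (h : Rel2 u R S) (h' : Rel2 u R' S') :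
    Rel2 u (fun a b => R a b ∧ R' a b) (fun x y => S x y ∧ S' x y) :=
  fun x y a b hu => and_congr (h x y a b hu) (h' x y a b hu)

theorem or (h : Rel2 u R S) (h' : Rel2 u R' S') :
    Rel2 u (fun a b => R a b ∨ R' a b) (fun x y => S x y ∨ S' x y) :=
  fun x y a b hu => or_congr (h x y a b hu) (h' x y a b hu)

theorem not (h : Rel2 u R S) : Rel2 u (fun a b => ¬ R a b) (fun x y => ¬ S x y) :=
  fun x y a b hu => not_congr (h x y a b hu)

theorem iUnion {ι : Sort*} {R : ι → V → V → Prop} {S : ι → W → W → Prop}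
    (h : ∀ i, Rel2 u (R i) (S i)) : Rel2 u (fun a b => ∃ i, R i a b) (fun x y => ∃ i, S i x y) :=
  fun x y a b hu => exists_congr fun i => h i x y a b hu

variable [Fintype V] [Fintype W] {p : X}

/-- An intermediate vertex on one side is transported to the other by inserting `p` in the middle of
a nonzero product. This is the combinatorial form of the product of two intertwined matrices. -/
theorem comp (h : Rel2 u R S) (h' : Rel2 u R' S') (hm : QMagic p u) :
    Rel2 u (fun a b => ∃ c, R a c ∧ R' c b) (fun x y => ∃ z, S x z ∧ S' z y) := by
  intro x y a b hu
  constructor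
  · rintro ⟨z, h1, h2⟩
    obtain ⟨c, hc, hc'⟩ := hm.exists_col_mul_mul hu z
    exact ⟨c, (h _ _ _ _ hc).1 h1, (h' _ _ _ _ hc').1 h2⟩
  · rintro ⟨c, h1, h2⟩
    obtain ⟨z, hc, hc'⟩ := hm.exists_row_mul_mul hu c
    exact ⟨z, (h _ _ _ _ hc).2 h1, (h' _ _ _ _ hc').2 h2⟩

theorem exists_right (h : Rel2 u R S) (hm : QMagic p u) :
    Rel1 u (fun a => ∃ b, R a b) (fun x => ∃ y, S x y) := by
  intro x a hu
  constructor
  · rintro ⟨y, h1⟩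
    obtain ⟨b, hb⟩ := hm.exists_col_mul hu y
    exact ⟨b, (h _ _ _ _ hb).1 h1⟩
  · rintro ⟨b, h1⟩
    obtain ⟨y, hb⟩ := hm.exists_row_mul hu b
    exact ⟨y, (h _ _ _ _ hb).2 h1⟩

theorem forall_right (h : Rel2 u R S) (hm : QMagic p u) :
    Rel1 u (fun a => ∀ b, R a b) (fun x => ∀ y, S x y) := by
  intro x a hu
  have := (h.not.exists_right hm) x a hu
  have := not_congr this
  simpa only [not_exists, not_not] using this

end Rel2

/-! ### Block sums along an invariant partition -/

section blocks

variable [Fintype V] [Fintype W] {p : X} {u : W → V → X} {κ κ' : Type*} {π : V → κ} {π' : W → κ'}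

-- Multiply each column entry by the row sum `p` at `x`, and each row entry by the column sum `p` at
-- `a`. By invariance of the partition only the products inside the block survive, and both sides
-- become the same double sum. Hence all row sums and column sums of a block agree.
open scoped Classical in
theorem QMagic.sum_block (h : QMagic p u)
    (hπ : Rel2 u (fun a b => π a = π b) (fun x y => π' x = π' y)) (x : W) (a : V) :
    ∑ y with π' y = π' x, u y a = ∑ b with π b = π a, u x b := by
  have h1 : ∑ y with π' y = π' x, u y a
      = ∑ y with π' y = π' x, ∑ b with π b = π a, u y a * u x b := by
    refine Finset.sum_congr rfl fun y hy => ?_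
    conv_lhs => rw [← h.mul_one y a, ← h.row_sum x, Finset.mul_sum]
    rw [Finset.sum_filter]
    refine Finset.sum_congr rfl fun b _ => ?_
    split_ifs with hb
    · rfl
    · by_contra hu
      exact hb ((hπ y x a b hu).1 (Finset.mem_filter.1 hy).2).symm
  have h2 : ∑ b with π b = π a, u x b
      = ∑ b with π b = π a, ∑ y with π' y = π' x, u y a * u x b := by
    refine Finset.sum_congr rfl fun b hb => ?_
    conv_lhs => rw [← h.one_mul x b, ← h.col_sum a, Finset.sum_mul]
    rw [Finset.sum_filter]
    refine Finset.sum_congr rfl fun y _ => ?_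
    split_ifs with hy
    · rfl
    · by_contra hu
      exact hy ((hπ y x a b hu).2 (Finset.mem_filter.1 hb).2.symm)
  rw [h1, h2, Finset.sum_comm]

open scoped Classical in
/-- The sum of the coefficients of the block of `u` defined by `c` and `c'`, in any column. -/
def blockSum (u : W → V → X) (π : V → κ) (π' : W → κ') (c' : κ') (c : κ) : X :=
  -- The chosen column is immaterial for an invariant partition; an empty class contributes the
  -- empty sum.
  if h : ∃ a, π a = c then ∑ y with π' y = c', u y h.choose else 0

open scoped Classical in
theorem QMagic.blockSum_row (h : QMagic p u)
    (hπ : Rel2 u (fun a b => π a = π b) (fun x y => π' x = π' y)) (x : W) (c : κ) :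
    ∑ b with π b = c, u x b = blockSum u π π' (π' x) c := by
  rw [blockSum]
  split_ifs with hc
  · rw [h.sum_block hπ x hc.choose, hc.choose_spec]
  · refine Finset.sum_eq_zero fun b hb => (hc ⟨b, (Finset.mem_filter.1 hb).2⟩).elim

open scoped Classical in
theorem QMagic.blockSum_col (h : QMagic p u)
    (hπ : Rel2 u (fun a b => π a = π b) (fun x y => π' x = π' y)) (c' : κ') (hc' : ∃ x, π' x = c')
    (a : V) : ∑ y with π' y = c', u y a = blockSum u π π' c' (π a) := by
  obtain ⟨x, rfl⟩ := hc'
  rw [h.sum_block hπ, h.blockSum_row hπ]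

/-- The sum of a block is in general not 1 even when `p = 1`, which is why an arbitrary `p` is
carried along in all the inductions. -/
theorem QMagic.restrict_block (h : QMagic p u)
    (hπ : Rel2 u (fun a b => π a = π b) (fun x y => π' x = π' y)) (c' : κ') (hc' : ∃ x, π' x = c')
    (c : κ) [Fintype {a // π a = c}] [Fintype {x // π' x = c'}] :
    QMagic (blockSum u π π' c' c) (fun (x : {x // π' x = c'}) (a : {a // π a = c}) => u x a)
    where
  idem x a := h.idem x a
  row_orth x a b hab := h.row_orth x a b fun e => hab (Subtype.ext e)
  col_orth x y a hxy := h.col_orth x y a fun e => hxy (Subtype.ext e)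
  row_sum x := by
    classical
    rw [← Finset.sum_subtype (p := fun a => π a = c) (Finset.univ.filter fun a => π a = c) (by simp) (u x.1),
      h.blockSum_row hπ, x.2]
  col_sum a := by
    classical
    rw [← Finset.sum_subtype (p := fun x => π' x = c') (Finset.univ.filter fun x => π' x = c')
      (by simp) (fun x => u x a.1), h.blockSum_col hπ c' hc', a.2]

theorem QMagic.mul_blockSum (h : QMagic p u)
    (hπ : Rel2 u (fun a b => π a = π b) (fun x y => π' x = π' y)) (x : W) (a : V) :
    u x a * blockSum u π π' (π' x) (π a) = u x a := by
  classical
  rw [← h.blockSum_row hπ, Finset.mul_sum, Finset.sum_eq_single a]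
  · exact h.idem x a
  · exact fun b _ hb => h.row_orth x a b hb.symm
  · simp

theorem QMagic.blockSum_row_sum (h : QMagic p u) [Fintype κ]
    (hπ : Rel2 u (fun a b => π a = π b) (fun x y => π' x = π' y)) (c' : κ') (hc' : ∃ x, π' x = c') :
    ∑ c, blockSum u π π' c' c = p := by
  classical
  obtain ⟨x, rfl⟩ := hc'
  simp only [← h.blockSum_row hπ]
  rw [← h.row_sum x]
  exact Finset.sum_fiberwise _ _ _

theorem QMagic.blockSum_col_sum (h : QMagic p u) [Fintype κ']
    (hπ : Rel2 u (fun a b => π a = π b) (fun x y => π' x = π' y)) (hπ' : Function.Surjective π')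
    (c : κ) (hc : ∃ a, π a = c) : ∑ c', blockSum u π π' c' c = p := by
  classical
  obtain ⟨a, rfl⟩ := hc
  simp only [← h.blockSum_col hπ _ (hπ' _)]
  rw [← h.col_sum a]
  exact Finset.sum_fiberwise _ _ _

/-- The block sums form a magic matrix. -/
theorem QMagic.blockSum_magic (h : QMagic p u) [Fintype κ] [Fintype κ']
    (hπ : Rel2 u (fun a b => π a = π b) (fun x y => π' x = π' y)) (hs : Function.Surjective π)
    (hs' : Function.Surjective π') : QMagic p (blockSum u π π') where
  idem c' c := by
    classical
    obtain ⟨x, rfl⟩ := hs' c'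
    conv_lhs => rw [← h.blockSum_row hπ x c]
    rw [Finset.sum_mul, ← h.blockSum_row hπ x c]
    refine Finset.sum_congr rfl fun b hb => ?_
    obtain rfl := (Finset.mem_filter.1 hb).2
    rw [h.blockSum_row hπ, h.mul_blockSum hπ]
  row_orth c' c₁ c₂ hne := by
    classical
    obtain ⟨x, rfl⟩ := hs' c'
    rw [← h.blockSum_row hπ, ← h.blockSum_row hπ, Finset.sum_mul_sum]
    refine Finset.sum_eq_zero fun a ha => Finset.sum_eq_zero fun b hb => h.row_orth _ _ _ ?_
    rintro rfl
    exact hne ((Finset.mem_filter.1 ha).2.symm.trans (Finset.mem_filter.1 hb).2)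
  col_orth c₁ c₂ c hne := by
    classical
    obtain ⟨a, rfl⟩ := hs c
    rw [← h.blockSum_col hπ _ (hs' _), ← h.blockSum_col hπ _ (hs' _), Finset.sum_mul_sum]
    refine Finset.sum_eq_zero fun x hx => Finset.sum_eq_zero fun y hy => h.col_orth _ _ _ ?_
    rintro rfl
    exact hne ((Finset.mem_filter.1 hx).2.symm.trans (Finset.mem_filter.1 hy).2)
  row_sum c' := h.blockSum_row_sum hπ c' (hs' c')
  col_sum c := h.blockSum_col_sum hπ hs' c (hs c)

end blocks

end Magic

/-! ### Quantum isomorphisms of coloured graphs -/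

section QIso

variable {V W K X : Type*} [Ring X] [Fintype V] [Fintype W]

/-- Quantum isomorphisms, with unit `p`, from a coloured graph to another one. -/
structure QIso (p : X) (u : W → V → X) (G : SimpleGraph V) (d : V → K) (H : SimpleGraph W)
    (d' : W → K) : Prop extends QMagic p u where
  adj : Rel2 u G.Adj H.Adj
  color : ∀ x a, u x a ≠ 0 → d' x = d a

/-- Isomorphism of coloured graphs. -/
def CIso {V W K : Type*} (G : SimpleGraph V) (d : V → K) (H : SimpleGraph W) (d' : W → K) : Prop :=
  ∃ f : V ≃ W, (∀ a b, H.Adj (f a) (f b) ↔ G.Adj a b) ∧ ∀ a, d' (f a) = d a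

theorem CIso.refl {V K : Type*} (G : SimpleGraph V) (d : V → K) : CIso G d G d :=
  ⟨Equiv.refl V, fun _ _ => Iff.rfl, fun _ => rfl⟩

theorem CIso.symm {V W K : Type*} {G : SimpleGraph V} {d : V → K} {H : SimpleGraph W} {d' : W → K}
    (h : CIso G d H d') : CIso H d' G d := by
  obtain ⟨f, h1, h2⟩ := h
  exact ⟨f.symm, fun a b => by simp [← h1], fun a => by simp [← h2]⟩

theorem CIso.trans {V W Y K : Type*} {G : SimpleGraph V} {d : V → K} {H : SimpleGraph W}
    {d' : W → K} {I : SimpleGraph Y} {d'' : Y → K}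
    (h : CIso G d H d') (h' : CIso H d' I d'') : CIso G d I d'' := by
  obtain ⟨f, h1, h2⟩ := h
  obtain ⟨g, h3, h4⟩ := h'
  exact ⟨f.trans g, fun a b => by simp [← h1, h3], fun a => by simp [← h2, h4]⟩

variable {p : X} {u : W → V → X} {G : SimpleGraph V} {d : V → K} {H : SimpleGraph W} {d' : W → K}

theorem QIso.compl (h : QIso p u G d H d') : QIso p u Gᶜ d Hᶜ d' where
  toQMagic := h.toQMagic
  adj := by
    intro x y a b hu
    rw [SimpleGraph.compl_adj, SimpleGraph.compl_adj]
    exact h.rel2_eq.not.and h.adj.not x y a b hu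
  color := h.color

open scoped Classical in
/-- A matrix of numbers is intertwined if it is constant along the matrix `u`. -/
theorem QMagic.intertwine (h : QMagic p u) (R : V → V → Prop) (S : W → W → Prop)
    (hRS : ∀ x b, ∑ a, u x a * (if R a b then (1 : X) else 0)
      = ∑ y, (if S x y then (1 : X) else 0) * u y b) : Rel2 u R S := by
  intro x y a b hu
  have h1 := congrArg (fun t => u x a * t * u y b) (hRS x b)
  have e1 : u x a * (∑ c, u x c * (if R c b then (1 : X) else 0)) * u y b
      = u x a * (if R a b then (1 : X) else 0) * u y b := by
    rw [Finset.mul_sum, Finset.sum_eq_single a]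
    · rw [← mul_assoc, h.idem]
    · intro c _ hc
      rw [← mul_assoc, h.row_orth x a c hc.symm, zero_mul]
    · simp
  have e2 : u x a * (∑ z, (if S x z then (1 : X) else 0) * u z b) * u y b
      = u x a * (if S x y then (1 : X) else 0) * u y b := by
    rw [mul_assoc, Finset.sum_mul, Finset.sum_eq_single y]
    · rw [mul_assoc, h.idem, mul_assoc]
    · intro c _ hc
      rw [mul_assoc, h.col_orth c y b hc, mul_zero]
    · simp
  simp only [e1, e2] at h1
  by_cases hR : R a b <;> by_cases hS : S x y <;> simp [hR, hS] at h1 ⊢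
  · exact hu h1
  · exact hu h1.symm

-- Converse of the previous lemma: multiplying by `p`, written as a column sum or as a row sum,
-- turns both sides into sums of the products `u x a * u y b`, and these agree termwise since a
-- nonzero product forces `S x y ↔ R a b`.
open scoped Classical in
theorem Rel2.intertwine {R : V → V → Prop} {S : W → W → Prop} (hRS : Rel2 u R S) (h : QMagic p u)
    (x : W) (b : V) : ∑ a, u x a * (if R a b then (1 : X) else 0)
      = ∑ y, (if S x y then (1 : X) else 0) * u y b := by
  have e1 : ∀ a, u x a * (if R a b then (1 : X) else 0)
      = ∑ y, if R a b then u x a * u y b else 0 := by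
    intro a
    split_ifs
    · rw [← Finset.mul_sum, h.col_sum, h.mul_one, _root_.mul_one]
    · simp
  have e2 : ∀ y, (if S x y then (1 : X) else 0) * u y b
      = ∑ a, if S x y then u x a * u y b else 0 := by
    intro a
    split_ifs
    · rw [← Finset.sum_mul, h.row_sum, h.one_mul, _root_.one_mul]
    · simp
  simp only [e1, e2]
  rw [Finset.sum_comm]
  refine Finset.sum_congr rfl fun y _ => Finset.sum_congr rfl fun a _ => ?_
  by_cases hu : u x a * u y b = 0
  · simp [hu]
  · simp [hRS x y a b hu]

end QIso

/-! ### Vertices within a given distance, and the centre of a graph -/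

namespace SimpleGraph

section dist

variable {V : Type*} {G : SimpleGraph V}

/-- The vertices `a` and `b` are joined by a walk of length at most `n`. -/
def WithinDist (G : SimpleGraph V) (n : ℕ) (a b : V) : Prop := ∃ w : G.Walk a b, w.length ≤ n

theorem withinDist_zero (a b : V) : G.WithinDist 0 a b ↔ a = b := by
  constructor
  · rintro ⟨w, hw⟩; exact Walk.eq_of_length_eq_zero (Nat.le_zero.1 hw)
  · rintro rfl; exact ⟨.nil, le_rfl⟩

theorem withinDist_succ (n : ℕ) (a b : V) :
    G.WithinDist (n + 1) a b ↔ a = b ∨ ∃ c, G.Adj a c ∧ G.WithinDist n c b := by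
  constructor
  · rintro ⟨w, hw⟩
    cases w with
    | nil => exact .inl rfl
    | cons h q => exact .inr ⟨_, h, q, by simpa using hw⟩
  · rintro (rfl | ⟨c, h, q, hq⟩)
    · exact ⟨.nil, by simp⟩
    · exact ⟨.cons h q, by simpa using hq⟩

theorem Preconnected.withinDist_iff (hG : G.Preconnected) (n : ℕ) (a b : V) :
    G.WithinDist n a b ↔ G.dist a b ≤ n := by
  constructor
  · rintro ⟨w, hw⟩; exact (dist_le w).trans hw
  · intro h
    obtain ⟨w, hw⟩ := (hG a b).exists_walk_length_eq_dist
    exact ⟨w, hw.trans_le h⟩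

theorem reachable_iff_exists_withinDist (a b : V) : G.Reachable a b ↔ ∃ n, G.WithinDist n a b :=
  ⟨fun ⟨w⟩ => ⟨w.length, w, le_rfl⟩, fun ⟨_, w, _⟩ => ⟨w⟩⟩

/-- The vertices of minimal eccentricity. -/
def IsCentral (G : SimpleGraph V) (a : V) : Prop :=
  ∀ n, (∃ b, ∀ c, G.WithinDist n b c) → ∀ c, G.WithinDist n a c

/-- Being central is defined without naming the radius, so that its invariance is immediate; here
the radius `ρ` is recovered. By minimality of `ρ`, no vertex has all others at distance less than
`ρ`. -/
theorem Connected.exists_radius [Finite V] (hG : G.Connected) :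
    ∃ ρ, (∀ a, G.IsCentral a ↔ ∀ c, G.dist a c ≤ ρ) ∧ (∃ a, G.IsCentral a) ∧
      ∀ a, ∃ c, ρ ≤ G.dist a c := by
  classical
  have hP := hG.preconnected
  have hex : ∃ n, ∃ b, ∀ c, G.WithinDist n b c := by
    obtain ⟨b⟩ := hG.nonempty
    obtain ⟨n, hn⟩ := (Set.finite_range (G.dist b)).bddAbove
    exact ⟨n, b, fun c => (hP.withinDist_iff _ _ _).2 (hn ⟨c, rfl⟩)⟩
  have key : ∀ a, G.IsCentral a ↔ ∀ c, G.dist a c ≤ Nat.find hex := by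
    intro a
    simp only [← hP.withinDist_iff]
    refine ⟨fun h => h _ (Nat.find_spec hex), fun h n hn c => ?_⟩
    rw [hP.withinDist_iff]
    exact ((hP.withinDist_iff _ _ _).1 (h c)).trans (Nat.find_min' hex hn)
  refine ⟨Nat.find hex, key, ?_, ?_⟩
  · obtain ⟨b, hb⟩ := Nat.find_spec hex
    exact ⟨b, (key b).2 fun c => (hP.withinDist_iff _ _ _).1 (hb c)⟩
  · intro a
    by_contra! H
    have h0 : 0 < Nat.find hex := (Nat.zero_le _).trans_lt (H a)
    refine Nat.find_min hex (Nat.sub_lt h0 one_pos) ⟨a, fun c => ?_⟩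
    rw [hP.withinDist_iff]
    exact Nat.le_sub_one_of_lt (H c)

theorem Walk.notMem_support_of_length_lt {x m v : V} (q : G.Walk x m)
    (h : q.length < G.dist x v) : v ∉ q.support := by
  classical
  intro hv
  have := dist_le (q.takeUntil v hv)
  have := q.length_takeUntil_le_length hv
  omega

theorem Connected.exists_adj_dist (hG : G.Connected) {x v : V} (h : v ≠ x) :
    ∃ m, G.Adj v m ∧ G.dist x m + 1 = G.dist x v := by
  obtain ⟨q, hq⟩ := hG.exists_walk_length_eq_dist v x
  cases q with
  | nil => exact (h rfl).elim
  | @cons _ m _ hm q =>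
    refine ⟨m, hm, ?_⟩
    have h1 := dist_le q
    have h2 := hG.dist_triangle (u := v) (v := m) (w := x)
    rw [dist_eq_one_iff_adj.2 hm] at h2
    rw [Walk.length_cons] at hq
    rw [dist_comm (u := x) (v := m), dist_comm (u := x) (v := v)]
    omega

theorem Connected.dist_add_dist_le (hG : G.Connected) {x v z : V}
    (h : ∀ q : G.Walk x z, v ∈ q.support) : G.dist x v + G.dist v z ≤ G.dist x z := by
  classical
  obtain ⟨q, hq⟩ := hG.exists_walk_length_eq_dist x z
  have e := congrArg Walk.length (q.take_spec (h q))
  rw [Walk.length_append] at e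
  have := dist_le (q.takeUntil v (h q))
  have := dist_le (q.dropUntil v (h q))
  omega

/-! ### Graphs whose blocks are complete -/

/-- Two neighbours of a vertex `r` that are connected in the complement of `r` are adjacent. -/
def IsBlockLike (G : SimpleGraph V) : Prop :=
  ∀ r x y, G.Adj r x → G.Adj r y → x ≠ y → (∃ q : G.Walk x y, r ∉ q.support) → G.Adj x y

theorem IsBlockLike.comap {W : Type*} (h : G.IsBlockLike) (f : W ↪ V) :
    (G.comap f).IsBlockLike := by
  rintro r x y hx hy hxy ⟨q, hq⟩
  let F : G.comap f →g G := ⟨f, fun h => h⟩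
  refine h (f r) (f x) (f y) hx hy (fun e => hxy (f.injective e)) ⟨q.map F, fun hr => ?_⟩
  have hr' := (Walk.support_map F q) ▸ hr
  obtain ⟨a, ha, e⟩ := List.mem_map.1 hr'
  exact hq (f.injective e ▸ ha)

/-- In a block-like graph, a vertex between two others separates them. -/
theorem IsBlockLike.mem_support (h : G.IsBlockLike) (hG : G.Connected) {x v z : V} (hx : v ≠ x)
    (hz : v ≠ z) (hd : G.dist x z = G.dist x v + G.dist v z) (q : G.Walk x z) : v ∈ q.support := by
  by_contra hq
  obtain ⟨m, hm, hm'⟩ := hG.exists_adj_dist hx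
  obtain ⟨k, hk, hk'⟩ := hG.exists_adj_dist hz
  obtain ⟨q1, hq1⟩ := hG.exists_walk_length_eq_dist x m
  obtain ⟨q2, hq2⟩ := hG.exists_walk_length_eq_dist z k
  have t1 := hG.dist_triangle (u := x) (v := m) (w := z)
  have t2 := hG.dist_triangle (u := m) (v := k) (w := z)
  rw [dist_comm (u := k)] at t2
  rw [dist_comm (u := v)] at hd
  have hne : m ≠ k := by
    rintro rfl
    rw [dist_comm (u := m) (v := z)] at t1
    omega
  -- If `q` avoided `v`, it would join `m` to `k` outside `v` together with two geodesics too short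
  -- to reach `v`. Then `m` and `k` would be adjacent, which makes `x` and `z` too close.
  have hadj : G.Adj m k := by
    refine h v m k hm hk hne ⟨q1.reverse.append (q.append q2), ?_⟩
    have n1 := q1.notMem_support_of_length_lt (v := v) (by omega)
    have n2 := q2.notMem_support_of_length_lt (v := v) (by omega)
    simp [Walk.mem_support_append_iff, n1, n2, hq]
  rw [dist_eq_one_iff_adj.2 hadj] at t2
  omega

/-- If `x` and `y` are not adjacent, let `v` be the neighbour of `x` on a geodesic to `y`, and `w` a
vertex at distance at least `ρ` from `v`. If `v` separated `x` or `y` from `w`, that vertex would be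
at distance more than `ρ` from `w`. Otherwise `x` and `y` are joined through `w` while avoiding `v`,
which lies between them. -/
theorem IsBlockLike.adj_of_isCentral [Finite V] (h : G.IsBlockLike) (hG : G.Connected) {x y : V}
    (hx : G.IsCentral x) (hy : G.IsCentral y) (hxy : x ≠ y) : G.Adj x y := by
  obtain ⟨ρ, hρ, -, hfar⟩ := hG.exists_radius
  by_contra hadj
  obtain ⟨v, hv, hd⟩ := hG.exists_adj_dist hxy
  have hvy : v ≠ y := by rintro rfl; exact hadj hv
  have hxv : G.dist x v = 1 := dist_eq_one_iff_adj.2 hv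
  obtain ⟨w, hw⟩ := hfar v
  have hx' := (hρ x).1 hx w
  have hy' := (hρ y).1 hy w
  have hyv := hG.pos_dist_of_ne hvy.symm
  by_cases h1 : ∀ q : G.Walk x w, v ∈ q.support
  · have := hG.dist_add_dist_le h1; omega
  by_cases h2 : ∀ q : G.Walk y w, v ∈ q.support
  · have := hG.dist_add_dist_le h2; omega
  push Not at h1 h2
  obtain ⟨q1, hq1⟩ := h1
  obtain ⟨q2, hq2⟩ := h2
  have := h.mem_support hG hv.ne' hvy (by
    rw [hxv, dist_comm (u := x), dist_comm (u := v), ← hd, add_comm]) (q1.append q2.reverse)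
  simp [Walk.mem_support_append_iff, hq1, hq2] at this

end dist

/-! ### Cutting a graph at its centre -/

section cut

variable {V : Type*} {G : SimpleGraph V}

/-- The vertices are coloured according to whether they are central, and whether they have a
central neighbour. -/
def centerColor (G : SimpleGraph V) (a : V) : Prop × Prop :=
  (G.IsCentral a, ∃ z, G.Adj a z ∧ G.IsCentral z)

/-- The graph obtained by removing the edges between vertices with `κ`-related colours. -/
def cut (G : SimpleGraph V) (κ : Prop × Prop → Prop × Prop → Prop) : SimpleGraph V where
  Adj a b := G.Adj a b ∧ ¬ (κ (G.centerColor a) (G.centerColor b) ∨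
    κ (G.centerColor b) (G.centerColor a))
  symm := ⟨fun _ _ h => ⟨h.1.symm, fun e => h.2 e.symm⟩⟩
  loopless := ⟨fun a h => G.loopless.irrefl a h.1⟩

theorem cut_le (κ : Prop × Prop → Prop × Prop → Prop) : G.cut κ ≤ G := fun _ _ h => h.1

/-- The first step of a path from `x` to `y` in the cut graph goes to a noncentral `m`, and `m` is
adjacent to `y` since the rest of the path avoids `x`. For `z` at distance more than `ρ` from `m`,
both `x` and `y` must be at distance `ρ` from `z`, and `x` lies between `m` and `z`. So `x`
separates them and lies on every geodesic from `y` to `z`, which makes that distance at least `ρ +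
1`. -/
theorem IsBlockLike.not_reachable_cut [Finite V] (h : G.IsBlockLike) (hG : G.Connected) {x y : V}
    (hx : G.IsCentral x) (hy : G.IsCentral y) (hxy : x ≠ y) :
    ¬ (G.cut fun s t => s.1 ∧ t.1).Reachable x y := by
  rintro hr
  obtain ⟨ρ, hρ, -, hfar⟩ := hG.exists_radius
  obtain ⟨w, hw⟩ := hr.exists_isPath
  have hadj := h.adj_of_isCentral hG hx hy hxy
  cases w with
  | nil => exact hxy rfl
  | @cons _ m _ hm q =>
    have hmZ : ¬ G.IsCentral m := fun hm' => hm.2 (.inl ⟨hx, hm'⟩)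
    have hmy : m ≠ y := by rintro rfl; exact hmZ hy
    have hxq := (Walk.cons_isPath_iff _ _).1 hw
    have hadj' : G.Adj m y := by
      refine h x m y hm.1 hadj hmy ⟨q.mapLe (cut_le _), ?_⟩
      simpa using hxq.2
    obtain ⟨z, hz⟩ : ∃ z, ρ < G.dist m z := by
      by_contra! H
      exact hmZ ((hρ m).2 H)
    have hxz := (hρ x).1 hx z
    have hyz := (hρ y).1 hy z
    have hxy1 := (hρ x).1 hx y
    rw [dist_eq_one_iff_adj.2 hadj] at hxy1
    have t1 := hG.dist_triangle (u := m) (v := x) (w := z)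
    have t2 := hG.dist_triangle (u := m) (v := y) (w := z)
    have e1 : G.dist m x = 1 := dist_eq_one_iff_adj.2 hm.1.symm
    have e2 : G.dist m y = 1 := dist_eq_one_iff_adj.2 hadj'
    obtain ⟨g, hg⟩ := hG.exists_walk_length_eq_dist y z
    have hne : x ≠ z := by rintro rfl; simp at t1; omega
    have hmem := h.mem_support hG hm.1.ne hne (by omega) (Walk.cons hadj' g)
    rw [Walk.support_cons, List.mem_cons] at hmem
    rcases hmem with rfl | hmem
    · exact G.loopless.irrefl _ hm.1
    · classical
      have e := congrArg Walk.length (g.take_spec hmem)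
      rw [Walk.length_append] at e
      have h1 := dist_le (g.takeUntil x hmem)
      have h2 := dist_le (g.dropUntil x hmem)
      rw [dist_comm, dist_eq_one_iff_adj.2 hadj] at h1
      omega

/-- Only the implication from `κ` to adjacency needs an argument: adjacent vertices in different
components of the cut graph have lost their edge, hence are related by `κ`. Three cases: a centre
with several vertices, a centre with one vertex, and a disconnected graph. -/
theorem exists_cut [Finite V] [Nontrivial V] (hG : ¬ G.Preconnected ∨ G.IsBlockLike) :
    ∃ κ : Prop × Prop → Prop × Prop → Prop, (∃ a b, ¬ (G.cut κ).Reachable a b) ∧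
      ∀ a b, ¬ (G.cut κ).Reachable a b →
        (G.Adj a b ↔ κ (G.centerColor a) (G.centerColor b) ∨
          κ (G.centerColor b) (G.centerColor a)) := by
  suffices H : ∃ κ : Prop × Prop → Prop × Prop → Prop, (∃ a b, ¬ (G.cut κ).Reachable a b) ∧
      ∀ a b, ¬ (G.cut κ).Reachable a b → κ (G.centerColor a) (G.centerColor b) → G.Adj a b by
    obtain ⟨κ, h1, h2⟩ := H
    refine ⟨κ, h1, fun a b hab => ⟨fun h => ?_, ?_⟩⟩
    · by_contra hc
      exact hab (Adj.reachable (G := G.cut κ) ⟨h, hc⟩)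
    · rintro (h | h)
      · exact h2 a b hab h
      · exact (h2 b a (fun e => hab e.symm) h).symm
  by_cases hP : G.Preconnected
  · have hB := hG.resolve_left (not_not.2 hP)
    have hC : G.Connected := ⟨hP⟩
    obtain ⟨-, -, ⟨r, hr⟩, -⟩ := hC.exists_radius
    by_cases hZ : ∃ s, G.IsCentral s ∧ r ≠ s
    · obtain ⟨s, hs, hrs⟩ := hZ
      refine ⟨_, ⟨r, s, hB.not_reachable_cut hC hr hs hrs⟩, fun a b hab h => ?_⟩
      exact hB.adj_of_isCentral hC h.1 h.2 (by rintro rfl; exact hab (.refl _))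
    · push Not at hZ
      obtain ⟨b, hb⟩ := exists_ne r
      -- The centre is `{r}`: the edges removed are those at `r`, and having a central neighbour
      -- means being adjacent to `r`.
      refine ⟨fun s t => s.1 ∧ t.2, ⟨r, b, ?_⟩, ?_⟩
      · rintro ⟨w⟩
        cases w with
        | nil => exact hb rfl
        | cons h q => exact h.2 (.inl ⟨hr, r, h.1.symm, hr⟩)
      · rintro a b - ⟨ha, z, hbz, hz⟩
        rw [← hZ a ha, hZ z hz]
        exact hbz.symm
  · refine ⟨fun _ _ => False, ?_, fun _ _ _ h => h.elim⟩
    rw [Preconnected] at hP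
    push Not at hP
    obtain ⟨a, b, hab⟩ := hP
    exact ⟨a, b, fun h => hab (h.mono (cut_le _))⟩

end cut

/-! ### Invariance under quantum isomorphisms -/

section invariance

variable {V W K X : Type*} [Ring X] [Fintype V] [Fintype W] {p : X} {u : W → V → X}
  {G : SimpleGraph V} {d : V → K} {H : SimpleGraph W} {d' : W → K}

theorem _root_.QMagic.rel2_withinDist (h : QMagic p u) (hadj : Rel2 u G.Adj H.Adj) (n : ℕ) :
    Rel2 u (G.WithinDist n) (H.WithinDist n) := by
  induction n with
  | zero =>
    intro x y a b hu
    rw [withinDist_zero, withinDist_zero]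
    exact h.rel2_eq x y a b hu
  | succ n ih =>
    intro x y a b hu
    rw [withinDist_succ, withinDist_succ]
    exact h.rel2_eq.or (hadj.comp ih h) x y a b hu

theorem _root_.QMagic.rel2_reachable (h : QMagic p u) (hadj : Rel2 u G.Adj H.Adj) :
    Rel2 u G.Reachable H.Reachable := by
  intro x y a b hu
  rw [reachable_iff_exists_withinDist, reachable_iff_exists_withinDist]
  exact Rel2.iUnion (fun n => h.rel2_withinDist hadj n) x y a b hu

/-- Centrality is obtained from the relations `WithinDist n` by quantifiers. The closed subformula
in it transfers only when `p ≠ 0`, which is implied by `u x a ≠ 0`. -/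
theorem _root_.QMagic.rel1_isCentral (h : QMagic p u) (hadj : Rel2 u G.Adj H.Adj) :
    Rel1 u G.IsCentral H.IsCentral := by
  intro x a hu
  have hp : p ≠ 0 := by rintro rfl; rw [← h.one_mul x a, zero_mul] at hu; exact hu rfl
  refine forall_congr' fun n => ?_
  have hn := (h.rel2_withinDist hadj n).forall_right h
  exact imp_congr (hn.exists_iff h hp) (hn x a hu)

theorem _root_.QMagic.centerColor_eq (h : QMagic p u) (hadj : Rel2 u G.Adj H.Adj) (x : W) (a : V)
    (hu : u x a ≠ 0) : H.centerColor x = G.centerColor a :=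
  Prod.ext (propext (h.rel1_isCentral hadj x a hu))
    (propext ((hadj.and (h.rel1_isCentral hadj).right).exists_right h x a hu))

theorem _root_.QMagic.rel2_cut (h : QMagic p u) (hadj : Rel2 u G.Adj H.Adj)
    (κ : Prop × Prop → Prop × Prop → Prop) :
    Rel2 u (G.cut κ).Adj (H.cut κ).Adj := by
  intro x y a b hu
  have hx := h.centerColor_eq hadj x a fun e => hu (by rw [e, zero_mul])
  have hy := h.centerColor_eq hadj y b fun e => hu (by rw [e, mul_zero])
  simp only [cut, hx, hy, hadj x y a b hu]

end invariance

/-! ### A hereditary family of graphs that contains the block-cographs -/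

/-- Every induced subgraph is not connected or has complete blocks, up to complement. -/
def IsGood {V : Type} (G : SimpleGraph V) : Prop :=
  ∀ (S : Type) (f : S ↪ V), (¬ (G.comap f).Preconnected ∨ (G.comap f).IsBlockLike) ∨
    (¬ (G.comap f)ᶜ.Preconnected ∨ (G.comap f)ᶜ.IsBlockLike)

section IsGood

variable {V : Type} {G : SimpleGraph V}

theorem IsGood.comap (h : G.IsGood) {W : Type} (f : W ↪ V) : (G.comap f).IsGood :=
  fun S g => h S (g.trans f)

theorem comap_compl {W : Type*} (f : W ↪ V) : (Gᶜ).comap f = (G.comap f)ᶜ := by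
  ext a b
  simp [compl_adj]

theorem IsGood.compl (h : G.IsGood) : Gᶜ.IsGood := by
  intro S f
  rw [comap_compl, compl_compl]
  exact (h S f).symm

theorem IsBlockLike.isGood (h : G.IsBlockLike) : G.IsGood :=
  fun _ f => .inl (.inr (h.comap f))

theorem IsGood.iso (h : G.IsGood) {W : Type} {H : SimpleGraph W} (e : G ≃g H) : H.IsGood := by
  have : H = G.comap e.symm.toEquiv.toEmbedding := by
    ext a b
    exact (e.symm.map_adj_iff (v := a) (w := b)).symm
  rw [this]
  exact h.comap _

/-- An induced subgraph of a disjoint union lies on one side or is disconnected. -/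
theorem IsGood.sum (h : G.IsGood) {W : Type} {H : SimpleGraph W} (h' : H.IsGood) :
    (G ⊕g H).IsGood := by
  intro S f
  by_cases h1 : ∀ s, ∃ a, f s = .inl a
  · choose g hg using h1
    have hinj : Function.Injective g := fun s t e => f.injective (by rw [hg, hg, e])
    have : (G ⊕g H).comap f = G.comap (⟨g, hinj⟩ : S ↪ V) := by
      ext s t; simp [hg]
    rw [this]
    exact h S _
  by_cases h2 : ∀ s, ∃ b, f s = .inr b
  · choose g hg using h2
    have hinj : Function.Injective g := fun s t e => f.injective (by rw [hg, hg, e])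
    have : (G ⊕g H).comap f = H.comap (⟨g, hinj⟩ : S ↪ W) := by
      ext s t; simp [hg]
    rw [this]
    exact h' S _
  push Not at h1 h2
  obtain ⟨s, hs⟩ := h1
  obtain ⟨t, ht⟩ := h2
  obtain ⟨b, hb⟩ : ∃ b, f s = .inr b := by
    rcases hfs : f s with a | b
    · exact (hs a hfs).elim
    · exact ⟨b, rfl⟩
  obtain ⟨a, ha⟩ : ∃ a, f t = .inl a := by
    rcases hfs : f t with a | b
    · exact ⟨a, rfl⟩
    · exact (ht b hfs).elim
  refine .inl (.inl fun hP => ?_)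
  have := (hP t s).map (Embedding.comap f (G ⊕g H)).toHom
  change (G ⊕g H).Reachable (f t) (f s) at this
  rw [ha, hb] at this
  exact not_reachable_sum_inl_inr a b this

/-- A good graph with several vertices has a nontrivial equivalence relation and a colouring,
that are invariant under quantum isomorphisms, and such that the adjacency of inequivalent
vertices depends only on their colours. -/
theorem IsGood.exists_split [Finite V] [Nontrivial V] (hG : G.IsGood) :
    ∃ (E : ∀ W : Type, SimpleGraph W → Setoid W) (t : ∀ W : Type, SimpleGraph W → W → Prop × Prop)
      (κ : Prop × Prop → Prop × Prop → Prop),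
      (∀ {V W K : Type} {X : Type w} [Ring X] [Fintype V] [Fintype W] {p : X} {u : W → V → X}
        {G : SimpleGraph V} {d : V → K} {H : SimpleGraph W} {d' : W → K}, QIso p u G d H d' →
        Rel2 u (E V G) (E W H) ∧ ∀ x a, u x a ≠ 0 → t W H x = t V G a) ∧
      (∃ a b, ¬ E V G a b) ∧ ∀ a b, ¬ E V G a b → (G.Adj a b ↔ κ (t V G a) (t V G b)) := by
  have hG' : (¬ G.Preconnected ∨ G.IsBlockLike) ∨ (¬ Gᶜ.Preconnected ∨ Gᶜ.IsBlockLike) :=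
    hG V (Function.Embedding.refl V)
  rcases hG' with h | h
  · obtain ⟨κ, h1, h2⟩ := exists_cut h
    -- The rule `κ` is chosen from `G`, but the relation and the colouring are defined for every
    -- graph: they have to be evaluated on a quantum isomorphic graph, which is not assumed to be
    -- good.
    exact ⟨fun W H => (H.cut κ).reachableSetoid, fun W H => H.centerColor,
      fun s t => κ s t ∨ κ t s, fun h => ⟨h.rel2_reachable (h.rel2_cut h.adj κ),
        h.centerColor_eq h.adj⟩, h1, h2⟩
  · obtain ⟨κ, h1, h2⟩ := exists_cut h
    refine ⟨fun W H => (Hᶜ.cut κ).reachableSetoid, fun W H => Hᶜ.centerColor,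
      fun s t => ¬ (κ s t ∨ κ t s), fun h => ⟨h.rel2_reachable (h.rel2_cut h.compl.adj κ),
        h.centerColor_eq h.compl.adj⟩, h1, fun a b hab => ?_⟩
    have hne : a ≠ b := by rintro rfl; exact hab (.refl _)
    have := h2 a b hab
    rw [compl_adj] at this
    exact ((not_congr this).symm.trans (by simp [hne])).symm

end IsGood

end SimpleGraph

/-! ### Superrigidity for coloured graphs -/

/-- Adding the entries between indices of type `s` by columns and by rows gives a multiple of `p` by
the number of columns, respectively rows, of that type. Since `p ≠ 0` and the scalars have
characteristic zero, the two numbers are equal. -/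
theorem QMagic.exists_equiv {V W γ : Type*} {X : Type*} [Ring X] [Algebra ℂ X] [Fintype V]
    [Fintype W] {p : X} {u : W → V → X} (h : QMagic p u) (hp : p ≠ 0) (τ : V → γ) (τ' : W → γ)
    (hτ : ∀ x a, u x a ≠ 0 → τ' x = τ a) : ∃ β : V ≃ W, ∀ a, τ' (β a) = τ a := by
  classical
  have key : ∀ s, Fintype.card {a // τ a = s} = Fintype.card {x // τ' x = s} := by
    intro s
    have e1 : ∑ a with τ a = s, ∑ x with τ' x = s, u x a = ∑ a with τ a = s, p := by
      refine Finset.sum_congr rfl fun a ha => ?_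
      rw [← h.col_sum a, Finset.sum_filter]
      refine Finset.sum_congr rfl fun x _ => ?_
      split_ifs with hx
      · rfl
      · by_contra hu
        exact hx ((hτ x a fun e => hu e.symm).trans (Finset.mem_filter.1 ha).2)
    have e2 : ∑ x with τ' x = s, ∑ a with τ a = s, u x a = ∑ x with τ' x = s, p := by
      refine Finset.sum_congr rfl fun x hx => ?_
      rw [← h.row_sum x, Finset.sum_filter]
      refine Finset.sum_congr rfl fun a _ => ?_
      split_ifs with ha
      · rfl
      · by_contra hu
        exact ha ((hτ x a fun e => hu e.symm).symm.trans (Finset.mem_filter.1 hx).2)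
    rw [Finset.sum_comm, e2, Finset.sum_const, Finset.sum_const, ← Nat.cast_smul_eq_nsmul ℂ,
      ← Nat.cast_smul_eq_nsmul ℂ] at e1
    have := Nat.cast_injective (smul_left_injective ℂ hp e1)
    rw [Fintype.card_subtype, Fintype.card_subtype, this]
  exact ⟨Equiv.ofFiberEquiv fun s => Fintype.equivOfCardEq (key s), Equiv.ofFiberEquiv_map _⟩

section

variable {V W K X : Type*} [Ring X] [Fintype V] [Fintype W] {p : X} {u : W → V → X}
  {G : SimpleGraph V} {d : V → K} {H : SimpleGraph W} {d' : W → K}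

theorem QIso.cIso_of_subsingleton [Subsingleton V] (h : QIso p u G d H d') (hp : p ≠ 0) :
    CIso G d H d' := by
  have hW : ∀ x y : W, x = y := by
    intro x y
    obtain ⟨a, b, hab⟩ := h.exists_cols hp x y
    exact (h.rel2_eq x y a b hab).2 (Subsingleton.elim a b)
  choose f hf using h.exists_row hp
  have hf' : Function.Bijective f := ⟨fun a b _ => Subsingleton.elim a b, fun x => by
    obtain ⟨a, -⟩ := h.exists_col hp x
    exact ⟨a, hW _ _⟩⟩
  refine ⟨Equiv.ofBijective f hf', fun a b => ?_, fun a => h.color _ _ (hf a)⟩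
  exact ⟨fun e => (e.ne (hW _ _)).elim, fun e => (e.ne (Subsingleton.elim _ _)).elim⟩

/-- The colours are refined by `t` because adjacency to the other classes is read off from `t`;
isomorphisms of classes have to respect it in order to be glued. -/
theorem QIso.restrict_block {K' Q Q' : Type*} {π : V → Q} {π' : W → Q'} {t : V → K'} {t' : W → K'}
    (h : QIso p u G d H d')
    (hπ : Rel2 u (fun a b => π a = π b) (fun x y => π' x = π' y))
    (ht : ∀ x a, u x a ≠ 0 → t' x = t a) (c' : Q') (hc' : ∃ x, π' x = c') (c : Q)
    [Fintype {a // π a = c}] [Fintype {x // π' x = c'}] :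
    QIso (blockSum u π π' c' c) (fun (x : {x // π' x = c'}) (a : {a // π a = c}) => u x a)
      (G.comap Subtype.val) (fun a => (d a, t a)) (H.comap Subtype.val) (fun x => (d' x, t' x)) where
  toQMagic := h.toQMagic.restrict_block hπ c' hc' c
  adj x y a b hu := h.adj x y a b hu
  color x a hu := by rw [h.color _ _ hu, ht _ _ hu]

end

/-- Isomorphism of the coloured subgraphs induced by two fibres. -/
abbrev FiberIso {V W K Q Q' : Type*} (G : SimpleGraph V) (d : V → K) (π : V → Q) (H : SimpleGraph W)
    (d' : W → K) (π' : W → Q') (c : Q) (c' : Q') : Prop :=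
  CIso (G.comap (Subtype.val : {a // π a = c} → V)) (fun a => d a)
    (H.comap (Subtype.val : {x // π' x = c'} → W)) (fun x => d' x)

/-- Isomorphisms between matched classes glue: adjacency inside a class is preserved by each of
them, and adjacency across classes follows the same rule `κ` on both sides, applied to preserved
colours. -/
theorem CIso.of_fiberIso {V W K L Q Q' : Type*} {G : SimpleGraph V} {d : V → K} {t : V → L}
    {π : V → Q} {H : SimpleGraph W} {d' : W → K} {t' : W → L} {π' : W → Q'} {κ : L → L → Prop}
    (hG : ∀ a b, π a ≠ π b → (G.Adj a b ↔ κ (t a) (t b)))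
    (hH : ∀ x y, π' x ≠ π' y → (H.Adj x y ↔ κ (t' x) (t' y)))
    (β : Q ≃ Q')
    (hβ : ∀ c, FiberIso G (fun a => (d a, t a)) π H (fun x => (d' x, t' x)) π' c (β c)) :
    CIso G d H d' := by
  choose f hf1 hf2 using hβ
  let F : V ≃ W := (Equiv.sigmaFiberEquiv π).symm.trans
    ((Equiv.sigmaCongr β f).trans (Equiv.sigmaFiberEquiv π'))
  have hF : ∀ c a (ha : π a = c), F a = (f c ⟨a, ha⟩).1 := by rintro _ a rfl; rfl
  have hcol : ∀ a, d' (F a) = d a ∧ t' (F a) = t a := fun a =>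
    Prod.ext_iff.1 (hf2 (π a) ⟨a, rfl⟩)
  have hπF : ∀ a, π' (F a) = β (π a) := fun a => (hF _ a rfl).symm ▸ (f (π a) ⟨a, rfl⟩).2
  refine ⟨F, fun a b => ?_, fun a => (hcol a).1⟩
  by_cases hab : π a = π b
  · rw [hF _ a hab, hF _ b rfl]
    exact hf1 (π b) ⟨a, hab⟩ ⟨b, rfl⟩
  · rw [hG a b hab, hH, (hcol a).2, (hcol b).2]
    rw [hπF, hπF]
    exact fun e => hab (β.injective e)

/-- Superrigidity, by induction on the number of vertices. Nonzero blocks give isomorphic classes,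
and counting in the magic matrix of block sums matches the classes of `G` with those of `H` up to
isomorphism. -/
theorem SimpleGraph.IsGood.cIso {X : Type w} [Ring X] [Algebra ℂ X] {V W K : Type} [Fintype V]
    [Fintype W] {p : X} {u : W → V → X} {G : SimpleGraph V} {d : V → K} {H : SimpleGraph W}
    {d' : W → K} (hG : G.IsGood) (h : QIso p u G d H d') (hp : p ≠ 0) : CIso G d H d' := by
  classical
  induction hn : Fintype.card V using Nat.strong_induction_on generalizing V W K p with
  | _ n ih =>
  subst hn
  rcases subsingleton_or_nontrivial V with hV | hV
  · exact h.cIso_of_subsingleton hp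
  obtain ⟨E, t, κ, hinv, ⟨a₀, b₀, hab₀⟩, hcross⟩ := hG.exists_split
  obtain ⟨hE, ht⟩ := hinv h
  let π : V → Quotient (E V G) := Quotient.mk _
  let π' : W → Quotient (E W H) := Quotient.mk _
  have hπ : Rel2 u (fun a b => π a = π b) (fun x y => π' x = π' y) := by
    intro x y a b hu
    exact Quotient.eq.trans ((hE x y a b hu).trans Quotient.eq.symm)
  have hcrossV : ∀ a b, π a ≠ π b → (G.Adj a b ↔ κ (t V G a) (t V G b)) := fun a b hab =>
    hcross a b fun e => hab (Quotient.sound e)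
  have hcrossW : ∀ x y, π' x ≠ π' y → (H.Adj x y ↔ κ (t W H x) (t W H y)) := by
    intro x y hxy
    obtain ⟨a, b, hab⟩ := h.exists_cols hp x y
    rw [ht x a fun e => hab (by rw [e, zero_mul]), ht y b fun e => hab (by rw [e, mul_zero]),
      h.adj x y a b hab]
    exact hcrossV a b fun e => hxy ((hπ x y a b hab).2 e)
  have hM := h.toQMagic.blockSum_magic hπ Quotient.mk_surjective Quotient.mk_surjective
  have hiso : ∀ c' c, blockSum u π π' c' c ≠ 0 →
      FiberIso G (fun a => (d a, t V G a)) π H (fun x => (d' x, t W H x)) π' c c' := by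
    intro c' c hc
    refine ih _ ?_ (hG.comap ⟨_, Subtype.val_injective⟩)
      (h.restrict_block hπ ht c' (Quotient.mk_surjective c') c) hc rfl
    by_cases hc₀ : π a₀ = c
    · exact Fintype.card_subtype_lt (x := b₀) fun e => hab₀ (Quotient.eq.1 (hc₀.trans e.symm))
    · exact Fintype.card_subtype_lt (x := a₀) hc₀
  -- The type of a class, on either side, is the set of classes of `G` isomorphic to it; so both
  -- labellings have values in the same set, and `c` belongs to its own type.
  let τ : Quotient (E V G) → Set (Quotient (E V G)) := fun c =>
    {c₁ | FiberIso G (fun a => (d a, t V G a)) π G (fun a => (d a, t V G a)) π c₁ c}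
  let τ' : Quotient (E W H) → Set (Quotient (E V G)) := fun c' =>
    {c₁ | FiberIso G (fun a => (d a, t V G a)) π H (fun x => (d' x, t W H x)) π' c₁ c'}
  obtain ⟨β, hβ⟩ := hM.exists_equiv hp τ τ' fun c' c hc => by
    ext c₁
    simp only [τ, τ', Set.mem_ofPred_eq]
    exact ⟨fun e => CIso.trans e (hiso c' c hc).symm, fun e => CIso.trans e (hiso c' c hc)⟩
  refine CIso.of_fiberIso hcrossV hcrossW β fun c => ?_
  have : c ∈ τ' (β c) := by
    rw [hβ]
    exact CIso.refl (G.comap (Subtype.val : {a // π a = c} → V)) fun a => (d a, t V G a)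
  exact this

/-! ### Block-cographs are good -/

namespace FinGraph

open SimpleGraph

theorem reachable_of_walk {V : Type} {G : SimpleGraph V} {S A : Set V} {T : Set S}
    (hT : ∀ a : S, a.1 ∈ A → a ∈ T) {a b : V} (p : G.Walk a b) (hp : ∀ z ∈ p.support, z ∈ S)
    (hA : ∀ z ∈ p.support, z ∈ A) (ha : a ∈ S) (hb : b ∈ S) (ha' : ⟨a, ha⟩ ∈ T) (hb' : ⟨b, hb⟩ ∈ T) :
    (((⊤ : G.Subgraph).induce S).coe.induce T).Reachable ⟨⟨a, ha⟩, ha'⟩ ⟨⟨b, hb⟩, hb'⟩ := by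
  induction p with
  | nil => exact .refl _
  | @cons a c b h p ih =>
    have hc : c ∈ S := hp c (by simp)
    have hc' : (⟨c, hc⟩ : S) ∈ T := hT _ (hA c (by simp))
    refine Reachable.trans (Adj.reachable ?_) (ih (fun z hz => hp z (by simp [hz]))
      (fun z hz => hA z (by simp [hz])) hc hb hc' hb')
    change ((⊤ : G.Subgraph).induce S).Adj a c
    exact ⟨ha, hc, h⟩

/-- The path `q` closes up through `r` to a cycle. After removal of `r` the path remains; after
removal of another vertex, every remaining vertex is still joined to `r` along one of the two arcs.
-/
theorem isTwoConnected_induce_cycle {V : Type} {G : SimpleGraph V} {r x y : V} (hx : G.Adj r x)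
    (hy : G.Adj r y) (q : G.Walk x y) (hq : q.IsPath) (hr : r ∉ q.support) :
    IsTwoConnected ((⊤ : G.Subgraph).induce {z | z = r ∨ z ∈ q.support}).coe := by
  classical
  set S : Set V := {z | z = r ∨ z ∈ q.support} with hS
  have key : ∀ c : V, ∀ a ∈ S, a ≠ c → r ≠ c →
      ∃ p : G.Walk r a, ∀ z ∈ p.support, z ∈ S ∧ z ≠ c := by
    intro c a ha hac hrc
    have hxS : ∀ (z : V) (p' : G.Walk x z), p'.support ⊆ q.support → c ∉ p'.support →
        ∃ p : G.Walk r z, ∀ z ∈ p.support, z ∈ S ∧ z ≠ c := by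
      intro z p' h1 h2
      refine ⟨.cons hx p', fun w hw => ?_⟩
      rw [Walk.support_cons, List.mem_cons] at hw
      rcases hw with rfl | hw
      · exact ⟨.inl rfl, hrc⟩
      · exact ⟨.inr (h1 hw), fun e => h2 (e ▸ hw)⟩
    have hyS : ∀ (z : V) (p' : G.Walk y z), p'.support ⊆ q.support → c ∉ p'.support →
        ∃ p : G.Walk r z, ∀ z ∈ p.support, z ∈ S ∧ z ≠ c := by
      intro z p' h1 h2
      refine ⟨.cons hy p', fun w hw => ?_⟩
      rw [Walk.support_cons, List.mem_cons] at hw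
      rcases hw with rfl | hw
      · exact ⟨.inl rfl, hrc⟩
      · exact ⟨.inr (h1 hw), fun e => h2 (e ▸ hw)⟩
    rcases ha with rfl | ha
    · refine ⟨.nil, fun z hz => ?_⟩
      obtain rfl := List.mem_singleton.1 hz
      exact ⟨.inl rfl, hac⟩
    -- A vertex before `c` on the path is reached from `r` through `x`, and a vertex after `c`
    -- through `y`.
    by_cases hc : c ∈ q.support
    · have ha2 := ha
      rw [← q.take_spec hc, Walk.mem_support_append_iff] at ha2
      rcases ha2 with ha2 | ha2
      · refine hxS a ((q.takeUntil c hc).takeUntil a ha2) ?_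
          (Walk.endpoint_notMem_support_takeUntil (hq.takeUntil hc) ha2 hac.symm)
        exact fun z hz => Walk.support_takeUntil_subset_support _ _
          (Walk.support_takeUntil_subset_support _ _ hz)
      · have ha3 : a ∈ (q.dropUntil c hc).reverse.support := by simpa using ha2
        refine hyS a ((q.dropUntil c hc).reverse.takeUntil a ha3) ?_
          (Walk.endpoint_notMem_support_takeUntil (hq.dropUntil hc).reverse ha3 hac.symm)
        intro z hz
        have hz' := Walk.support_takeUntil_subset_support _ _ hz
        exact Walk.support_dropUntil_subset_support _ hc (by simpa using hz')
    · exact hxS a (q.takeUntil a ha) (Walk.support_takeUntil_subset_support _ _)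
        fun h => hc (Walk.support_takeUntil_subset_support _ _ h)
  have hrS : r ∈ S := .inl rfl
  refine ⟨?_, ?_⟩
  · suffices H : ∀ a : S, ((⊤ : G.Subgraph).induce S).coe.Reachable ⟨r, hrS⟩ a from
      fun a b => (H a).symm.trans (H b)
    rintro ⟨a, ha⟩
    obtain ⟨p, hp⟩ : ∃ p : G.Walk r a, ∀ z ∈ p.support, z ∈ S := by
      rcases ha with rfl | ha
      · exact ⟨.nil, by simp [hrS]⟩
      · refine ⟨.cons hx (q.takeUntil a ha), fun z hz => ?_⟩
        rw [Walk.support_cons, List.mem_cons] at hz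
        exact hz.imp id fun h => Walk.support_takeUntil_subset_support _ _ h
    exact (reachable_of_walk (A := Set.univ) (T := Set.univ) (fun _ _ => trivial) p hp
      (fun _ _ => trivial) hrS ha trivial trivial).map (Embedding.induce _).toHom
  · rintro ⟨c, hc⟩
    have hT : ∀ a : S, a.1 ∈ ({c}ᶜ : Set V) → a ∈ ({⟨c, hc⟩}ᶜ : Set S) := fun a ha h =>
      ha (congrArg Subtype.val h)
    by_cases hrc : r = c
    · subst hrc
      rintro ⟨⟨a, ha⟩, ha'⟩ ⟨⟨b, hb⟩, hb'⟩
      have ha2 : a ∈ q.support := ha.resolve_left fun e => ha' (Subtype.ext e)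
      have hb2 : b ∈ q.support := hb.resolve_left fun e => hb' (Subtype.ext e)
      have hsub : ∀ z ∈ ((q.takeUntil a ha2).reverse.append (q.takeUntil b hb2)).support,
          z ∈ q.support := by
        intro z hz
        rw [Walk.mem_support_append_iff, Walk.support_reverse, List.mem_reverse] at hz
        exact hz.elim (fun h => Walk.support_takeUntil_subset_support _ _ h)
          (fun h => Walk.support_takeUntil_subset_support _ _ h)
      exact reachable_of_walk hT _ (fun z hz => .inr (hsub z hz))
        (fun z hz e => hr (e ▸ hsub z hz)) ha hb ha' hb'
    · have hr' : (⟨r, hrS⟩ : S) ∈ ({⟨c, hc⟩}ᶜ : Set S) := fun e => hrc (congrArg Subtype.val e)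
      suffices H : ∀ a : ({⟨c, hc⟩}ᶜ : Set S),
          (((⊤ : G.Subgraph).induce S).coe.induce {⟨c, hc⟩}ᶜ).Reachable ⟨⟨r, hrS⟩, hr'⟩ a from
        fun a b => (H a).symm.trans (H b)
      rintro ⟨⟨a, ha⟩, ha'⟩
      obtain ⟨p, hp⟩ := key c a ha (fun e => ha' (Subtype.ext e)) hrc
      exact reachable_of_walk hT p (fun z hz => (hp z hz).1) (fun z hz => (hp z hz).2) hrS ha hr' ha'

/-- By finiteness every 2-connected subgraph lies in a block, and the blocks are complete. -/
theorem adj_of_isTwoConnected {V : Type} [Finite V] {G : SimpleGraph V}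
    (hG : ∀ B : G.Subgraph, IsBlock B → B.coe = ⊤) (H : G.Subgraph) (hH : IsTwoConnected H.coe)
    {x y : V} (hx : x ∈ H.verts) (hy : y ∈ H.verts) (hxy : x ≠ y) : G.Adj x y := by
  have : Finite G.Subgraph := by infer_instance
  obtain ⟨B, hHB, hB⟩ := (Set.toFinite {B : G.Subgraph | IsTwoConnected B.coe}).exists_le_maximal hH
  have h := hG B hB
  have : B.coe.Adj ⟨x, hHB.1 hx⟩ ⟨y, hHB.1 hy⟩ := by
    rw [h]
    exact fun e => hxy (congrArg Subtype.val e)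
  exact B.adj_sub this

theorem isBlockLike_of_mem_blockGraphs {G : FinGraph} (hG : G ∈ blockGraphs) :
    G.graph.IsBlockLike := by
  classical
  rintro r x y hx hy hxy ⟨q, hq⟩
  refine adj_of_isTwoConnected hG _ (isTwoConnected_induce_cycle hx hy q.toPath.1 q.toPath.2
    fun h => hq (q.support_toPath_subset_support h)) ?_ ?_ hxy
  · exact .inr (Walk.start_mem_support _)
  · exact .inr (Walk.end_mem_support _)

theorem isGood_of_mem_blockCographs {G : FinGraph} (hG : G ∈ blockCographs) : G.graph.IsGood := by
  have hG : Cographs blockGraphs G := hG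
  induction hG with
  | of h => exact (isBlockLike_of_mem_blockGraphs h).isGood
  | iso e _ ih => exact (ih ‹_›).iso e.some
  | compl _ ih => exact (ih ‹_›).compl
  | sum _ _ ih ih' => exact (ih ‹_›).sum (ih' ‹_›)

end FinGraph

/-! ### Decompositions of coloured graphs -/

/-- A partition of a coloured graph into two coloured graphs, respected by all quantum
automorphisms, such that adjacency between the two parts depends only on colours. -/
structure SumDecomp {V V₁ V₂ K K₁ K₂ : Type} [Fintype V] (G : SimpleGraph V) (d : V → K)
    (G₁ : SimpleGraph V₁) (d₁ : V₁ → K₁) (G₂ : SimpleGraph V₂) (d₂ : V₂ → K₂)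
    (e : V₁ ⊕ V₂ ≃ V) : Prop where
  adj_inl : ∀ a b, G.Adj (e (.inl a)) (e (.inl b)) ↔ G₁.Adj a b
  adj_inr : ∀ a b, G.Adj (e (.inr a)) (e (.inr b)) ↔ G₂.Adj a b
  cross : ∀ a a' b b', d₁ a = d₁ a' → d₂ b = d₂ b' →
    (G.Adj (e (.inl a)) (e (.inr b)) ↔ G.Adj (e (.inl a')) (e (.inr b')))
  color_inl : ∀ a a', d₁ a = d₁ a' → d (e (.inl a)) = d (e (.inl a'))
  color_inr : ∀ a a', d₂ a = d₂ a' → d (e (.inr a)) = d (e (.inr a'))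
  zero : ∀ {X : Type} [Ring X] [Algebra ℂ X] {p : X} {u : V → V → X}, QIso p u G d G d →
    ∀ a b, u (e (.inl a)) (e (.inr b)) = 0 ∧ u (e (.inr b)) (e (.inl a)) = 0
  inv_inl : ∀ {X : Type} [Ring X] [Algebra ℂ X] {p : X} {u : V → V → X}, QIso p u G d G d →
    ∀ a b, u (e (.inl a)) (e (.inl b)) ≠ 0 → d₁ a = d₁ b
  inv_inr : ∀ {X : Type} [Ring X] [Algebra ℂ X] {p : X} {u : V → V → X}, QIso p u G d G d →
    ∀ a b, u (e (.inr a)) (e (.inr b)) ≠ 0 → d₂ a = d₂ b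

/-- A partition of a coloured graph into `n` copies of a coloured graph, respected by all quantum
automorphisms, such that adjacency between the parts depends only on colours. -/
structure WreathDecomp {V C K K' : Type} [Fintype V] (G : SimpleGraph V) (d : V → K)
    (G' : SimpleGraph C) (d' : C → K') (n : ℕ) (e : Fin n × C ≃ V) : Prop where
  adj : ∀ i a b, G.Adj (e (i, a)) (e (i, b)) ↔ G'.Adj a b
  cross : ∀ i j i' j' a a' b b', i ≠ j → i' ≠ j' → d' a = d' a' → d' b = d' b' →
    (G.Adj (e (i, a)) (e (j, b)) ↔ G.Adj (e (i', a')) (e (j', b')))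
  color : ∀ i j a b, d' a = d' b → d (e (i, a)) = d (e (j, b))
  rel : ∀ {X : Type} [Ring X] [Algebra ℂ X] {p : X} {u : V → V → X}, QIso p u G d G d →
    Rel2 u (fun a b => (e.symm a).1 = (e.symm b).1) (fun a b => (e.symm a).1 = (e.symm b).1)
  inv : ∀ {X : Type} [Ring X] [Algebra ℂ X] {p : X} {u : V → V → X}, QIso p u G d G d →
    ∀ i j a b, u (e (i, a)) (e (j, b)) ≠ 0 → d' a = d' b

/-- A nonzero entry makes the sum of its block nonzero, so superrigidity applies to that block. -/
theorem QIso.fiberIso {V W K L Q Q' X : Type} [Ring X] [Algebra ℂ X] [Fintype V] [Fintype W]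
    {p : X} {u : W → V → X} {G : SimpleGraph V} {d : V → K} {H : SimpleGraph W} {d' : W → K}
    {π : V → Q} {π' : W → Q'} {t : V → L} {t' : W → L} (h : QIso p u G d H d') (hG : G.IsGood)
    (hπ : Rel2 u (fun a b => π a = π b) (fun x y => π' x = π' y))
    (ht : ∀ x a, u x a ≠ 0 → t' x = t a) (x : W) (a : V) (hu : u x a ≠ 0) :
    FiberIso G (fun a => (d a, t a)) π H (fun x => (d' x, t' x)) π' (π a) (π' x) := by
  classical
  refine (hG.comap ⟨_, Subtype.val_injective⟩).cIso
    (h.restrict_block hπ ht (π' x) ⟨x, rfl⟩ (π a)) ?_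
  intro h0
  rw [← h.mul_blockSum hπ x a, h0, mul_zero] at hu
  exact hu rfl

/-- Induction principle for good coloured graphs. -/
theorem SimpleGraph.IsGood.induction
    {P : ∀ {V K : Type} [Fintype V] [Nonempty V], SimpleGraph V → (V → K) → Prop}
    (single : ∀ {V K : Type} [Fintype V] [Nonempty V] (G : SimpleGraph V) (d : V → K),
      Subsingleton V → P G d)
    (sum : ∀ {V V₁ V₂ K K₁ K₂ : Type} [Fintype V] [Nonempty V] [Fintype V₁] [Nonempty V₁]
      [Fintype V₂] [Nonempty V₂] {G : SimpleGraph V} {d : V → K} {G₁ : SimpleGraph V₁}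
      {d₁ : V₁ → K₁} {G₂ : SimpleGraph V₂} {d₂ : V₂ → K₂} {e : V₁ ⊕ V₂ ≃ V},
      SumDecomp G d G₁ d₁ G₂ d₂ e → P G₁ d₁ → P G₂ d₂ → P G d)
    (wreath : ∀ {V C K K' : Type} [Fintype V] [Nonempty V] [Fintype C] [Nonempty C]
      {G : SimpleGraph V} {d : V → K} {G' : SimpleGraph C} {d' : C → K'} {n : ℕ}
      {e : Fin n × C ≃ V}, 2 ≤ n → WreathDecomp G d G' d' n e → P G' d' → P G d)
    {V K : Type} [Fintype V] [Nonempty V] {G : SimpleGraph V} (d : V → K) (hG : G.IsGood) :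
    P G d := by
  classical
  induction hn : Fintype.card V using Nat.strong_induction_on generalizing V K with
  | _ n ih =>
  subst hn
  rcases subsingleton_or_nontrivial V with hV | hV
  · exact single G d hV
  obtain ⟨E, t, κ, hinv, ⟨a₀, b₀, hab₀⟩, hcross⟩ := hG.exists_split
  let π : V → Quotient (E V G) := Quotient.mk _
  have hπ : ∀ {X : Type} [Ring X] [Algebra ℂ X] {p : X} {u : V → V → X}, QIso p u G d G d →
      Rel2 u (fun a b => π a = π b) (fun x y => π x = π y) :=
    fun h x y a b hu => Quotient.eq.trans (((hinv h).1 x y a b hu).trans Quotient.eq.symm)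
  have hcrossV : ∀ a b, π a ≠ π b → (G.Adj a b ↔ κ (t V G a) (t V G b)) := fun a b hab =>
    hcross a b fun e => hab (Quotient.sound e)
  let d' : V → K × (Prop × Prop) := fun a => (d a, t V G a)
  -- The dichotomy: either all classes are isomorphic to that of `a₀`, and the graph consists of
  -- copies of it, or the union of the classes of this type and its complement form an invariant
  -- partition.
  let T : V → Prop := fun b => FiberIso G d' π G d' π (π a₀) (π b)
  have hcol : ∀ {X : Type} [Ring X] [Algebra ℂ X] {p : X} {u : V → V → X}, QIso p u G d G d →
      ∀ x a, u x a ≠ 0 → d' x = d' a :=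
    fun h x a hu => Prod.ext (h.color x a hu) ((hinv h).2 x a hu)
  by_cases hT : ∀ b, T b
  · choose f hf1 hf2 using hT
    let C := {a // π a = π a₀}
    have : Nonempty C := ⟨⟨a₀, rfl⟩⟩
    let m := Fintype.card (Quotient (E V G))
    let σ : Fin m ≃ Quotient (E V G) := (Fintype.equivFin _).symm
    -- A representative of each class fixes one isomorphism from the model class, so that all
    -- vertices of a class are labelled consistently.
    let g : ∀ c : Quotient (E V G), C ≃ {a // π a = c} := fun c =>
      (f c.out).trans (Equiv.subtypeEquivRight fun a => by
        rw [show π c.out = c from c.out_eq])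
    let e : Fin m × C ≃ V := (Equiv.sigmaEquivProd _ _).symm.trans
      ((Equiv.sigmaCongr σ fun i => g (σ i)).trans (Equiv.sigmaFiberEquiv π))
    have heπ : ∀ i a, π (e (i, a)) = σ i := fun i a => (g (σ i) a).2
    have hed : ∀ i a, d' (e (i, a)) = d' a := fun i a => hf2 _ a
    have hsymm : ∀ a, σ (e.symm a).1 = π a := fun a => by
      rw [← heπ (e.symm a).1 (e.symm a).2]; simp
    refine wreath (n := m) (e := e) (G' := G.comap (Subtype.val : C → V)) (d' := fun a => d' a)
      ?_ ⟨?_, ?_, ?_, ?_, ?_⟩ (ih _ ?_ _ (hG.comap ⟨_, Subtype.val_injective⟩) rfl)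
    · exact Fintype.one_lt_card_iff.2 ⟨π a₀, π b₀, fun h => hab₀ (Quotient.eq.1 h)⟩
    · exact fun i a b => hf1 _ a b
    · intro i j i' j' a a' b b' hij hij' ha hb
      have ha' := congrArg Prod.snd ((hed i a).trans (ha.trans (hed i' a').symm))
      have hb' := congrArg Prod.snd ((hed j b).trans (hb.trans (hed j' b').symm))
      have h1 : π (e (i, a)) ≠ π (e (j, b)) := by
        rw [heπ, heπ]; exact fun h => hij (σ.injective h)
      have h2 : π (e (i', a')) ≠ π (e (j', b')) := by
        rw [heπ, heπ]; exact fun h => hij' (σ.injective h)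
      rw [hcrossV _ _ h1, hcrossV _ _ h2]
      change κ (d' _).2 (d' _).2 ↔ κ (d' _).2 (d' _).2
      rw [ha', hb']
    · intro i j a b hab
      exact congrArg Prod.fst ((hed i a).trans (hab.trans (hed j b).symm))
    · intro X _ _ p u h x y a b hu
      have := hπ h x y a b hu
      simp only [← hsymm, σ.injective.eq_iff] at this
      exact this
    · intro X _ _ p u h i j a b hu
      rw [← hed i a, ← hed j b]
      exact hcol h _ _ hu
    · exact Fintype.card_subtype_lt (x := b₀) fun e => hab₀ (Quotient.eq.1 e.symm)
  · push Not at hT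
    obtain ⟨b₁, hb₁⟩ := hT
    have ha₀ : T a₀ := CIso.refl (G.comap (Subtype.val : {a // π a = π a₀} → V)) fun a => d' a
    have hTπ : ∀ a b, T a → ¬ T b → π a ≠ π b := by
      intro a b ha hb h
      apply hb
      change FiberIso G d' π G d' π (π a₀) (π b)
      rw [← h]
      exact ha
    have hTu : ∀ {X : Type} [Ring X] [Algebra ℂ X] {p : X} {u : V → V → X}, QIso p u G d G d →
        ∀ x a, u x a ≠ 0 → (T x ↔ T a) := by
      intro X _ _ p u h x a hu
      have := h.fiberIso hG (hπ h) (hinv h).2 x a hu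
      exact ⟨fun e => CIso.trans e this.symm, fun e => CIso.trans e this⟩
    have : Nonempty {a // T a} := ⟨⟨a₀, ha₀⟩⟩
    have : Nonempty {a // ¬ T a} := ⟨⟨b₁, hb₁⟩⟩
    refine sum (e := Equiv.sumCompl T) (G₁ := G.comap (Subtype.val : {a // T a} → V))
      (G₂ := G.comap (Subtype.val : {a // ¬ T a} → V)) (d₁ := fun a => d' a) (d₂ := fun a => d' a)
      ⟨fun _ _ => Iff.rfl, fun _ _ => Iff.rfl, ?_, ?_, ?_, ?_, ?_, ?_⟩
      (ih _ ?_ _ (hG.comap ⟨_, Subtype.val_injective⟩) rfl)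
      (ih _ ?_ _ (hG.comap ⟨_, Subtype.val_injective⟩) rfl)
    · rintro ⟨a, ha⟩ ⟨a', ha'⟩ ⟨b, hb⟩ ⟨b', hb'⟩ h1 h2
      change G.Adj a b ↔ G.Adj a' b'
      rw [hcrossV a b (hTπ a b ha hb), hcrossV a' b' (hTπ a' b' ha' hb')]
      change κ (d' a).2 (d' b).2 ↔ κ (d' a').2 (d' b').2
      rw [show d' a = d' a' from h1, show d' b = d' b' from h2]
    · exact fun a a' h => congrArg Prod.fst h
    · exact fun a a' h => congrArg Prod.fst h
    · intro X _ _ p u h a b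
      refine ⟨?_, ?_⟩ <;> by_contra hu
      · exact b.2 ((hTu h _ _ hu).1 a.2)
      · exact b.2 ((hTu h _ _ hu).2 a.2)
    · exact fun h a b hu => hcol h _ _ hu
    · exact fun h a b hu => hcol h _ _ hu
    · exact Fintype.card_subtype_lt (x := b₁) hb₁
    · exact Fintype.card_subtype_lt (x := a₀) (not_not.2 ha₀)

/-! ### The blocks of a quantum automorphism of a decomposed graph -/

section restrict

variable {V V₁ V₂ C K K₁ K₂ X : Type} [Ring X] [Algebra ℂ X] [Fintype V] {p : X} {u : V → V → X}

theorem SumDecomp.qIso_inl [Fintype V₁] [Fintype V₂] {G : SimpleGraph V} {d : V → K}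
    {G₁ : SimpleGraph V₁} {d₁ : V₁ → K₁} {G₂ : SimpleGraph V₂} {d₂ : V₂ → K₂} {e : V₁ ⊕ V₂ ≃ V}
    (h : SumDecomp G d G₁ d₁ G₂ d₂ e) (hu : QIso p u G d G d) :
    QIso p (fun x y => u (e (.inl x)) (e (.inl y))) G₁ d₁ G₁ d₁ where
  idem x y := hu.idem _ _
  row_orth x y z hyz := hu.row_orth _ _ _ fun e' => hyz (Sum.inl_injective (e.injective e'))
  col_orth x y z hyz := hu.col_orth _ _ _ fun e' => hyz (Sum.inl_injective (e.injective e'))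
  row_sum x := by
    rw [← hu.row_sum (e (.inl x)), ← e.sum_comp, Fintype.sum_sum_type]
    simp [(h.zero hu _ _).1]
  col_sum x := by
    rw [← hu.col_sum (e (.inl x)), ← e.sum_comp, Fintype.sum_sum_type]
    simp [(h.zero hu _ _).2]
  adj x y a b hne := by
    rw [← h.adj_inl, ← h.adj_inl]
    exact hu.adj _ _ _ _ hne
  color x a := h.inv_inl hu x a

theorem SumDecomp.qIso_inr [Fintype V₁] [Fintype V₂] {G : SimpleGraph V} {d : V → K}
    {G₁ : SimpleGraph V₁} {d₁ : V₁ → K₁} {G₂ : SimpleGraph V₂} {d₂ : V₂ → K₂} {e : V₁ ⊕ V₂ ≃ V}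
    (h : SumDecomp G d G₁ d₁ G₂ d₂ e) (hu : QIso p u G d G d) :
    QIso p (fun x y => u (e (.inr x)) (e (.inr y))) G₂ d₂ G₂ d₂ where
  idem x y := hu.idem _ _
  row_orth x y z hyz := hu.row_orth _ _ _ fun e' => hyz (Sum.inr_injective (e.injective e'))
  col_orth x y z hyz := hu.col_orth _ _ _ fun e' => hyz (Sum.inr_injective (e.injective e'))
  row_sum x := by
    rw [← hu.row_sum (e (.inr x)), ← e.sum_comp, Fintype.sum_sum_type]
    simp [(h.zero hu _ _).2]
  col_sum x := by
    rw [← hu.col_sum (e (.inr x)), ← e.sum_comp, Fintype.sum_sum_type]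
    simp [(h.zero hu _ _).1]
  adj x y a b hne := by
    rw [← h.adj_inr, ← h.adj_inr]
    exact hu.adj _ _ _ _ hne
  color x a := h.inv_inr hu x a

variable {n : ℕ} {G : SimpleGraph V} {d : V → K} {G' : SimpleGraph C} {d' : C → K₁}
  {e : Fin n × C ≃ V}

theorem sum_fst_eq [Fintype C] (e : Fin n × C ≃ V) (f : V → X) (j : Fin n)
    [DecidablePred fun b => (e.symm b).1 = j] :
    ∑ b with (e.symm b).1 = j, f b = ∑ y, f (e (j, y)) := by
  rw [Finset.sum_filter, ← e.sum_comp, Fintype.sum_prod_type, Finset.sum_eq_single j]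
  · simp
  · intro i _ hi; simp [hi]
  · simp

/-- The coefficient `(i, j)` of the quantum permutation of the copies. -/
abbrev copyPerm (u : V → V → X) (e : Fin n × C ≃ V) : Fin n → Fin n → X :=
  blockSum u (fun a => (e.symm a).1) (fun a => (e.symm a).1)

variable [Fintype C]

theorem WreathDecomp.copyPerm_row (h : WreathDecomp G d G' d' n e) (hu : QIso p u G d G d)
    (i j : Fin n) (x : C) : ∑ y, u (e (i, x)) (e (j, y)) = copyPerm u e i j := by
  classical
  have := hu.blockSum_row (h.rel hu) (e (i, x)) j
  rw [sum_fst_eq] at this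
  simpa using this

theorem WreathDecomp.copyPerm_col [Nonempty C] (h : WreathDecomp G d G' d' n e)
    (hu : QIso p u G d G d) (i j : Fin n) (y : C) :
    ∑ x, u (e (i, x)) (e (j, y)) = copyPerm u e i j := by
  classical
  obtain ⟨c⟩ := ‹Nonempty C›
  have := hu.blockSum_col (h.rel hu) i ⟨e (i, c), by simp⟩ (e (j, y))
  rw [sum_fst_eq e (fun z => u z (e (j, y)))] at this
  simpa using this

theorem WreathDecomp.copyPerm_magic [Nonempty C] (h : WreathDecomp G d G' d' n e)
    (hu : QIso p u G d G d) : QMagic p (copyPerm u e) := by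
  obtain ⟨c⟩ := ‹Nonempty C›
  have hs : Function.Surjective fun a => (e.symm a).1 := fun i => ⟨e (i, c), by simp⟩
  exact hu.blockSum_magic (h.rel hu) hs hs

theorem WreathDecomp.qIso_block [Nonempty C] (h : WreathDecomp G d G' d' n e)
    (hu : QIso p u G d G d) (i j : Fin n) :
    QIso (copyPerm u e i j) (fun x y => u (e (i, x)) (e (j, y))) G' d' G' d' where
  idem x y := hu.idem _ _
  row_orth x y z hyz := hu.row_orth _ _ _ fun e' => hyz (congrArg Prod.snd (e.injective e'))
  col_orth x y z hyz := hu.col_orth _ _ _ fun e' => hyz (congrArg Prod.snd (e.injective e'))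
  row_sum x := h.copyPerm_row hu i j x
  col_sum x := h.copyPerm_col hu i j x
  adj x y a b hne := by
    rw [← h.adj i, ← h.adj j]
    exact hu.adj _ _ _ _ hne
  color x a := h.inv hu i j x a

/-- Invariance of the partition into copies: two rows lie in the same copy exactly when the columns
do, unless the product vanishes. -/
theorem WreathDecomp.mul_eq_zero (h : WreathDecomp G d G' d' n e) (hu : QIso p u G d G d)
    {i j k l : Fin n} (hne : ¬ (i = k ↔ j = l)) (x y z t : C) :
    u (e (i, x)) (e (j, y)) * u (e (k, z)) (e (l, t)) = 0 := by
  by_contra h0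
  exact hne (by simpa using h.rel hu _ _ _ _ h0)

/-- The quantum automorphism of the `i`-th copy. -/
def copyAut (u : V → V → X) (e : Fin n × C ≃ V) (i : Fin n) (x y : C) : X :=
  ∑ j, u (e (i, x)) (e (j, y))

theorem WreathDecomp.qIso_copyAut [Nonempty C] (h : WreathDecomp G d G' d' n e)
    (hu : QIso p u G d G d) (i : Fin n) : QIso p (copyAut u e i) G' d' G' d' where
  idem x y := by
    rw [copyAut, Finset.sum_mul_sum]
    refine Finset.sum_congr rfl fun j _ => ?_
    rw [Finset.sum_eq_single j (fun k _ hk => h.mul_eq_zero hu (by simpa using hk.symm) _ _ _ _)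
      (by simp), hu.idem]
  row_orth x y z hyz := by
    rw [copyAut, copyAut, Finset.sum_mul_sum]
    exact Finset.sum_eq_zero fun j _ => Finset.sum_eq_zero fun k _ =>
      hu.row_orth _ _ _ fun e' => hyz (congrArg Prod.snd (e.injective e'))
  col_orth x y z hxy := by
    rw [copyAut, copyAut, Finset.sum_mul_sum]
    refine Finset.sum_eq_zero fun j _ => Finset.sum_eq_zero fun k _ => ?_
    by_cases hjk : j = k
    · subst hjk
      exact hu.col_orth _ _ _ fun e' => hxy (congrArg Prod.snd (e.injective e'))
    · exact h.mul_eq_zero hu (by simpa using hjk) _ _ _ _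
  row_sum x := by
    simp only [copyAut]
    rw [Finset.sum_comm]
    simp only [h.copyPerm_row hu, (h.copyPerm_magic hu).row_sum]
  col_sum x := by
    simp only [copyAut]
    rw [Finset.sum_comm]
    simp only [h.copyPerm_col hu, (h.copyPerm_magic hu).row_sum]
  adj x y a b hne := by
    rw [copyAut, copyAut, Finset.sum_mul_sum] at hne
    obtain ⟨j, -, hj⟩ := Finset.exists_ne_zero_of_sum_ne_zero hne
    obtain ⟨k, -, hk⟩ := Finset.exists_ne_zero_of_sum_ne_zero hj
    have hjk : j = k := by
      by_contra hjk
      exact hk (h.mul_eq_zero hu (by simpa using hjk) _ _ _ _)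
    subst hjk
    rw [← h.adj i, ← h.adj j]
    exact hu.adj _ _ _ _ hk
  color x a hne := by
    obtain ⟨j, -, hj⟩ := Finset.exists_ne_zero_of_sum_ne_zero hne
    exact h.inv hu i j x a hj

/-- Orthogonality kills all terms but one. With the factors in the other order the product is the
same, which is exactly the commutation relation of a free wreath product. -/
theorem WreathDecomp.copyAut_mul_copyPerm (h : WreathDecomp G d G' d' n e) (hu : QIso p u G d G d)
    (i j : Fin n) (x y : C) : copyAut u e i x y * copyPerm u e i j = u (e (i, x)) (e (j, y)) := by
  rw [← h.copyPerm_row hu i j x, copyAut, Finset.sum_mul_sum, Finset.sum_eq_single j,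
    Finset.sum_eq_single y, hu.idem]
  · exact fun z _ hz => hu.row_orth _ _ _ fun e' => hz (congrArg Prod.snd (e.injective e')).symm
  · simp
  · exact fun k _ hk => Finset.sum_eq_zero fun z _ => h.mul_eq_zero hu (by simpa using hk) _ _ _ _
  · simp

theorem WreathDecomp.copyPerm_mul_copyAut (h : WreathDecomp G d G' d' n e) (hu : QIso p u G d G d)
    (i j : Fin n) (x y : C) : copyPerm u e i j * copyAut u e i x y = u (e (i, x)) (e (j, y)) := by
  rw [← h.copyPerm_row hu i j x, copyAut, Finset.sum_mul_sum, Finset.sum_eq_single y,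
    Finset.sum_eq_single j, hu.idem]
  · exact fun k _ hk => h.mul_eq_zero hu (by simpa using hk.symm) _ _ _ _
  · simp
  · exact fun z _ hz => Finset.sum_eq_zero fun k _ =>
      hu.row_orth _ _ _ fun e' => hz (congrArg Prod.snd (e.injective e'))
  · simp

end restrict

/-! ### Quantum automorphism groups of coloured graphs -/

theorem UnivStarAlg.hom_ext {Y : Type} {r : StarTerm Y → StarTerm Y → Prop} {B : Type*} [Ring B]
    [StarRing B] [Algebra ℂ B] [StarModule ℂ B] {φ ψ : UnivStarAlg r →⋆ₐ[ℂ] B}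
    (h : ∀ x, φ (.of r x) = ψ (.of r x)) : φ = ψ :=
  StarAlgHom.ext_of_adjoin_eq_top (UnivStarAlg.adjoin_of (r := r)) (by rintro _ ⟨x, rfl⟩; exact h x)

namespace QPermGroup

theorem hom_ext {P : QPermGroup} {B : Type*} [Ring B] [StarRing B] [Algebra ℂ B] [StarModule ℂ B]
    {φ ψ : P.A →⋆ₐ[ℂ] B} (h : ∀ i j, φ (P.u i j) = ψ (P.u i j)) : φ = ψ :=
  StarAlgHom.ext_of_adjoin_eq_top P.adjoin_u (by rintro _ ⟨x, rfl⟩; exact h x.1 x.2)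

theorem Isomorphic.of_homs {P Q : QPermGroup} (φ : P.A →⋆ₐ[ℂ] Q.A) (ψ : Q.A →⋆ₐ[ℂ] P.A)
    (h1 : ψ.comp φ = .id ℂ P.A) (h2 : φ.comp ψ = .id ℂ Q.A)
    (hΔ : (tensorMap φ φ).comp P.Δ = Q.Δ.comp φ) : P.Isomorphic Q :=
  ⟨StarAlgEquiv.ofStarAlgHom φ ψ h1 h2, fun a => DFunLike.congr_fun hΔ a⟩

theorem Isomorphic.exists_homs {P Q : QPermGroup} (h : P.Isomorphic Q) :
    ∃ (φ : P.A →⋆ₐ[ℂ] Q.A) (ψ : Q.A →⋆ₐ[ℂ] P.A), ψ.comp φ = .id ℂ P.A ∧ φ.comp ψ = .id ℂ Q.A ∧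
      (tensorMap φ φ).comp P.Δ = Q.Δ.comp φ := by
  obtain ⟨φ, hφ⟩ := h
  exact ⟨φ, φ.symm, by ext; simp, by ext; simp, by ext a; exact hφ a⟩

theorem tensorMap_comp_Δ {P Q : QPermGroup} {φ : P.A →⋆ₐ[ℂ] Q.A} {ψ : Q.A →⋆ₐ[ℂ] P.A}
    (h1 : ψ.comp φ = .id ℂ P.A) (h2 : φ.comp ψ = .id ℂ Q.A)
    (hΔ : (tensorMap φ φ).comp P.Δ = Q.Δ.comp φ) : (tensorMap ψ ψ).comp Q.Δ = P.Δ.comp ψ := by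
  have key : ∀ t : P.A ⊗[ℂ] P.A, tensorMap ψ ψ (tensorMap φ φ t) = t := by
    intro t
    induction t with
    | zero => simp
    | tmul a b =>
      rw [tensorMap_tmul, tensorMap_tmul]
      exact congrArg₂ _ (DFunLike.congr_fun h1 a) (DFunLike.congr_fun h1 b)
    | add x y hx hy => rw [map_add, map_add, hx, hy]
  ext a
  obtain ⟨b, rfl⟩ : ∃ b, a = φ b := ⟨ψ a, (DFunLike.congr_fun h2 a).symm⟩
  change tensorMap ψ ψ (Q.Δ (φ b)) = P.Δ (ψ (φ b))
  rw [show ψ (φ b) = b from DFunLike.congr_fun h1 b, ← key (P.Δ b)]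
  exact congrArg _ (DFunLike.congr_fun hΔ b).symm

theorem Isomorphic.symm {P Q : QPermGroup} (h : P.Isomorphic Q) : Q.Isomorphic P := by
  obtain ⟨φ, ψ, h1, h2, h3⟩ := h.exists_homs
  exact .of_homs ψ φ h2 h1 (tensorMap_comp_Δ h1 h2 h3)

theorem tensorMap_comp {A₁ A₂ A₃ B₁ B₂ B₃ : Type} [Ring A₁] [StarRing A₁] [Algebra ℂ A₁]
    [StarModule ℂ A₁] [Ring A₂] [StarRing A₂] [Algebra ℂ A₂] [StarModule ℂ A₂] [Ring A₃]
    [StarRing A₃] [Algebra ℂ A₃] [StarModule ℂ A₃] [Ring B₁] [StarRing B₁] [Algebra ℂ B₁]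
    [StarModule ℂ B₁] [Ring B₂] [StarRing B₂] [Algebra ℂ B₂] [StarModule ℂ B₂] [Ring B₃]
    [StarRing B₃] [Algebra ℂ B₃] [StarModule ℂ B₃] (f₂ : A₂ →⋆ₐ[ℂ] A₃) (g₂ : B₂ →⋆ₐ[ℂ] B₃)
    (f₁ : A₁ →⋆ₐ[ℂ] A₂) (g₁ : B₁ →⋆ₐ[ℂ] B₂) (t : A₁ ⊗[ℂ] B₁) :
    tensorMap f₂ g₂ (tensorMap f₁ g₁ t) = tensorMap (f₂.comp f₁) (g₂.comp g₁) t := by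
  induction t with
  | zero => simp
  | tmul a b => rfl
  | add x y hx hy => simp only [map_add, hx, hy]

theorem Isomorphic.trans {P Q R : QPermGroup} (h : P.Isomorphic Q) (h' : Q.Isomorphic R) :
    P.Isomorphic R := by
  obtain ⟨φ, ψ, h1, h2, h3⟩ := h.exists_homs
  obtain ⟨φ', ψ', h1', h2', h3'⟩ := h'.exists_homs
  refine .of_homs (φ'.comp φ) (ψ.comp ψ') ?_ ?_ ?_
  · ext a
    exact (congrArg ψ (DFunLike.congr_fun h1' (φ a))).trans (DFunLike.congr_fun h1 a)
  · ext a
    exact (congrArg φ' (DFunLike.congr_fun h2 (ψ' a))).trans (DFunLike.congr_fun h2' a)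
  · ext a
    change tensorMap (φ'.comp φ) (φ'.comp φ) (P.Δ a) = R.Δ (φ' (φ a))
    rw [← tensorMap_comp]
    exact (congrArg _ (DFunLike.congr_fun h3 a)).trans (DFunLike.congr_fun h3' (φ a))

end QPermGroup

/-- The quantum permutation group `P` is the quantum automorphism group of a coloured graph. -/
structure IsModel (P : QPermGroup) {V K : Type} [Fintype V] (G : SimpleGraph V) (d : V → K)
    (e : V ≃ P.I) : Prop where
  qIso : QIso (1 : P.A) (fun x y => P.u (e x) (e y)) G d G d
  lift : ∀ (B : Type) [Ring B] [StarRing B] [Algebra ℂ B] [StarModule ℂ B] (w : V → V → B),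
    (∀ x y, star (w x y) = w x y) → QIso 1 w G d G d →
      ∃ φ : P.A →⋆ₐ[ℂ] B, ∀ x y, φ (P.u (e x) (e y)) = w x y

/-- Two solutions of the same universal problem: the comparison maps identify the fundamental
representations, hence also the comultiplications. -/
theorem IsModel.isomorphic {P Q : QPermGroup} {V K : Type} [Fintype V] {G : SimpleGraph V}
    {d : V → K} {e : V ≃ P.I} {e' : V ≃ Q.I} (hP : IsModel P G d e) (hQ : IsModel Q G d e') :
    P.Isomorphic Q := by
  obtain ⟨φ, hφ⟩ := hP.lift Q.A _ (fun x y => Q.magic.selfAdj _ _) hQ.qIso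
  obtain ⟨ψ, hψ⟩ := hQ.lift P.A _ (fun x y => P.magic.selfAdj _ _) hP.qIso
  refine .of_homs φ ψ ?_ ?_ ?_
  · refine QPermGroup.hom_ext fun i j => ?_
    obtain ⟨x, rfl⟩ := e.surjective i
    obtain ⟨y, rfl⟩ := e.surjective j
    rw [StarAlgHom.comp_apply, hφ, hψ]; rfl
  · refine QPermGroup.hom_ext fun i j => ?_
    obtain ⟨x, rfl⟩ := e'.surjective i
    obtain ⟨y, rfl⟩ := e'.surjective j
    rw [StarAlgHom.comp_apply, hψ, hφ]; rfl
  · refine QPermGroup.hom_ext fun i j => ?_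
    obtain ⟨x, rfl⟩ := e.surjective i
    obtain ⟨y, rfl⟩ := e.surjective j
    rw [StarAlgHom.comp_apply, StarAlgHom.comp_apply, hφ, P.Δ_u, Q.Δ_u, map_sum, ← e.sum_comp,
      ← e'.sum_comp]
    simp only [tensorMap_tmul, hφ]

theorem QPermGroup.qMagic (P : QPermGroup) {V : Type} [Fintype V] (e : V ≃ P.I) :
    QMagic (1 : P.A) (fun x y => P.u (e x) (e y)) where
  idem _ _ := P.magic.idem _ _
  row_orth _ _ _ h := P.magic.row_orth _ _ _ fun e' => h (e.injective e').symm
  col_orth _ _ _ h := P.magic.col_orth _ _ _ fun e' => h (e.injective e').symm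
  row_sum x := (e.sum_comp (P.u (e x))).trans (P.magic.row_sum _)
  col_sum x := (e.sum_comp fun y => P.u y (e x)).trans (P.magic.col_sum _)

/-- Commutation with the adjacency matrix and the condition on nonzero products are exchanged by the
two `intertwine` lemmas. -/
theorem FinGraph.isModel_qu (G : FinGraph) :
    IsModel G.qu G.graph (fun _ => ()) (Equiv.refl G.V) where
  qIso :=
    { toQMagic := G.qu.qMagic (Equiv.refl G.V)
      adj := by
        classical
        refine G.quMatrix_magic.qMagic.intertwine _ _ fun x b => ?_
        have := congrFun (congrFun G.quMatrix_comm x) b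
        simp only [Matrix.mul_apply, adj] at this
        convert this
      color := fun _ _ _ => rfl }
  lift B _ _ _ _ w hs hw := by
    have hm : IsMagicUnitary (w : Matrix G.V G.V B) :=
      ⟨hw.idem, hs, fun i j k h => hw.row_orth i j k h.symm, fun i j k h => hw.col_orth i k j h.symm,
        hw.col_sum, hw.row_sum⟩
    have hc : Matrix.of w * G.adj B = G.adj B * Matrix.of w := by
      ext x b
      have := hw.adj.intertwine hw.toQMagic x b
      simp only [Matrix.mul_apply, adj, Matrix.of_apply]
      convert this
    exact ⟨UnivStarAlg.lift (fun p => w p.1 p.2) fun a b h => h.eval_eq hm hc, fun x y => rfl⟩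

theorem isModel_trivial {V K : Type} [Fintype V] [Nonempty V] [hV : Subsingleton V]
    (G : SimpleGraph V) (d : V → K) :
    ∃ e : V ≃ QPermGroup.trivial.I, IsModel QPermGroup.trivial G d e := by
  have : Unique V := ⟨⟨Classical.arbitrary V⟩, fun _ => Subsingleton.elim _ _⟩
  refine ⟨Equiv.ofUnique V Unit, ⟨QPermGroup.trivial.qMagic _, ?_, ?_⟩, ?_⟩
  · intro x y a b _
    rw [Subsingleton.elim x a, Subsingleton.elim y b]
  · intro x a _
    rw [Subsingleton.elim x a]
  · intro B _ _ _ _ w hs hw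
    let φ : ℂ →⋆ₐ[ℂ] B := { Algebra.ofId ℂ B with map_star' := fun c => algebraMap_star_comm c }
    refine ⟨φ, fun x y => ?_⟩
    have h := hw.row_sum x
    rw [Fintype.sum_subsingleton _ y] at h
    rw [h]
    exact map_one (algebraMap ℂ B)

/-! ### Free products as quantum automorphism groups of sums -/

namespace QPermGroup

/-- The first factor of a free product. -/
def inlHom (P Q : QPermGroup) : P.A →⋆ₐ[ℂ] (P.freeProd Q).A := freeProdInl P Q

/-- The second factor of a free product. -/
def inrHom (P Q : QPermGroup) : Q.A →⋆ₐ[ℂ] (P.freeProd Q).A := freeProdInr P Q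

/-- The star-homomorphism on a free product defined by star-homomorphisms on the factors. -/
def freeProdLift {P Q : QPermGroup} {B : Type*} [Ring B] [StarRing B] [Algebra ℂ B]
    [StarModule ℂ B] (φ : P.A →⋆ₐ[ℂ] B) (ψ : Q.A →⋆ₐ[ℂ] B) : (P.freeProd Q).A →⋆ₐ[ℂ] B :=
  UnivStarAlg.lift (Sum.elim φ ψ) (by
    rintro a b (h | h)
    · exact StarHomRel.eval_eq (e := Sum.inl) φ (fun _ => rfl) h
    · exact StarHomRel.eval_eq (e := Sum.inr) ψ (fun _ => rfl) h)

theorem freeProdLift_inl {P Q : QPermGroup} {B : Type*} [Ring B] [StarRing B] [Algebra ℂ B]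
    [StarModule ℂ B] (φ : P.A →⋆ₐ[ℂ] B) (ψ : Q.A →⋆ₐ[ℂ] B) (a : P.A) :
    freeProdLift φ ψ (inlHom P Q a) = φ a := rfl

theorem freeProdLift_inr {P Q : QPermGroup} {B : Type*} [Ring B] [StarRing B] [Algebra ℂ B]
    [StarModule ℂ B] (φ : P.A →⋆ₐ[ℂ] B) (ψ : Q.A →⋆ₐ[ℂ] B) (a : Q.A) :
    freeProdLift φ ψ (inrHom P Q a) = ψ a := rfl

theorem freeProd_hom_ext {P Q : QPermGroup} {B : Type*} [Ring B] [StarRing B] [Algebra ℂ B]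
    [StarModule ℂ B] {φ ψ : (P.freeProd Q).A →⋆ₐ[ℂ] B}
    (h1 : ∀ a, φ (inlHom P Q a) = ψ (inlHom P Q a))
    (h2 : ∀ a, φ (inrHom P Q a) = ψ (inrHom P Q a)) : φ = ψ :=
  UnivStarAlg.hom_ext (by rintro (a | a); exacts [h1 a, h2 a])

/-- The indexing of the fundamental representation of a free product. -/
def freeProdIndex (P Q : QPermGroup) {V V₁ V₂ : Type} (e : V₁ ⊕ V₂ ≃ V) (e₁ : V₁ ≃ P.I)
    (e₂ : V₂ ≃ Q.I) : V ≃ (P.freeProd Q).I :=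
  e.symm.trans (Equiv.sumCongr e₁ e₂)

section

variable {P Q : QPermGroup} {V V₁ V₂ : Type} {e : V₁ ⊕ V₂ ≃ V} {e₁ : V₁ ≃ P.I} {e₂ : V₂ ≃ Q.I}

theorem freeProdIndex_apply (x : V₁ ⊕ V₂) :
    freeProdIndex P Q e e₁ e₂ (e x) = Sum.map e₁ e₂ x :=
  congrArg (Sum.map e₁ e₂) (e.symm_apply_apply x)

theorem freeProd_entry_inl (x y : V₁) : (P.freeProd Q).u (freeProdIndex P Q e e₁ e₂ (e (.inl x)))
    (freeProdIndex P Q e e₁ e₂ (e (.inl y))) = inlHom P Q (P.u (e₁ x) (e₁ y)) :=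
  congrArg₂ (P.freeProd Q).u (freeProdIndex_apply _) (freeProdIndex_apply _)

theorem freeProd_entry_inr (x y : V₂) : (P.freeProd Q).u (freeProdIndex P Q e e₁ e₂ (e (.inr x)))
    (freeProdIndex P Q e e₁ e₂ (e (.inr y))) = inrHom P Q (Q.u (e₂ x) (e₂ y)) :=
  congrArg₂ (P.freeProd Q).u (freeProdIndex_apply _) (freeProdIndex_apply _)

theorem freeProd_entry_inl_inr (x : V₁) (y : V₂) : (P.freeProd Q).u
    (freeProdIndex P Q e e₁ e₂ (e (.inl x))) (freeProdIndex P Q e e₁ e₂ (e (.inr y))) = 0 :=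
  congrArg₂ (P.freeProd Q).u (freeProdIndex_apply _) (freeProdIndex_apply _)

theorem freeProd_entry_inr_inl (x : V₂) (y : V₁) : (P.freeProd Q).u
    (freeProdIndex P Q e e₁ e₂ (e (.inr x))) (freeProdIndex P Q e e₁ e₂ (e (.inl y))) = 0 :=
  congrArg₂ (P.freeProd Q).u (freeProdIndex_apply _) (freeProdIndex_apply _)

end

theorem freeProd_Δ_inl (P Q : QPermGroup) (a : P.A) :
    (P.freeProd Q).Δ (inlHom P Q a)
      = tensorMap (inlHom P Q) (inlHom P Q) (P.Δ a) := rfl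

theorem freeProd_Δ_inr (P Q : QPermGroup) (a : Q.A) :
    (P.freeProd Q).Δ (inrHom P Q a)
      = tensorMap (inrHom P Q) (inrHom P Q) (Q.Δ a) := rfl

end QPermGroup

open QPermGroup

/-- Quantum automorphisms are block diagonal, so they amount to a pair of quantum automorphisms of
the parts. No relation links the two blocks, since adjacency across depends only on colours, which
each block preserves by itself; this is the universal property of the coproduct. -/
theorem SumDecomp.isModel {V V₁ V₂ K K₁ K₂ : Type} [Fintype V] [Fintype V₁] [Fintype V₂]
    {G : SimpleGraph V} {d : V → K} {G₁ : SimpleGraph V₁} {d₁ : V₁ → K₁} {G₂ : SimpleGraph V₂}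
    {d₂ : V₂ → K₂} {e : V₁ ⊕ V₂ ≃ V} (h : SumDecomp G d G₁ d₁ G₂ d₂ e) {P Q : QPermGroup}
    {e₁ : V₁ ≃ P.I} {e₂ : V₂ ≃ Q.I} (hP : IsModel P G₁ d₁ e₁) (hQ : IsModel Q G₂ d₂ e₂) :
    IsModel (P.freeProd Q) G d (freeProdIndex P Q e e₁ e₂) where
  qIso :=
    { toQMagic := QPermGroup.qMagic _ _
      adj := by
        intro x y a b hne
        obtain ⟨x, rfl⟩ := e.surjective x
        obtain ⟨y, rfl⟩ := e.surjective y
        obtain ⟨a, rfl⟩ := e.surjective a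
        obtain ⟨b, rfl⟩ := e.surjective b
        have hx := left_ne_zero_of_mul hne
        have hy := right_ne_zero_of_mul hne
        rcases x with x | x <;> rcases a with a | a <;>
          simp only [freeProd_entry_inl, freeProd_entry_inr, freeProd_entry_inl_inr,
            freeProd_entry_inr_inl, ne_eq, not_true_eq_false] at hne hx
        · have hx' := hP.qIso.color x a fun e' => hx (by rw [e', map_zero])
          rcases y with y | y <;> rcases b with b | b <;>
            simp only [freeProd_entry_inl, freeProd_entry_inr, freeProd_entry_inl_inr,
              freeProd_entry_inr_inl, ne_eq, not_true_eq_false] at hne hy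
          · rw [h.adj_inl, h.adj_inl]
            exact hP.qIso.adj x y a b fun e' => hne (by rw [← map_mul, e', map_zero])
          · exact h.cross _ _ _ _ hx' (hQ.qIso.color y b fun e' => hy (by rw [e', map_zero]))
        · have hx' := hQ.qIso.color x a fun e' => hx (by rw [e', map_zero])
          rcases y with y | y <;> rcases b with b | b <;>
            simp only [freeProd_entry_inl, freeProd_entry_inr, freeProd_entry_inl_inr,
              freeProd_entry_inr_inl, ne_eq, not_true_eq_false] at hne hy
          · rw [G.adj_comm, G.adj_comm (e (.inr a))]
            exact h.cross _ _ _ _ (hP.qIso.color y b fun e' => hy (by rw [e', map_zero])) hx'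
          · rw [h.adj_inr, h.adj_inr]
            exact hQ.qIso.adj x y a b fun e' => hne (by rw [← map_mul, e', map_zero])
      color := by
        intro x a hx
        obtain ⟨x, rfl⟩ := e.surjective x
        obtain ⟨a, rfl⟩ := e.surjective a
        rcases x with x | x <;> rcases a with a | a <;>
          simp only [freeProd_entry_inl, freeProd_entry_inr, freeProd_entry_inl_inr,
            freeProd_entry_inr_inl, ne_eq, not_true_eq_false] at hx
        · exact h.color_inl _ _ (hP.qIso.color x a fun e' => hx (by rw [e', map_zero]))
        · exact h.color_inr _ _ (hQ.qIso.color x a fun e' => hx (by rw [e', map_zero])) }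
  lift B _ _ _ _ w hs hw := by
    obtain ⟨φ, hφ⟩ := hP.lift B _ (fun x y => hs _ _) (h.qIso_inl hw)
    obtain ⟨ψ, hψ⟩ := hQ.lift B _ (fun x y => hs _ _) (h.qIso_inr hw)
    refine ⟨freeProdLift φ ψ, fun x y => ?_⟩
    obtain ⟨x, rfl⟩ := e.surjective x
    obtain ⟨y, rfl⟩ := e.surjective y
    rcases x with x | x <;> rcases y with y | y
    · rw [freeProd_entry_inl, freeProdLift_inl, hφ]
    · rw [freeProd_entry_inl_inr, map_zero, (h.zero hw x y).1]
    · rw [freeProd_entry_inr_inl, map_zero, (h.zero hw y x).2]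
    · rw [freeProd_entry_inr, freeProdLift_inr, hψ]

/-! ### Free wreath products as quantum automorphism groups of copies -/

namespace QPermGroup

/-- The `i`-th copy in a free wreath product. -/
def copyHom (P : QPermGroup) (n : ℕ) [NeZero n] (i : Fin n) : P.A →⋆ₐ[ℂ] (P.freeWreath n).A :=
  wreathCopy P n i

/-- The copy of the algebra of `S_n⁺` in a free wreath product. -/
def permHom (P : QPermGroup) (n : ℕ) [NeZero n] : (symPlus n).A →⋆ₐ[ℂ] (P.freeWreath n).A :=
  wreathPerm P n

/-- The image in a free wreath product of the fundamental representation of `S_n⁺`. -/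
def permEntry (P : QPermGroup) (n : ℕ) [NeZero n] (i j : Fin n) : (P.freeWreath n).A :=
  wreathS P n i j

theorem permEntry_magic (P : QPermGroup) (n : ℕ) [NeZero n] : QMagic 1 (permEntry P n) :=
  (wreathS_magic (P := P) (n := n)).qMagic

theorem copyHom_comm {P : QPermGroup} {n : ℕ} [NeZero n] (i j : Fin n) (a : P.A) :
    copyHom P n i a * permEntry P n i j = permEntry P n i j * copyHom P n i a :=
  wreath_comm i j a

/-- The star-homomorphism on a free wreath product defined by star-homomorphisms on the copies
and on the algebra of `S_n⁺`. -/
def freeWreathLift {P : QPermGroup} {n : ℕ} [NeZero n] {B : Type*} [Ring B] [StarRing B]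
    [Algebra ℂ B] [StarModule ℂ B] (φ : Fin n → P.A →⋆ₐ[ℂ] B) (ψ : (symPlus n).A →⋆ₐ[ℂ] B)
    (h : ∀ i j a, φ i a * ψ ((symPlus n).u i j) = ψ ((symPlus n).u i j) * φ i a) :
    (P.freeWreath n).A →⋆ₐ[ℂ] B :=
  UnivStarAlg.lift (Sum.elim (fun p => φ p.1 p.2) ψ) (by
    rintro a b (⟨i, h⟩ | h | ⟨i, j, a⟩)
    · exact StarHomRel.eval_eq (e := fun a => Sum.inl (i, a)) (φ i) (fun _ => rfl) h
    · exact StarHomRel.eval_eq (e := Sum.inr) ψ (fun _ => rfl) h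
    · exact h i j a)

theorem freeWreath_hom_ext {P : QPermGroup} {n : ℕ} [NeZero n] {B : Type*} [Ring B] [StarRing B]
    [Algebra ℂ B] [StarModule ℂ B] {φ ψ : (P.freeWreath n).A →⋆ₐ[ℂ] B}
    (h1 : ∀ i a, φ (copyHom P n i a) = ψ (copyHom P n i a))
    (h2 : ∀ a, φ (permHom P n a) = ψ (permHom P n a)) : φ = ψ :=
  UnivStarAlg.hom_ext (by rintro (a | a); exacts [h1 a.1 a.2, h2 a])

theorem freeWreathLift_copy {P : QPermGroup} {n : ℕ} [NeZero n] {B : Type*} [Ring B] [StarRing B]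
    [Algebra ℂ B] [StarModule ℂ B] (φ : Fin n → P.A →⋆ₐ[ℂ] B) (ψ : (symPlus n).A →⋆ₐ[ℂ] B)
    (h : ∀ i j a, φ i a * ψ ((symPlus n).u i j) = ψ ((symPlus n).u i j) * φ i a) (i : Fin n)
    (a : P.A) : freeWreathLift φ ψ h (copyHom P n i a) = φ i a := rfl

theorem freeWreathLift_permEntry {P : QPermGroup} {n : ℕ} [NeZero n] {B : Type*} [Ring B]
    [StarRing B] [Algebra ℂ B] [StarModule ℂ B] (φ : Fin n → P.A →⋆ₐ[ℂ] B)
    (ψ : (symPlus n).A →⋆ₐ[ℂ] B)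
    (h : ∀ i j a, φ i a * ψ ((symPlus n).u i j) = ψ ((symPlus n).u i j) * φ i a) (i j : Fin n) :
    freeWreathLift φ ψ h (permEntry P n i j) = ψ ((symPlus n).u i j) := rfl

/-- The indexing of the fundamental representation of a free wreath product. -/
def freeWreathIndex (P : QPermGroup) {n : ℕ} [NeZero n] {V C : Type} (e : Fin n × C ≃ V)
    (e' : C ≃ P.I) : V ≃ (P.freeWreath n).I :=
  e.symm.trans (Equiv.prodCongr (Equiv.refl _) e')

theorem freeWreath_entry {P : QPermGroup} {n : ℕ} [NeZero n] {V C : Type} {e : Fin n × C ≃ V}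
    {e' : C ≃ P.I} (i j : Fin n) (x y : C) :
    (P.freeWreath n).u (freeWreathIndex P e e' (e (i, x))) (freeWreathIndex P e e' (e (j, y)))
      = permEntry P n i j * copyHom P n i (P.u (e' x) (e' y)) :=
  congrArg₂ (P.freeWreath n).u (congrArg (Prod.map id e') (e.symm_apply_apply (i, x)))
    (congrArg (Prod.map id e') (e.symm_apply_apply (j, y)))

theorem freeWreath_Δ_copy (P : QPermGroup) (n : ℕ) [NeZero n] (i : Fin n) (a : P.A) :
    (P.freeWreath n).Δ (copyHom P n i a)
      = ∑ k, tensorMap (copyHom P n i) (copyHom P n k) (P.Δ a) * (permEntry P n i k ⊗ₜ 1) :=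
  rfl

theorem freeWreath_Δ_perm (P : QPermGroup) (n : ℕ) [NeZero n] (a : (symPlus n).A) :
    (P.freeWreath n).Δ (permHom P n a)
      = tensorMap (permHom P n) (permHom P n) ((symPlus n).Δ a) :=
  rfl

/-- A self-adjoint element that commutes with the image of the fundamental representation
commutes with the image of the algebra. -/
theorem commute_of_commute_u {P : QPermGroup} {B : Type*} [Ring B] [StarRing B] [Algebra ℂ B]
    [StarModule ℂ B] (φ : P.A →⋆ₐ[ℂ] B) (s : B) (hs : star s = s)
    (h : ∀ i j, φ (P.u i j) * s = s * φ (P.u i j)) (a : P.A) : φ a * s = s * φ a := by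
  have ha : a ∈ StarAlgebra.adjoin ℂ (Set.range fun p : P.I × P.I => P.u p.1 p.2) := by
    rw [P.adjoin_u]; exact StarSubalgebra.mem_top
  induction ha using StarAlgebra.adjoin_induction with
  | mem x hx => obtain ⟨p, rfl⟩ := hx; exact h p.1 p.2
  | algebraMap r => simp only [AlgHomClass.commutes, Algebra.commutes]
  | add x y _ _ hx hy => simp only [map_add, add_mul, mul_add, hx, hy]
  | mul x y _ _ hx hy => rw [map_mul, mul_assoc, hy, ← mul_assoc, hx, mul_assoc]
  | star x _ hx =>
    have := congrArg star hx
    rw [star_mul, star_mul, hs] at this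
    rw [map_star, this]

theorem exists_symPlus_hom {n : ℕ} [NeZero n] {B : Type} [Ring B] [StarRing B] [Algebra ℂ B]
    [StarModule ℂ B] (p : Fin n → Fin n → B) (hs : ∀ i j, star (p i j) = p i j)
    (hp : QMagic 1 p) : ∃ φ : (symPlus n).A →⋆ₐ[ℂ] B, ∀ i j : Fin n,
      φ ((symPlus n).u i j) = p i j := by
  refine (FinGraph.isModel_qu ⟨Fin n, ⊥⟩).lift B p hs ⟨hp, ?_, fun _ _ _ => rfl⟩
  exact fun x y a b _ => Iff.rfl

end QPermGroup

/-- A quantum automorphism factors as a quantum permutation of the copies times a quantum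
automorphism attached to each source copy. Conversely such products preserve adjacency: inside a
copy by the second factor, across copies because only colours matter. -/
theorem WreathDecomp.isModel {V C K K' : Type} [Fintype V] [Fintype C] [Nonempty C]
    {G : SimpleGraph V} {d : V → K} {G' : SimpleGraph C} {d' : C → K'} {n : ℕ} [NeZero n]
    {e : Fin n × C ≃ V} (h : WreathDecomp G d G' d' n e) {P : QPermGroup}
    {e' : C ≃ P.I} (hP : IsModel P G' d' e') :
    IsModel (P.freeWreath n) G d (freeWreathIndex P e e') where
  qIso :=
    { toQMagic := QPermGroup.qMagic _ _
      adj := by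
        intro x y a b hne
        obtain ⟨⟨i, x⟩, rfl⟩ := e.surjective x
        obtain ⟨⟨k, y⟩, rfl⟩ := e.surjective y
        obtain ⟨⟨j, a⟩, rfl⟩ := e.surjective a
        obtain ⟨⟨l, b⟩, rfl⟩ := e.surjective b
        simp only [freeWreath_entry] at hne
        have hx := left_ne_zero_of_mul hne
        have hy := right_ne_zero_of_mul hne
        have hx' := hP.qIso.color x a fun e' => hx (by rw [e', map_zero, mul_zero])
        have hy' := hP.qIso.color y b fun e' => hy (by rw [e', map_zero, mul_zero])
        by_cases hik : i = k
        · subst hik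
          have key : (permEntry P n i j * copyHom P n i (P.u (e' x) (e' a))) *
              (permEntry P n i l * copyHom P n i (P.u (e' y) (e' b)))
              = (permEntry P n i j * permEntry P n i l) *
                copyHom P n i (P.u (e' x) (e' a) * P.u (e' y) (e' b)) := by
            rw [mul_assoc, ← mul_assoc (copyHom P n i _), copyHom_comm, map_mul]
            simp only [mul_assoc]
          rw [key] at hne
          have hjl : j = l := by
            by_contra hjl
            rw [(permEntry_magic P n).row_orth i j l hjl, zero_mul] at hne
            exact hne rfl
          subst hjl
          rw [h.adj, h.adj]
          exact hP.qIso.adj x y a b fun e' => hne (by rw [e', map_zero, mul_zero])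
        · have hjl : j ≠ l := by
            rintro rfl
            rw [← copyHom_comm, mul_assoc, ← mul_assoc (permEntry P n i j),
              (permEntry_magic P n).col_orth i k j hik, zero_mul, mul_zero] at hne
            exact hne rfl
          exact h.cross _ _ _ _ _ _ _ _ hik hjl hx' hy'
      color := by
        intro x a hx
        obtain ⟨⟨i, x⟩, rfl⟩ := e.surjective x
        obtain ⟨⟨j, a⟩, rfl⟩ := e.surjective a
        simp only [freeWreath_entry] at hx
        exact h.color _ _ _ _ (hP.qIso.color x a fun e' => hx (by rw [e', map_zero, mul_zero])) }
  lift B _ _ _ _ w hs hw := by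
    have hsP : ∀ i j, star (copyPerm w e i j) = copyPerm w e i j := by
      obtain ⟨c⟩ := ‹Nonempty C›
      intro i j
      rw [← h.copyPerm_row hw i j c, star_sum]
      simp only [hs]
    have hsA : ∀ i x y, star (copyAut w e i x y) = copyAut w e i x y := by
      intro i x y
      rw [copyAut, star_sum]
      simp only [hs]
    obtain ⟨ψ, hψ⟩ := exists_symPlus_hom _ hsP (h.copyPerm_magic hw)
    choose φ hφ using fun i => hP.lift B _ (hsA i) (h.qIso_copyAut hw i)
    refine ⟨freeWreathLift φ ψ fun i j => ?_, fun x y => ?_⟩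
    · refine commute_of_commute_u (φ i) _ ((map_star ψ _).symm.trans (congrArg ψ ?_)) fun k l => ?_
      · exact (symPlus n).magic.selfAdj i j
      · obtain ⟨x, rfl⟩ := e'.surjective k
        obtain ⟨y, rfl⟩ := e'.surjective l
        have hij : ψ ((symPlus n).u i j) = copyPerm w e i j := hψ i j
        rw [hφ, hij]
        exact (h.copyAut_mul_copyPerm hw i j x y).trans (h.copyPerm_mul_copyAut hw i j x y).symm
    · obtain ⟨⟨i, x⟩, rfl⟩ := e.surjective x
      obtain ⟨⟨j, y⟩, rfl⟩ := e.surjective y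
      simp only [freeWreath_entry]
      rw [map_mul, freeWreathLift_copy, freeWreathLift_permEntry, hφ,
        ← h.copyPerm_mul_copyAut hw, ← hψ]

theorem SimpleGraph.IsGood.exists_model {V K : Type} [Fintype V] [Nonempty V] {G : SimpleGraph V}
    (hG : G.IsGood) (d : V → K) :
    ∃ (P : QPermGroup) (e : V ≃ P.I), JorPlus {QPermGroup.trivial} P ∧ IsModel P G d e := by
  refine SimpleGraph.IsGood.induction (P := fun {V K} _ _ (G : SimpleGraph V) (d : V → K) =>
    ∃ (P : QPermGroup) (e : V ≃ P.I), JorPlus {QPermGroup.trivial} P ∧ IsModel P G d e)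
    ?_ ?_ ?_ d hG
  · intro V K _ _ G d hV
    obtain ⟨e, he⟩ := isModel_trivial G d
    exact ⟨_, e, .of rfl, he⟩
  · rintro V V₁ V₂ K K₁ K₂ _ _ _ _ _ _ G d G₁ d₁ G₂ d₂ e h ⟨P, e₁, hP, h₁⟩ ⟨Q, e₂, hQ, h₂⟩
    exact ⟨_, _, .freeProd hP hQ, h.isModel h₁ h₂⟩
  · rintro V C K K' _ _ _ _ G d G' d' n e hn h ⟨P, e', hP, h'⟩
    have : NeZero n := ⟨by omega⟩
    exact ⟨_, _, .freeWreath n hP, h.isModel h'⟩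

theorem FinGraph.jorPlus_qu {G : FinGraph} (hG : G.graph.IsGood) :
    JorPlus {QPermGroup.trivial} G.qu := by
  obtain ⟨P, e, hP, h⟩ := hG.exists_model (fun _ => ())
  exact .iso (h.isomorphic G.isModel_qu) hP

/-! ### Automorphism groups of coloured graphs -/

/-- The group of automorphisms of a coloured graph. -/
def autC {V K : Type} (G : SimpleGraph V) (d : V → K) : Subgroup (Equiv.Perm V) where
  carrier := {f | (∀ a b, G.Adj (f a) (f b) ↔ G.Adj a b) ∧ ∀ a, d (f a) = d a}
  mul_mem' {f g} hf hg := ⟨fun a b => (hf.1 _ _).trans (hg.1 a b), fun a => (hf.2 _).trans (hg.2 a)⟩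
  one_mem' := ⟨fun _ _ => Iff.rfl, fun _ => rfl⟩
  inv_mem' {f} hf := ⟨fun a b => by rw [← hf.1]; simp, fun a => by rw [← hf.2]; simp⟩

theorem mem_autC {V K : Type} {G : SimpleGraph V} {d : V → K} {f : Equiv.Perm V} :
    f ∈ autC G d ↔ (∀ a b, G.Adj (f a) (f b) ↔ G.Adj a b) ∧ ∀ a, d (f a) = d a := Iff.rfl

open scoped Classical in
/-- The permutation matrix of an automorphism is a quantum automorphism. -/
theorem qIso_of_mem_autC {V K : Type} [Fintype V] {G : SimpleGraph V} {d : V → K}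
    {f : Equiv.Perm V} (hf : f ∈ autC G d) :
    QIso (1 : ℂ) (fun x a => if x = f a then 1 else 0) G d G d where
  idem x a := by simp
  row_orth x a b hab := by
    by_cases h : x = f a
    · subst h
      simp [hab]
    · simp [h]
  col_orth x y a hxy := by
    by_cases h : x = f a
    · subst h
      simp [hxy.symm]
    · simp [h]
  row_sum x := by
    rw [Finset.sum_eq_single (f.symm x)] <;> simp
    intro b hb h
    exact hb (by simp [h])
  col_sum a := by simp
  adj x y a b h := by
    obtain ⟨rfl, rfl⟩ : y = f b ∧ x = f a := by simpa using h
    exact hf.1 a b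
  color x a h := by
    obtain rfl : x = f a := by simpa using h
    exact hf.2 a

section sum

variable {V V₁ V₂ K K₁ K₂ : Type} [Fintype V] {G : SimpleGraph V} {d : V → K}
  {G₁ : SimpleGraph V₁} {d₁ : V₁ → K₁} {G₂ : SimpleGraph V₂} {d₂ : V₂ → K₂} {e : V₁ ⊕ V₂ ≃ V}

theorem SumDecomp.mem_autC (h : SumDecomp G d G₁ d₁ G₂ d₂ e) {f : Equiv.Perm V₁}
    {g : Equiv.Perm V₂} (hf : f ∈ autC G₁ d₁) (hg : g ∈ autC G₂ d₂) :
    e.permCongr (Equiv.sumCongr f g) ∈ autC G d := by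
  refine ⟨fun x y => ?_, fun x => ?_⟩
  · obtain ⟨x, rfl⟩ := e.surjective x
    obtain ⟨y, rfl⟩ := e.surjective y
    simp only [Equiv.permCongr_apply, Equiv.symm_apply_apply]
    rcases x with x | x <;> rcases y with y | y <;>
      simp only [Equiv.sumCongr_apply, Sum.map_inl, Sum.map_inr]
    · rw [h.adj_inl, h.adj_inl, hf.1]
    · exact h.cross _ _ _ _ (hf.2 x) (hg.2 y)
    · rw [G.adj_comm, G.adj_comm (e (.inr x))]
      exact h.cross _ _ _ _ (hf.2 y) (hg.2 x)
    · rw [h.adj_inr, h.adj_inr, hg.1]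
  · obtain ⟨x, rfl⟩ := e.surjective x
    simp only [Equiv.permCongr_apply, Equiv.symm_apply_apply]
    rcases x with x | x <;> simp only [Equiv.sumCongr_apply, Sum.map_inl, Sum.map_inr]
    · exact h.color_inl _ _ (hf.2 x)
    · exact h.color_inr _ _ (hg.2 x)

/-- The automorphisms of a decomposed graph defined by automorphisms of the parts. -/
def SumDecomp.autHom (h : SumDecomp G d G₁ d₁ G₂ d₂ e) : autC G₁ d₁ × autC G₂ d₂ →* autC G d where
  toFun p := ⟨e.permCongr (Equiv.sumCongr p.1.1 p.2.1), h.mem_autC p.1.2 p.2.2⟩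
  map_one' := by
    ext x
    obtain ⟨x | x, rfl⟩ := e.surjective x <;> simp
  map_mul' p q := by
    ext x
    obtain ⟨x | x, rfl⟩ := e.surjective x <;> simp

theorem SumDecomp.autHom_inl (h : SumDecomp G d G₁ d₁ G₂ d₂ e) (p : autC G₁ d₁ × autC G₂ d₂)
    (x : V₁) : (h.autHom p).1 (e (.inl x)) = e (.inl (p.1.1 x)) := by
  simp [autHom]

theorem SumDecomp.autHom_inr (h : SumDecomp G d G₁ d₁ G₂ d₂ e) (p : autC G₁ d₁ × autC G₂ d₂)
    (x : V₂) : (h.autHom p).1 (e (.inr x)) = e (.inr (p.2.1 x)) := by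
  simp [autHom]

theorem SumDecomp.autHom_injective (h : SumDecomp G d G₁ d₁ G₂ d₂ e) :
    Function.Injective h.autHom := by
  rintro ⟨f, g⟩ ⟨f', g'⟩ H
  refine Prod.ext (Subtype.ext (Equiv.ext fun x => ?_)) (Subtype.ext (Equiv.ext fun x => ?_))
  · have := congrArg (fun k => k.1 (e (.inl x))) H
    simpa [h.autHom_inl] using this
  · have := congrArg (fun k => k.1 (e (.inr x))) H
    simpa [h.autHom_inr] using this

theorem SumDecomp.autHom_surjective [Finite V₁] [Finite V₂] (h : SumDecomp G d G₁ d₁ G₂ d₂ e) :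
    Function.Surjective h.autHom := by
  classical
  rintro ⟨k, hk⟩
  -- Viewed as a complex magic matrix, a classical automorphism inherits the invariance of the
  -- partition.
  have hq := qIso_of_mem_autC hk
  have hmaps : Set.MapsTo (e.permCongr.symm k) (Set.range Sum.inl) (Set.range Sum.inl) := by
    rintro _ ⟨a, rfl⟩
    rcases hb : e.permCongr.symm k (.inl a) with b | b
    · exact ⟨b, rfl⟩
    · exfalso
      have hb' : e (.inr b) = k (e (.inl a)) := by rw [← hb]; simp
      have := (h.zero hq a b).2
      simp [hb'] at this
  obtain ⟨⟨f, g⟩, hfg⟩ := Equiv.Perm.mem_sumCongrHom_range_of_perm_mapsTo_inl hmaps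
  have hk' : k = e.permCongr (Equiv.sumCongr f g) := by
    rw [← Equiv.symm_apply_eq]; exact hfg.symm
  have hf' : ∀ a, k (e (.inl a)) = e (.inl (f a)) := fun a => by rw [hk']; simp
  have hg' : ∀ a, k (e (.inr a)) = e (.inr (g a)) := fun a => by rw [hk']; simp
  have hf : f ∈ autC G₁ d₁ := by
    refine ⟨fun a b => ?_, fun a => h.inv_inl hq _ _ (by simp [hf'])⟩
    rw [← h.adj_inl, ← hf', ← hf', hk.1, h.adj_inl]
  have hg : g ∈ autC G₂ d₂ := by
    refine ⟨fun a b => ?_, fun a => h.inv_inr hq _ _ (by simp [hg'])⟩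
    rw [← h.adj_inr, ← hg', ← hg', hk.1, h.adj_inr]
  exact ⟨⟨⟨f, hf⟩, ⟨g, hg⟩⟩, Subtype.ext hk'.symm⟩

/-- The automorphism group of a decomposed graph. -/
def SumDecomp.autEquiv [Finite V₁] [Finite V₂] (h : SumDecomp G d G₁ d₁ G₂ d₂ e) :
    autC G₁ d₁ × autC G₂ d₂ ≃* autC G d :=
  MulEquiv.ofBijective h.autHom ⟨h.autHom_injective, h.autHom_surjective⟩

end sum

section wreath

variable {V C K K' : Type} [Fintype V] {G : SimpleGraph V} {d : V → K} {G' : SimpleGraph C}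
  {d' : C → K'} {n : ℕ} {e : Fin n × C ≃ V}

/-- The automorphisms are indexed by the target copy `σ i`; this matches the action `mulAutArrow`
and makes the map from the wreath product multiplicative. -/
theorem WreathDecomp.mem_autC (h : WreathDecomp G d G' d' n e) (σ : Equiv.Perm (Fin n))
    {f : Fin n → Equiv.Perm C} (hf : ∀ i, f i ∈ autC G' d') :
    e.permCongr (Equiv.prodShear σ fun i => f (σ i)) ∈ autC G d := by
  refine ⟨fun x y => ?_, fun x => ?_⟩
  · obtain ⟨⟨i, x⟩, rfl⟩ := e.surjective x
    obtain ⟨⟨j, y⟩, rfl⟩ := e.surjective y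
    simp only [Equiv.permCongr_apply, Equiv.symm_apply_apply, Equiv.prodShear_apply]
    by_cases hij : i = j
    · subst hij
      rw [h.adj, h.adj, (hf _).1]
    · exact h.cross _ _ _ _ _ _ _ _ (fun e => hij (σ.injective e)) hij ((hf _).2 x) ((hf _).2 y)
  · obtain ⟨⟨i, x⟩, rfl⟩ := e.surjective x
    simp only [Equiv.permCongr_apply, Equiv.symm_apply_apply, Equiv.prodShear_apply]
    exact h.color _ _ _ _ ((hf _).2 x)

/-- The automorphisms of a graph made of copies defined by a permutation of the copies and
automorphisms of the copies. -/
def WreathDecomp.autHom (h : WreathDecomp G d G' d' n e) : WreathSym (autC G' d') n →* autC G d where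
  toFun p := ⟨e.permCongr (Equiv.prodShear p.right fun i => (p.left (p.right i)).1),
    h.mem_autC p.right fun i => (p.left i).2⟩
  map_one' := by
    ext x
    obtain ⟨x, rfl⟩ := e.surjective x
    simp
  map_mul' p q := by
    ext x
    obtain ⟨x, rfl⟩ := e.surjective x
    have h : (mulAutArrow p.right q.left : Fin n → autC G' d') (p.right (q.right x.1))
        = q.left (q.right x.1) :=
      congrArg q.left (p.right.symm_apply_apply (q.right x.1))
    simp only [SemidirectProduct.mul_left, SemidirectProduct.mul_right, Equiv.permCongr_apply,
      Equiv.symm_apply_apply, Equiv.prodShear_apply, Subgroup.coe_mul, Equiv.Perm.mul_apply,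
      Pi.mul_apply, h]

theorem WreathDecomp.autHom_apply (h : WreathDecomp G d G' d' n e) (p : WreathSym (autC G' d') n)
    (i : Fin n) (x : C) :
    (h.autHom p).1 (e (i, x)) = e (p.right i, (p.left (p.right i)).1 x) := by
  simp [autHom]

theorem WreathDecomp.autHom_injective [Nonempty C] (h : WreathDecomp G d G' d' n e) :
    Function.Injective h.autHom := by
  intro p q H
  obtain ⟨c⟩ := ‹Nonempty C›
  have key : ∀ i x, (p.right i, (p.left (p.right i)).1 x) = (q.right i, (q.left (q.right i)).1 x) := by
    intro i x
    have := congrArg (fun k => k.1 (e (i, x))) H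
    simp only [h.autHom_apply] at this
    exact e.injective this
  have hr : p.right = q.right := Equiv.ext fun i => (Prod.ext_iff.1 (key i c)).1
  refine SemidirectProduct.ext (funext fun i => Subtype.ext (Equiv.ext fun x => ?_)) hr
  have := (Prod.ext_iff.1 (key (p.right.symm i) x)).2
  rw [← hr] at this
  simpa using this

theorem WreathDecomp.autHom_surjective [Nonempty C] [Finite C] (h : WreathDecomp G d G' d' n e) :
    Function.Surjective h.autHom := by
  classical
  rintro ⟨k, hk⟩
  have hq := qIso_of_mem_autC hk
  obtain ⟨c⟩ := ‹Nonempty C›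
  have hrel : ∀ i j x y, (e.symm (k (e (i, x)))).1 = (e.symm (k (e (j, y)))).1 ↔ i = j := by
    intro i j x y
    have := h.rel hq (k (e (i, x))) (k (e (j, y))) (e (i, x)) (e (j, y)) (by simp)
    simpa using this
  have hσ : Function.Injective fun i => (e.symm (k (e (i, c)))).1 :=
    fun i j hij => (hrel i j c c).1 hij
  let σ : Equiv.Perm (Fin n) := Equiv.ofBijective _ (Finite.injective_iff_bijective.1 hσ)
  have hσk : ∀ i x, (e.symm (k (e (i, x)))).1 = σ i := fun i x => (hrel i i x c).2 rfl
  have hφ : ∀ i, Function.Injective fun x => (e.symm (k (e (σ.symm i, x)))).2 := by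
    intro i x y hxy
    have : e.symm (k (e (σ.symm i, x))) = e.symm (k (e (σ.symm i, y))) :=
      Prod.ext (by rw [hσk, hσk]) hxy
    have := e.injective (k.injective (e.symm.injective this))
    exact (Prod.ext_iff.1 this).2
  let φ : Fin n → Equiv.Perm C := fun i =>
    Equiv.ofBijective _ (Finite.injective_iff_bijective.1 (hφ i))
  have hk' : ∀ i x, k (e (i, x)) = e (σ i, φ (σ i) x) := by
    intro i x
    rw [← Equiv.symm_apply_eq]
    refine Prod.ext (hσk i x) ?_
    change _ = (e.symm (k (e (σ.symm (σ i), x)))).2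
    rw [σ.symm_apply_apply]
  have hφm : ∀ i, φ i ∈ autC G' d' := by
    intro i
    obtain ⟨i, rfl⟩ := σ.surjective i
    refine ⟨fun a b => ?_, fun a => h.inv hq (σ i) i _ _ (by simp [hk'])⟩
    rw [← h.adj (σ i), ← hk', ← hk', hk.1, h.adj]
  refine ⟨⟨fun i => ⟨φ i, hφm i⟩, σ⟩, Subtype.ext (Equiv.ext fun x => ?_)⟩
  obtain ⟨⟨i, x⟩, rfl⟩ := e.surjective x
  rw [h.autHom_apply, hk']

/-- The automorphism group of a graph made of copies of a graph. -/
def WreathDecomp.autEquiv [Nonempty C] [Finite C] (h : WreathDecomp G d G' d' n e) :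
    WreathSym (autC G' d') n ≃* autC G d :=
  MulEquiv.ofBijective h.autHom ⟨h.autHom_injective, h.autHom_surjective⟩

end wreath

theorem subsingleton_autC {V K : Type} [Subsingleton V] (G : SimpleGraph V) (d : V → K) :
    Subsingleton (autC G d) :=
  ⟨fun _ _ => Subtype.ext (Equiv.ext fun _ => Subsingleton.elim _ _)⟩

theorem SimpleGraph.IsGood.jor_autC {V K : Type} [Fintype V] [Nonempty V] {G : SimpleGraph V}
    (hG : G.IsGood) (d : V → K) : Jor {GrpCat.of Unit} (GrpCat.of (autC G d)) := by
  refine SimpleGraph.IsGood.induction (P := fun {V K} _ _ (G : SimpleGraph V) (d : V → K) =>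
    Jor {GrpCat.of Unit} (GrpCat.of (autC G d))) ?_ ?_ ?_ d hG
  · intro V K _ _ G d hV
    have := subsingleton_autC G d
    have : Unique (autC G d) := ⟨⟨1⟩, fun _ => Subsingleton.elim _ _⟩
    exact .iso (Γ := GrpCat.of Unit) ⟨(MulEquiv.ofUnique : Unit ≃* autC G d)⟩ (.of rfl)
  · intro V V₁ V₂ K K₁ K₂ _ _ _ _ _ _ G d G₁ d₁ G₂ d₂ e h h₁ h₂
    exact .iso ⟨h.autEquiv⟩ (.prod h₁ h₂)
  · intro V C K K' _ _ _ _ G d G' d' n e hn h h'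
    have : NeZero n := ⟨by omega⟩
    exact .iso ⟨h.autEquiv⟩ (.wreath n h')

/-- Automorphisms of a graph preserve any constant colouring. -/
def autEquivAutC {V : Type} (G : SimpleGraph V) : (G ≃g G) ≃* autC G fun _ => () where
  toFun f := ⟨f.toEquiv, fun _ _ => f.map_adj_iff, fun _ => rfl⟩
  invFun f := ⟨f.1, fun {a b} => f.2.1 a b⟩
  left_inv _ := rfl
  right_inv _ := rfl
  map_mul' _ _ := rfl

/-! ### Quantum symmetry -/

section alternative

variable {V K : Type} [Fintype V]

/-- A coloured graph is rigid if all its quantum automorphisms are trivial. -/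
def IsRigid (G : SimpleGraph V) (d : V → K) : Prop :=
  ∀ {X : Type} [Ring X] [Algebra ℂ X] {p : X} {u : V → V → X}, QIso p u G d G d →
    ∀ x y, x ≠ y → u x y = 0

/-- The coefficients of all quantum automorphisms of the coloured graph commute. -/
def IsCommuting (G : SimpleGraph V) (d : V → K) : Prop :=
  ∀ {X : Type} [Ring X] [Algebra ℂ X] {p : X} {u : V → V → X}, QIso p u G d G d →
    ∀ x y z t, u x y * u z t = u z t * u x y

/-- The coloured graph has two nontrivial automorphisms with disjoint supports. -/
def HasDisjointAut (G : SimpleGraph V) (d : V → K) : Prop :=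
  ∃ f ∈ autC G d, ∃ g ∈ autC G d, f ≠ 1 ∧ g ≠ 1 ∧ ∀ x, f x = x ∨ g x = x

theorem IsRigid.apply_self {G : SimpleGraph V} {d : V → K} (hr : IsRigid G d) {X : Type} [Ring X]
    [Algebra ℂ X] {p : X} {u : V → V → X} (h : QIso p u G d G d) (x : V) : u x x = p := by
  classical
  rw [← h.row_sum x, Finset.sum_eq_single x (fun y _ hy => hr h x y hy.symm) (by simp)]

/-- All entries are 0 or `p`, so they commute with anything for which `p` is a unit. -/
theorem IsRigid.commute {G : SimpleGraph V} {d : V → K} (hr : IsRigid G d) {X : Type} [Ring X]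
    [Algebra ℂ X] {p : X} {u : V → V → X} (h : QIso p u G d G d) {c : X} (hc : p * c = c)
    (hc' : c * p = c) (x y : V) : u x y * c = c * u x y := by
  rcases eq_or_ne x y with rfl | hxy
  · rw [hr.apply_self h, hc, hc']
  · rw [hr h x y hxy, zero_mul, mul_zero]

theorem IsRigid.isCommuting {G : SimpleGraph V} {d : V → K} (hr : IsRigid G d) :
    IsCommuting G d :=
  fun h x y z t => hr.commute h (h.one_mul z t) (h.mul_one z t) x y

/-- The coefficients of a magic matrix of size at most three commute. -/
theorem QMagic.commute_of_le_three {X : Type*} [Ring X] {p : X} {W : Type*} [Fintype W] {n : ℕ}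
    (hn : n ≤ 3) {u : W → Fin n → X} (h : QMagic p u) (x y : W) (a b : Fin n) :
    u x a * u y b = u y b * u x a := by
  rcases eq_or_ne x y with rfl | hxy
  · rcases eq_or_ne a b with rfl | hab
    · rfl
    · rw [h.row_orth x a b hab, h.row_orth x b a hab.symm]
  rcases eq_or_ne a b with rfl | hab
  · rw [h.col_orth x y a hxy, h.col_orth y x a hxy.symm]
  -- Summing the middle factor over its row gives `u x a * u x c = 0`. The columns `a` and `c`
  -- contribute nothing, so with at most three columns the term at `b` must vanish too.
  have key : ∀ a b c : Fin n, a ≠ b → b ≠ c → a ≠ c → u x a * u y b * u x c = 0 := by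
    intro a b c hab hbc hac
    have h1 : ∑ e, u x a * u y e * u x c = 0 := by
      rw [← Finset.sum_mul, ← Finset.mul_sum, h.row_sum, h.mul_one, h.row_orth x a c hac]
    rw [Finset.sum_eq_single b] at h1
    · exact h1
    · intro e _ he
      rcases eq_or_ne e a with rfl | hea
      · rw [h.col_orth x y e hxy, zero_mul]
      · obtain rfl : e = c := by omega
        rw [mul_assoc, h.col_orth y x e hxy.symm, mul_zero]
    · simp
  have h1 : u x a * u y b = u x a * u y b * u x a := by
    have : ∑ c, u x a * u y b * u x c = u x a * u y b := by
      rw [← Finset.mul_sum, h.row_sum, mul_assoc, h.mul_one]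
    refine this.symm.trans (Finset.sum_eq_single a (fun c _ hc => ?_) (by simp))
    rcases eq_or_ne c b with rfl | hcb
    · rw [mul_assoc, h.col_orth y x c hxy.symm, mul_zero]
    · exact key a b c hab hcb.symm hc.symm
  have h2 : u y b * u x a = u x a * u y b * u x a := by
    have : ∑ c, u x c * u y b * u x a = u y b * u x a := by
      rw [← Finset.sum_mul, ← Finset.sum_mul, h.row_sum, h.one_mul]
    refine this.symm.trans (Finset.sum_eq_single a (fun c _ hc => ?_) (by simp))
    rcases eq_or_ne c b with rfl | hcb
    · rw [h.col_orth x y c hxy, zero_mul]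
    · exact key c b a hcb hab.symm hc
  rw [h1, h2]

end alternative

section sum

variable {V V₁ V₂ K K₁ K₂ : Type} [Fintype V] [Fintype V₁] [Fintype V₂] {G : SimpleGraph V}
  {d : V → K} {G₁ : SimpleGraph V₁} {d₁ : V₁ → K₁} {G₂ : SimpleGraph V₂} {d₂ : V₂ → K₂}
  {e : V₁ ⊕ V₂ ≃ V}

theorem SumDecomp.isRigid (h : SumDecomp G d G₁ d₁ G₂ d₂ e) (h₁ : IsRigid G₁ d₁)
    (h₂ : IsRigid G₂ d₂) : IsRigid G d := by
  intro X _ _ p u hu x y hxy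
  obtain ⟨x, rfl⟩ := e.surjective x
  obtain ⟨y, rfl⟩ := e.surjective y
  rcases x with x | x <;> rcases y with y | y
  · exact h₁ (h.qIso_inl hu) x y fun e' => hxy (by rw [e'])
  · exact (h.zero hu _ _).1
  · exact (h.zero hu _ _).2
  · exact h₂ (h.qIso_inr hu) x y fun e' => hxy (by rw [e'])

/-- Entries of the two different blocks are free with respect to each other; they commute only
because one block is trivial. -/
theorem SumDecomp.isCommuting (h : SumDecomp G d G₁ d₁ G₂ d₂ e) (h₁ : IsCommuting G₁ d₁)
    (h₂ : IsCommuting G₂ d₂) (hr : IsRigid G₁ d₁ ∨ IsRigid G₂ d₂) : IsCommuting G d := by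
  intro X _ _ p u hu x y z t
  obtain ⟨x, rfl⟩ := e.surjective x
  obtain ⟨y, rfl⟩ := e.surjective y
  obtain ⟨z, rfl⟩ := e.surjective z
  obtain ⟨t, rfl⟩ := e.surjective t
  have key : ∀ x y z t, u (e (.inl x)) (e (.inl y)) * u (e (.inr z)) (e (.inr t))
      = u (e (.inr z)) (e (.inr t)) * u (e (.inl x)) (e (.inl y)) := by
    intro x y z t
    rcases hr with hr | hr
    · exact hr.commute (h.qIso_inl hu) (hu.one_mul _ _) (hu.mul_one _ _) x y
    · exact (hr.commute (h.qIso_inr hu) (hu.one_mul _ _) (hu.mul_one _ _) z t).symm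
  rcases x with x | x <;> rcases y with y | y <;> rcases z with z | z <;> rcases t with t | t <;>
    try simp only [(h.zero hu _ _).1, (h.zero hu _ _).2, zero_mul, mul_zero]
  · exact h₁ (h.qIso_inl hu) x y z t
  · exact key x y z t
  · exact (key z t x y).symm
  · exact h₂ (h.qIso_inr hu) x y z t

/-- Nontrivial automorphisms of the two parts have disjoint supports. -/
theorem SumDecomp.hasDisjointAut_of_ne (h : SumDecomp G d G₁ d₁ G₂ d₂ e) {f : autC G₁ d₁}
    {g : autC G₂ d₂} (hf : f ≠ 1) (hg : g ≠ 1) : HasDisjointAut G d := by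
  refine ⟨_, (h.autHom (f, 1)).2, _, (h.autHom (1, g)).2, ?_, ?_, ?_⟩
  · intro e'
    exact hf (Prod.ext_iff.1 (h.autHom_injective ((Subtype.ext e').trans (map_one h.autHom).symm))).1
  · intro e'
    exact hg (Prod.ext_iff.1 (h.autHom_injective ((Subtype.ext e').trans (map_one h.autHom).symm))).2
  · intro x
    obtain ⟨x | x, rfl⟩ := e.surjective x
    · right; rw [h.autHom_inl]; rfl
    · left; rw [h.autHom_inr]; rfl

theorem SumDecomp.hasDisjointAut_left (h : SumDecomp G d G₁ d₁ G₂ d₂ e)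
    (h₁ : HasDisjointAut G₁ d₁) : HasDisjointAut G d := by
  obtain ⟨f, hf, g, hg, hf1, hg1, hfg⟩ := h₁
  refine ⟨_, (h.autHom (⟨f, hf⟩, 1)).2, _, (h.autHom (⟨g, hg⟩, 1)).2, ?_, ?_, ?_⟩
  · intro e'
    exact hf1 (congrArg Subtype.val
      (Prod.ext_iff.1 (h.autHom_injective ((Subtype.ext e').trans (map_one h.autHom).symm))).1)
  · intro e'
    exact hg1 (congrArg Subtype.val
      (Prod.ext_iff.1 (h.autHom_injective ((Subtype.ext e').trans (map_one h.autHom).symm))).1)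
  · intro x
    obtain ⟨x | x, rfl⟩ := e.surjective x
    · rw [h.autHom_inl, h.autHom_inl]
      exact (hfg x).imp (congrArg fun x => e (.inl x)) (congrArg fun x => e (.inl x))
    · left; rw [h.autHom_inr]; rfl

theorem SumDecomp.hasDisjointAut_right (h : SumDecomp G d G₁ d₁ G₂ d₂ e)
    (h₁ : HasDisjointAut G₂ d₂) : HasDisjointAut G d := by
  obtain ⟨f, hf, g, hg, hf1, hg1, hfg⟩ := h₁
  refine ⟨_, (h.autHom (1, ⟨f, hf⟩)).2, _, (h.autHom (1, ⟨g, hg⟩)).2, ?_, ?_, ?_⟩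
  · intro e'
    exact hf1 (congrArg Subtype.val
      (Prod.ext_iff.1 (h.autHom_injective ((Subtype.ext e').trans (map_one h.autHom).symm))).2)
  · intro e'
    exact hg1 (congrArg Subtype.val
      (Prod.ext_iff.1 (h.autHom_injective ((Subtype.ext e').trans (map_one h.autHom).symm))).2)
  · intro x
    obtain ⟨x | x, rfl⟩ := e.surjective x
    · left; rw [h.autHom_inl]; rfl
    · rw [h.autHom_inr, h.autHom_inr]
      exact (hfg x).imp (congrArg fun x => e (.inr x)) (congrArg fun x => e (.inr x))

end sum

section wreath

variable {V C K K' : Type} [Fintype V] [Fintype C] [Nonempty C] {G : SimpleGraph V} {d : V → K}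
  {G' : SimpleGraph C} {d' : C → K'} {n : ℕ} {e : Fin n × C ≃ V}

/-- If the copies are rigid, each block is a scalar matrix with value an entry of the permutation of
the copies, and these entries commute when there are at most three copies. -/
theorem WreathDecomp.isCommuting (h : WreathDecomp G d G' d' n e) (hr : IsRigid G' d')
    (hn : n ≤ 3) : IsCommuting G d := by
  intro X _ _ p u hu x y z t
  obtain ⟨⟨i, x⟩, rfl⟩ := e.surjective x
  obtain ⟨⟨j, y⟩, rfl⟩ := e.surjective y
  obtain ⟨⟨k, z⟩, rfl⟩ := e.surjective z
  obtain ⟨⟨l, t⟩, rfl⟩ := e.surjective t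
  rcases eq_or_ne x y with rfl | hxy
  · rcases eq_or_ne z t with rfl | hzt
    · rw [hr.apply_self (h.qIso_block hu i j), hr.apply_self (h.qIso_block hu k l)]
      exact (h.copyPerm_magic hu).commute_of_le_three hn i k j l
    · rw [hr (h.qIso_block hu k l) z t hzt, zero_mul, mul_zero]
  · rw [hr (h.qIso_block hu i j) x y hxy, zero_mul, mul_zero]

theorem WreathDecomp.hasDisjointAut (h : WreathDecomp G d G' d' n e) {p q : WreathSym (autC G' d') n}
    (hp : p ≠ 1) (hq : q ≠ 1) (hpq : ∀ i, (p.right i = i ∧ p.left (p.right i) = 1) ∨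
      (q.right i = i ∧ q.left (q.right i) = 1)) : HasDisjointAut G d := by
  refine ⟨_, (h.autHom p).2, _, (h.autHom q).2, ?_, ?_, ?_⟩
  · exact fun e' => hp (h.autHom_injective ((Subtype.ext e').trans (map_one h.autHom).symm))
  · exact fun e' => hq (h.autHom_injective ((Subtype.ext e').trans (map_one h.autHom).symm))
  · intro x
    obtain ⟨⟨i, x⟩, rfl⟩ := e.surjective x
    rw [h.autHom_apply, h.autHom_apply]
    refine (hpq i).imp ?_ ?_ <;>
    · rintro ⟨h1, h2⟩
      rw [h2, h1]; rfl

end wreath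

/-- A good coloured graph without nontrivial automorphisms is rigid, and the coefficients of its
quantum automorphisms commute if it does not have nontrivial automorphisms with disjoint
supports. -/
theorem SimpleGraph.IsGood.alternative {V K : Type} [Fintype V] [Nonempty V] {G : SimpleGraph V}
    (hG : G.IsGood) (d : V → K) :
    ((∀ f : autC G d, f = 1) → IsRigid G d) ∧ (¬ HasDisjointAut G d → IsCommuting G d) := by
  refine SimpleGraph.IsGood.induction (P := fun {V K} _ _ (G : SimpleGraph V) (d : V → K) =>
    ((∀ f : autC G d, f = 1) → IsRigid G d) ∧ (¬ HasDisjointAut G d → IsCommuting G d))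
    ?_ ?_ ?_ d hG
  · intro V K _ _ G d hV
    have hr : IsRigid G d := fun _ x y hxy => (hxy (Subsingleton.elim x y)).elim
    exact ⟨fun _ => hr, fun _ => hr.isCommuting⟩
  · intro V V₁ V₂ K K₁ K₂ _ _ _ _ _ _ G d G₁ d₁ G₂ d₂ e h h₁ h₂
    constructor
    · intro H
      refine h.isRigid (h₁.1 fun f => ?_) (h₂.1 fun f => ?_)
      · exact (Prod.ext_iff.1
          (h.autHom_injective ((H (h.autHom (f, 1))).trans (map_one h.autHom).symm))).1
      · exact (Prod.ext_iff.1
          (h.autHom_injective ((H (h.autHom (1, f))).trans (map_one h.autHom).symm))).2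
    · intro H
      refine h.isCommuting (h₁.2 fun h' => H (h.hasDisjointAut_left h'))
        (h₂.2 fun h' => H (h.hasDisjointAut_right h')) ?_
      -- If neither part is rigid, each has a nontrivial automorphism, and these two have disjoint
      -- supports.
      by_contra! hr
      have h1 := mt h₁.1 hr.1
      have h2 := mt h₂.1 hr.2
      push Not at h1 h2
      obtain ⟨f, hf⟩ := h1
      obtain ⟨g, hg⟩ := h2
      exact H (h.hasDisjointAut_of_ne hf hg)
  · intro V C K K' _ _ _ _ G d G' d' n e hn h h'
    have h01 : (⟨0, by omega⟩ : Fin n) ≠ ⟨1, by omega⟩ := by simp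
    have swap_ne : ∀ {i j : Fin n}, i ≠ j →
        (⟨1, Equiv.swap i j⟩ : WreathSym (autC G' d') n) ≠ 1 := by
      intro i j hij e'
      have := congrArg (fun p => p.right i) e'
      simp [hij.symm] at this
    constructor
    · intro H
      -- Vacuous: as `n ≥ 2`, exchanging two copies is a nontrivial automorphism.
      exact (swap_ne h01 (h.autHom_injective ((H _).trans (map_one h.autHom).symm))).elim
    · intro H
      refine h.isCommuting (h'.1 ?_) ?_
      -- A nontrivial automorphism of the model, applied to copy 0 and to copy 1, would give
      -- disjoint automorphisms.
      · by_contra! hf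
        obtain ⟨f, hf⟩ := hf
        have single_ne : ∀ i : Fin n,
            (⟨Pi.mulSingle i f, 1⟩ : WreathSym (autC G' d') n) ≠ 1 := by
          intro i e'
          have := congrArg (fun p => p.left i) e'
          simp [hf] at this
        refine H (h.hasDisjointAut (single_ne ⟨0, by omega⟩) (single_ne ⟨1, by omega⟩) fun i => ?_)
        rcases eq_or_ne i ⟨0, by omega⟩ with rfl | hi
        · right; exact ⟨rfl, Pi.mulSingle_eq_of_ne (M := fun _ : Fin n => autC G' d') h01 f⟩
        · left; exact ⟨rfl, Pi.mulSingle_eq_of_ne (M := fun _ : Fin n => autC G' d') hi f⟩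
      -- With at least four copies, the transpositions `(0 1)` and `(2 3)` are disjoint.
      · by_contra! hn4
        have h23 : (⟨2, by omega⟩ : Fin n) ≠ ⟨3, by omega⟩ := by simp
        refine H (h.hasDisjointAut (swap_ne h01) (swap_ne h23) fun i => ?_)
        by_cases hi : i.1 < 2
        · right
          refine ⟨Equiv.swap_apply_of_ne_of_ne ?_ ?_, rfl⟩ <;>
          · rintro rfl; simp at hi
        · left
          refine ⟨Equiv.swap_apply_of_ne_of_ne ?_ ?_, rfl⟩ <;>
          · rintro rfl; simp at hi

/-! ### Quantum automorphisms built from two disjoint automorphisms -/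

section mix

variable {V K B : Type} [Ring B] [DecidableEq V]

/-- The matrix that is, on each orbit of `k`, a combination of the identity and of `k`. -/
def mixMatrix (k : Equiv.Perm V) (r : V → B) (x a : V) : B :=
  (if x = a then 1 - r a else 0) + if x = k a then r a else 0

/-- Where `r` takes the same value, the identity and `k` are applied together, since `r * (1 - r) =
0` kills mixed products. Where `r` takes different values, these need not commute, and `H` ensures
that moving one vertex alone does not change adjacency. -/
theorem mixMatrix_qIso [Fintype V] {G : SimpleGraph V} {d : V → K} {k : Equiv.Perm V}
    (hk : k ∈ autC G d) {r : V → B} (hr : ∀ a, r a * r a = r a) (hrk : ∀ a, r (k a) = r a)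
    (H : ∀ a b, r a = r b ∨ (G.Adj a (k b) ↔ G.Adj a b)) : QIso 1 (mixMatrix k r) G d G d := by
  have h1 : ∀ a, (1 - r a) * r a = 0 := fun a => by rw [sub_mul, one_mul, hr, sub_self]
  have h2 : ∀ a, r a * (1 - r a) = 0 := fun a => by rw [mul_sub, mul_one, hr, sub_self]
  have h3 : ∀ a, (1 - r a) * (1 - r a) = 1 - r a := fun a => by rw [mul_sub, h1, mul_one, sub_zero]
  have hne : ∀ x a, mixMatrix k r x a ≠ 0 → x = a ∨ x = k a := by
    intro x a h
    by_contra! h'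
    exact h (by simp [mixMatrix, h'.1, h'.2])
  have hself : ∀ a, k a = a → mixMatrix k r a a = 1 := fun a h => by simp [mixMatrix, h]
  have hdiag : ∀ a, k a ≠ a → mixMatrix k r a a = 1 - r a := fun a h => by
    simp [mixMatrix, h.symm]
  have hoff : ∀ a, k a ≠ a → mixMatrix k r (k a) a = r a := fun a h => by simp [mixMatrix, h]
  refine ⟨⟨?_, ?_, ?_, ?_, ?_⟩, ?_, ?_⟩
  · intro x a
    by_cases h0 : mixMatrix k r x a = 0
    · simp [h0]
    by_cases hka : k a = a
    · obtain rfl : x = a := by simpa [hka] using hne x a h0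
      simp [hself x hka]
    · rcases hne x a h0 with rfl | rfl
      · rw [hdiag x hka, h3]
      · rw [hoff a hka, hr]
  · intro x a b hab
    by_contra h0
    have ha := hne x a (left_ne_zero_of_mul h0)
    have hb := hne x b (right_ne_zero_of_mul h0)
    rcases ha with rfl | rfl
    · rcases hb with rfl | rfl
      · exact hab rfl
      · have hkb : k (k b) ≠ k b := fun e => hab (k.injective e)
        rw [hdiag _ hkb, hoff b hab, hrk, h1] at h0
        exact h0 rfl
    · rcases hb with rfl | hb
      · have hka : k (k a) ≠ k a := fun e => hab (k.injective e).symm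
        rw [hdiag _ hka, hoff a hab.symm, hrk, h2] at h0
        exact h0 rfl
      · exact hab (k.injective hb)
  · intro x y a hxy
    by_contra h0
    have hx := hne x a (left_ne_zero_of_mul h0)
    have hy := hne y a (right_ne_zero_of_mul h0)
    rcases hx with rfl | rfl <;> rcases hy with rfl | rfl
    · exact hxy rfl
    · rw [hdiag x hxy.symm, hoff x hxy.symm, h1] at h0
      exact h0 rfl
    · rw [hdiag y hxy, hoff y hxy, h2] at h0
      exact h0 rfl
    · exact hxy rfl
  · intro x
    simp only [mixMatrix, Finset.sum_add_distrib]
    have : ∑ a, (if x = k a then r a else 0) = r x := by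
      rw [← k.symm.sum_comp]
      simp [← hrk (k.symm x)]
    rw [this]
    simp
  · intro a
    simp [mixMatrix, Finset.sum_add_distrib]
  · intro x y a b h0
    have hx := hne x a (left_ne_zero_of_mul h0)
    have hy := hne y b (right_ne_zero_of_mul h0)
    by_cases hka : k a = a
    · obtain rfl : x = a := by simpa [hka] using hx
      rcases hy with rfl | rfl
      · rfl
      · rw [← hk.1 x b, hka]
    by_cases hkb : k b = b
    · obtain rfl : y = b := by simpa [hkb] using hy
      rcases hx with rfl | rfl
      · rfl
      · rw [← hk.1 a y, hkb]
    rcases hx with rfl | rfl <;> rcases hy with rfl | rfl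
    · rfl
    · refine (H x b).resolve_left fun e => ?_
      rw [hdiag x hka, hoff b hkb, ← e, h1] at h0
      exact h0 rfl
    · rw [G.adj_comm, G.adj_comm a]
      refine (H y a).resolve_left fun e => ?_
      rw [hdiag y hkb, hoff a hka, e, h2] at h0
      exact h0 rfl
    · exact hk.1 a b
  · intro x a h
    rcases hne x a h with rfl | rfl
    · rfl
    · exact hk.2 a

/-- Two nontrivial automorphisms with disjoint supports and two idempotents define a quantum
automorphism. -/
theorem exists_qIso_of_disjoint [Fintype V] {G : SimpleGraph V} {d : V → K} {f g : Equiv.Perm V}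
    (hf : f ∈ autC G d) (hg : g ∈ autC G d) (hf1 : f ≠ 1) (hg1 : g ≠ 1)
    (hfg : ∀ x, f x = x ∨ g x = x) [StarRing B] {p q : B} (hp : p * p = p) (hq : q * q = q)
    (hp' : star p = p) (hq' : star q = q) :
    ∃ w : V → V → B, (∀ x y, star (w x y) = w x y) ∧ QIso 1 w G d G d ∧
      (∃ x, w x x = 1 - p) ∧ ∃ x, w x x = 1 - q := by
  classical
  -- The projection `p` controls `f` and `q` controls `g`; at common fixed points the value is
  -- irrelevant, as the diagonal entry is 1 there anyway.
  let r : V → B := fun a => if f a ≠ a then p else if g a ≠ a then q else 0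
  have hkf : ∀ a, f a ≠ a → (f * g) a = f a := fun a ha => by
    rw [Equiv.Perm.mul_apply, (hfg a).resolve_left ha]
  have hfga : ∀ a, g a ≠ a → f (g a) = g a := fun a ha =>
    (hfg (g a)).resolve_right fun e => ha (g.injective e)
  have hkg : ∀ a, g a ≠ a → (f * g) a = g a := hfga
  have hrf : ∀ a, f a ≠ a → r a = p := fun a ha => by simp [r, ha]
  have hrg : ∀ a, g a ≠ a → r a = q := fun a ha => by
    simp [r, ha, (hfg a).resolve_right ha]
  have hr0 : ∀ a, f a = a → g a = a → r a = 0 := fun a h h' => by simp [r, h, h']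
  have hdiag : ∀ a, (f * g) a ≠ a → mixMatrix (f * g) r a a = 1 - r a := fun a h => by
    simp only [mixMatrix, if_true, if_neg h.symm, add_zero]
  obtain ⟨x, hx⟩ : ∃ x, f x ≠ x := by
    by_contra! h; exact hf1 (Equiv.ext h)
  obtain ⟨y, hy⟩ : ∃ y, g y ≠ y := by
    by_contra! h; exact hg1 (Equiv.ext h)
  refine ⟨mixMatrix (f * g) r, ?_, mixMatrix_qIso (mul_mem hf hg) ?_ ?_ ?_, ⟨x, ?_⟩, ⟨y, ?_⟩⟩
  · intro x y
    have : star (r y) = r y := by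
      simp only [r]; split_ifs <;> simp [hp', hq']
    simp only [mixMatrix, star_add, apply_ite star, star_sub, star_one, star_zero, this]
  · intro a
    simp only [r]; split_ifs <;> simp [hp, hq]
  · intro a
    by_cases h : f a = a
    · by_cases h' : g a = a
      · rw [Equiv.Perm.mul_apply, h', h]
      · rw [hkg a h', hrg _ h', hrg _ fun e => h' (g.injective e)]
    · rw [hkf a h, hrf _ h, hrf _ fun e => h (f.injective e)]
  -- If `b` is moved by one of the automorphisms and `a` is fixed by it, that automorphism itself
  -- shows that moving `b` preserves adjacency to `a`; if it moves both, the values of `r` coincide.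
  · intro a b
    by_cases h : f b = b
    · by_cases h' : g b = b
      · right; rw [Equiv.Perm.mul_apply, h', h]
      · by_cases ha : g a = a
        · right; rw [hkg b h']; conv_lhs => rw [← ha]
          exact hg.1 a b
        · left; rw [hrg a ha, hrg b h']
    · by_cases ha : f a = a
      · right; rw [hkf b h]; conv_lhs => rw [← ha]
        exact hf.1 a b
      · left; rw [hrf a ha, hrf b h]
  · rw [hdiag x (by rwa [hkf x hx]), hrf x hx]
  · rw [hdiag y (by rwa [hkg y hy]), hrg y hy]

end mix

/-- There are two projections that do not commute. -/
theorem exists_projections : ∃ p q : Matrix (Fin 2) (Fin 2) ℂ, p * p = p ∧ q * q = q ∧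
    star p = p ∧ star q = q ∧ (1 - p) * (1 - q) ≠ (1 - q) * (1 - p) := by
  refine ⟨!![1, 0; 0, 0], !![1 / 2, 1 / 2; 1 / 2, 1 / 2], ?_, ?_, ?_, ?_, ?_⟩
  · ext i j; fin_cases i <;> fin_cases j <;> simp
  · ext i j; fin_cases i <;> fin_cases j <;> simp <;> norm_num
  · ext i j; fin_cases i <;> fin_cases j <;> simp [Matrix.star_apply]
  · ext i j; fin_cases i <;> fin_cases j <;> simp [Matrix.star_apply]
  · intro h
    have := congrFun (congrFun h 0) 1
    simp [Matrix.mul_apply, Matrix.one_apply] at this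

namespace FinGraph

/-- The generators commute with one another and are self-adjoint, so commutation extends to the
star-algebra they generate, one factor at a time. -/
theorem commute_of_isCommuting {G : FinGraph} (h : IsCommuting G.graph fun _ => ()) (a b : G.qu.A) :
    a * b = b * a := by
  have h0 : ∀ x y z t : G.V, G.qu.u x y * G.qu.u z t = G.qu.u z t * G.qu.u x y :=
    h G.isModel_qu.qIso
  have h1 : ∀ (a : G.qu.A) (x y : G.V), a * G.qu.u x y = G.qu.u x y * a := fun a x y =>
    QPermGroup.commute_of_commute_u (StarAlgHom.id ℂ G.qu.A) _ (G.qu.magic.selfAdj x y)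
      (fun i j => h0 i j x y) a
  have hb : b ∈ StarAlgebra.adjoin ℂ (Set.range fun p : G.qu.I × G.qu.I => G.qu.u p.1 p.2) := by
    rw [G.qu.adjoin_u]; exact StarSubalgebra.mem_top
  induction hb using StarAlgebra.adjoin_induction generalizing a with
  | mem x hx => obtain ⟨p, rfl⟩ := hx; exact h1 a p.1 p.2
  | algebraMap r => exact (Algebra.commutes r a).symm
  | add x y _ _ hx hy => rw [mul_add, add_mul, hx, hy]
  | mul x y _ _ hx hy => rw [← mul_assoc, hx, mul_assoc, hy, mul_assoc]
  | star x _ hx => simpa using (congrArg star (hx (star a))).symm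

theorem schmidtCriterion_iff (G : FinGraph) :
    G.SchmidtCriterion ↔ HasDisjointAut G.graph fun _ => () := by
  constructor
  · rintro ⟨f, g, hf, hg, hfg⟩
    refine ⟨_, (autEquivAutC G.graph f).2, _, (autEquivAutC G.graph g).2, ?_, ?_, hfg⟩
    · exact fun e => hf ((autEquivAutC G.graph).injective ((Subtype.ext e).trans (map_one _).symm))
    · exact fun e => hg ((autEquivAutC G.graph).injective ((Subtype.ext e).trans (map_one _).symm))
  · rintro ⟨f, hf, g, hg, hf1, hg1, hfg⟩
    refine ⟨(autEquivAutC G.graph).symm ⟨f, hf⟩, (autEquivAutC G.graph).symm ⟨g, hg⟩, ?_, ?_, hfg⟩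
    · exact fun e => hf1 (congrArg Subtype.val
        ((autEquivAutC G.graph).symm.injective (e.trans (map_one _).symm)))
    · exact fun e => hg1 (congrArg Subtype.val
        ((autEquivAutC G.graph).symm.injective (e.trans (map_one _).symm)))

/-- The universal property sends two diagonal generators to `1 - p` and `1 - q`, where `p` and `q`
are noncommuting projections in the matrix algebra of size two. -/
theorem hasQuantumSymmetry_of_schmidtCriterion {G : FinGraph} (h : G.SchmidtCriterion) :
    G.HasQuantumSymmetry := by
  classical
  obtain ⟨f, hf, g, hg, hf1, hg1, hfg⟩ := G.schmidtCriterion_iff.1 h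
  obtain ⟨p, q, hp, hq, hp', hq', hpq⟩ := exists_projections
  obtain ⟨w, hw, hw', ⟨x, hx⟩, y, hy⟩ :=
    exists_qIso_of_disjoint hf hg hf1 hg1 hfg hp hq hp' hq'
  obtain ⟨φ, hφ⟩ := G.isModel_qu.lift _ w hw hw'
  intro hc
  have := congrArg φ (hc (G.qu.u x x) (G.qu.u y y))
  rw [map_mul, map_mul] at this
  have h1 : φ (G.qu.u x x) = w x x := hφ x x
  have h2 : φ (G.qu.u y y) = w y y := hφ y y
  rw [h1, h2, hx, hy] at this
  exact hpq this

theorem schmidtAlternative_blockCographs : SchmidtAlternative blockCographs := by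
  intro G hG
  refine ⟨fun h => ?_, hasQuantumSymmetry_of_schmidtCriterion⟩
  by_contra hs
  rw [schmidtCriterion_iff] at hs
  exact h (commute_of_isCommuting (((isGood_of_mem_blockCographs hG).alternative _).2 hs))

end FinGraph

/-! ### Free products and free wreath products of isomorphic quantum groups -/

namespace QPermGroup

theorem Isomorphic.freeProd {P P' Q Q' : QPermGroup} (hP : P.Isomorphic P') (hQ : Q.Isomorphic Q') :
    (P.freeProd Q).Isomorphic (P'.freeProd Q') := by
  obtain ⟨φ, φ', h1, h2, h3⟩ := hP.exists_homs
  obtain ⟨ψ, ψ', k1, k2, k3⟩ := hQ.exists_homs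
  refine .of_homs (freeProdLift ((inlHom P' Q').comp φ) ((inrHom P' Q').comp ψ))
    (freeProdLift ((inlHom P Q).comp φ') ((inrHom P Q).comp ψ')) ?_ ?_ ?_
  · exact freeProd_hom_ext (fun a => congrArg (inlHom P Q) (DFunLike.congr_fun h1 a))
      (fun a => congrArg (inrHom P Q) (DFunLike.congr_fun k1 a))
  · exact freeProd_hom_ext (fun a => congrArg (inlHom P' Q') (DFunLike.congr_fun h2 a))
      (fun a => congrArg (inrHom P' Q') (DFunLike.congr_fun k2 a))
  · refine freeProd_hom_ext (fun a => ?_) (fun a => ?_)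
    · rw [StarAlgHom.comp_apply, StarAlgHom.comp_apply, freeProd_Δ_inl, tensorMap_comp,
        freeProdLift_inl, StarAlgHom.comp_apply, freeProd_Δ_inl,
        show P'.Δ (φ a) = tensorMap φ φ (P.Δ a) from (DFunLike.congr_fun h3 a).symm, tensorMap_comp]
      rfl
    · rw [StarAlgHom.comp_apply, StarAlgHom.comp_apply, freeProd_Δ_inr, tensorMap_comp,
        freeProdLift_inr, StarAlgHom.comp_apply, freeProd_Δ_inr,
        show Q'.Δ (ψ a) = tensorMap ψ ψ (Q.Δ a) from (DFunLike.congr_fun k3 a).symm, tensorMap_comp]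
      rfl

/-- The star-homomorphism induced on free wreath products. -/
def freeWreathMap {P Q : QPermGroup} (n : ℕ) [NeZero n] (φ : P.A →⋆ₐ[ℂ] Q.A) :
    (P.freeWreath n).A →⋆ₐ[ℂ] (Q.freeWreath n).A :=
  freeWreathLift (fun i => (copyHom Q n i).comp φ) (permHom Q n) fun i j a => copyHom_comm i j (φ a)

theorem Isomorphic.freeWreath {P Q : QPermGroup} (h : P.Isomorphic Q) (n : ℕ) [NeZero n] :
    (P.freeWreath n).Isomorphic (Q.freeWreath n) := by
  obtain ⟨φ, ψ, h1, h2, h3⟩ := h.exists_homs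
  refine .of_homs (freeWreathMap n φ) (freeWreathMap n ψ) ?_ ?_ ?_
  · exact freeWreath_hom_ext (fun i a => congrArg (copyHom P n i) (DFunLike.congr_fun h1 a))
      (fun a => rfl)
  · exact freeWreath_hom_ext (fun i a => congrArg (copyHom Q n i) (DFunLike.congr_fun h2 a))
      (fun a => rfl)
  · refine freeWreath_hom_ext (fun i a => ?_) (fun a => ?_)
    · have hc : freeWreathMap n φ (copyHom P n i a) = copyHom Q n i (φ a) := rfl
      rw [StarAlgHom.comp_apply, StarAlgHom.comp_apply, hc, freeWreath_Δ_copy, freeWreath_Δ_copy,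
        show Q.Δ (φ a) = tensorMap φ φ (P.Δ a) from (DFunLike.congr_fun h3 a).symm, map_sum]
      refine Finset.sum_congr rfl fun k _ => ?_
      rw [map_mul, tensorMap_comp, tensorMap_comp, tensorMap_tmul, map_one]
      rfl
    · rw [StarAlgHom.comp_apply, StarAlgHom.comp_apply, freeWreath_Δ_perm, tensorMap_comp]
      exact (freeWreath_Δ_perm Q n a).symm

/-- The star-homomorphism from the algebra of the trivial quantum group. -/
def trivialHom (B : Type) [Ring B] [StarRing B] [Algebra ℂ B] [StarModule ℂ B] :
    trivial.A →⋆ₐ[ℂ] B :=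
  show ℂ →⋆ₐ[ℂ] B from { Algebra.ofId ℂ B with map_star' := fun c => algebraMap_star_comm c }

theorem trivial_hom_ext {B : Type*} [Ring B] [StarRing B] [Algebra ℂ B] [StarModule ℂ B]
    (φ ψ : trivial.A →⋆ₐ[ℂ] B) : φ = ψ :=
  hom_ext fun _ _ => (map_one φ).trans (map_one ψ).symm

theorem freeProd_trivial (P : QPermGroup) : (P.freeProd trivial).Isomorphic P := by
  refine .symm (.of_homs (inlHom P trivial) (freeProdLift (.id ℂ P.A) (trivialHom P.A)) rfl ?_ rfl)
  exact freeProd_hom_ext (fun a => rfl) fun a =>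
    DFunLike.congr_fun (trivial_hom_ext (((inlHom P trivial).comp
      (freeProdLift (.id ℂ P.A) (trivialHom P.A))).comp (inrHom P trivial)) (inrHom P trivial)) a

theorem Isomorphic.refl (P : QPermGroup) : P.Isomorphic P :=
  .of_homs (.id ℂ P.A) (.id ℂ P.A) rfl rfl (hom_ext fun i j => by
    rw [StarAlgHom.comp_apply, P.Δ_u, map_sum]
    simp only [tensorMap_tmul]
    exact (P.Δ_u i j).symm)

theorem freeProd_of_trivial {P Q : QPermGroup} (hQ : Q.Isomorphic trivial) :
    (P.freeProd Q).Isomorphic P :=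
  ((Isomorphic.refl P).freeProd hQ).trans (freeProd_trivial P)

end QPermGroup

/-- Wreath products of isomorphic groups are isomorphic. -/
def wreathSymCongr {Γ Λ : Type} [Group Γ] [Group Λ] (f : Γ ≃* Λ) (n : ℕ) :
    WreathSym Γ n ≃* WreathSym Λ n :=
  SemidirectProduct.congr (MulEquiv.piCongrRight fun _ => f) (MulEquiv.refl _) fun _ => rfl

/-! ### Sums and copies of connected graphs -/

section connected

variable {V W : Type} {G : SimpleGraph V} {H : SimpleGraph W}

theorem reachable_sum_iff (hG : G.Preconnected) (hH : H.Preconnected) (x y : V ⊕ W) :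
    (G ⊕g H).Reachable x y ↔ x.isLeft = y.isLeft := by
  rcases x with x | x <;> rcases y with y | y
  · exact iff_of_true ((hG x y).map SimpleGraph.Embedding.sumInl.toHom) rfl
  · exact iff_of_false (SimpleGraph.not_reachable_sum_inl_inr x y) (by simp)
  · exact iff_of_false (fun h => SimpleGraph.not_reachable_sum_inl_inr y x h.symm) (by simp)
  · exact iff_of_true ((hH x y).map SimpleGraph.Embedding.sumInr.toHom) rfl

/-- The colours `((), ())` are the trivial case of the pairs of colours in `FiberIso`; this
identifies a summand with a class of the partition into components. -/
theorem cIso_fiber_inl : CIso G (fun _ => ((), ())) ((G ⊕g H).comap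
    (Subtype.val : {x : V ⊕ W // x.isLeft = true} → V ⊕ W)) fun _ => ((), ()) := by
  refine ⟨Equiv.ofBijective (fun v => ⟨.inl v, rfl⟩) ⟨fun v v' h => ?_, ?_⟩, fun _ _ => Iff.rfl,
    fun _ => rfl⟩
  · exact Sum.inl_injective (congrArg Subtype.val h)
  · rintro ⟨v | v, hv⟩
    · exact ⟨v, rfl⟩
    · simp at hv

theorem cIso_fiber_inr : CIso H (fun _ => ((), ())) ((G ⊕g H).comap
    (Subtype.val : {x : V ⊕ W // x.isLeft = false} → V ⊕ W)) fun _ => ((), ()) := by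
  refine ⟨Equiv.ofBijective (fun v => ⟨.inr v, rfl⟩) ⟨fun v v' h => ?_, ?_⟩, fun _ _ => Iff.rfl,
    fun _ => rfl⟩
  · exact Sum.inr_injective (congrArg Subtype.val h)
  · rintro ⟨v | v, hv⟩
    · simp at hv
    · exact ⟨v, rfl⟩

/-- The disjoint union of two connected graphs that are not isomorphic. -/
theorem sumDecomp_of_preconnected [Fintype V] [Fintype W] (hG : G.Preconnected)
    (hH : H.Preconnected) (hG' : G.IsGood) (hH' : H.IsGood) (hGH : IsEmpty (G ≃g H)) :
    SumDecomp (G ⊕g H) (fun _ => ()) G (fun _ => ()) H (fun _ => ()) (Equiv.refl (V ⊕ W)) where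
  adj_inl a b := by simp
  adj_inr a b := by simp
  cross a a' b b' _ _ := by simp
  color_inl _ _ _ := rfl
  color_inr _ _ _ := rfl
  inv_inl _ _ _ _ := rfl
  inv_inr _ _ _ _ := rfl
  zero {X _ _ p u} hu a b := by
    have hπ : Rel2 u (fun x y : V ⊕ W => x.isLeft = y.isLeft) fun x y => x.isLeft = y.isLeft := by
      intro x y z t h
      have := hu.rel2_reachable hu.adj x y z t h
      rwa [reachable_sum_iff hG hH, reachable_sum_iff hG hH] at this
    have key : ¬ CIso G (fun _ => ((), ())) H fun _ => ((), ()) := by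
      rintro ⟨f, hf, -⟩
      exact hGH.false ⟨f, fun {a b} => hf a b⟩
    have ht : ∀ x a : V ⊕ W, u x a ≠ 0 → () = () := fun _ _ _ => rfl
    constructor
    -- A nonzero entry between the two components would make them isomorphic by superrigidity.
    · by_contra h
      have := hu.fiberIso (hG'.sum hH') hπ (t := fun _ => ()) (t' := fun _ => ()) ht _ _ h
      exact key (cIso_fiber_inl.trans (this.symm.trans cIso_fiber_inr.symm))
    · by_contra h
      have := hu.fiberIso (hG'.sum hH') hπ (t := fun _ => ()) (t' := fun _ => ()) ht _ _ h
      exact key (cIso_fiber_inl.trans (this.trans cIso_fiber_inr.symm))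

open SimpleGraph in
/-- The disjoint union of copies of a connected graph. -/
theorem wreathDecomp_of_preconnected [Fintype V] (hG : G.Preconnected) (n : ℕ) :
    WreathDecomp ((⊥ : SimpleGraph (Fin n)) □ G) (fun _ => ()) G (fun _ => ()) n
      (Equiv.refl (Fin n × V)) where
  adj i a b := by simp [boxProd_adj]
  cross i j i' j' a a' b b' h h' _ _ := by simp [boxProd_adj, h, h']
  color _ _ _ _ _ := rfl
  inv _ _ _ _ _ _ := rfl
  rel {X _ _ p u} hu := by
    have key : ∀ x y : Fin n × V, ((⊥ : SimpleGraph (Fin n)) □ G).Reachable x y ↔ x.1 = y.1 := by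
      intro x y
      rw [reachable_boxProd, reachable_bot]
      exact and_iff_left (hG _ _)
    intro x y z t h
    have := hu.rel2_reachable hu.adj x y z t h
    rwa [key, key] at this

open SimpleGraph in
theorem nonempty_iso_boxProd_one (G : SimpleGraph V) :
    Nonempty (G ≃g (⊥ : SimpleGraph (Fin 1)) □ G) :=
  ⟨⟨(Equiv.uniqueProd V (Fin 1)).symm, fun {a b} => by
    change ((⊥ : SimpleGraph (Fin 1)) □ G).Adj (default, a) (default, b) ↔ _
    simp [boxProd_adj]⟩⟩

open SimpleGraph in
theorem nonempty_iso_boxProd_succ (G : SimpleGraph V) (n : ℕ) :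
    Nonempty (((⊥ : SimpleGraph (Fin n)) □ G) ⊕g G ≃g (⊥ : SimpleGraph (Fin (n + 1))) □ G) := by
  let f : (Fin n × V) ⊕ V → Fin (n + 1) × V :=
    Sum.elim (fun p => (p.1.castSucc, p.2)) fun v => (Fin.last n, v)
  have hf : Function.Bijective f := by
    constructor
    · rintro (⟨i, x⟩ | x) (⟨j, y⟩ | y) h
      · simpa [f] using h
      · exact (Fin.castSucc_ne_last i (Prod.ext_iff.1 h).1).elim
      · exact (Fin.castSucc_ne_last j (Prod.ext_iff.1 h).1.symm).elim
      · simpa [f] using h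
    · rintro ⟨i, x⟩
      induction i using Fin.lastCases with
      | last => exact ⟨.inr x, rfl⟩
      | cast i => exact ⟨.inl (i, x), rfl⟩
  refine ⟨⟨Equiv.ofBijective f hf, fun {a b} => ?_⟩⟩
  change ((⊥ : SimpleGraph (Fin (n + 1))) □ G).Adj (f a) (f b) ↔ _
  rcases a with ⟨i, x⟩ | x <;> rcases b with ⟨j, y⟩ | y
  · simp [f, boxProd_adj]
  · simp [f, boxProd_adj, Fin.castSucc_ne_last]
  · simp [f, boxProd_adj, (Fin.castSucc_ne_last _).symm]
  · simp [f, boxProd_adj]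

end connected

/-! ### Graphs realising products and wreath products -/

namespace FinGraph

/-- The automorphism group of a graph. -/
abbrev Aut (G : FinGraph) : Type := G.graph ≃g G.graph

/-- The complement. -/
def compl (G : FinGraph) : FinGraph := ⟨G.V, G.graphᶜ⟩

/-- The disjoint union. -/
def sum (G H : FinGraph) : FinGraph := ⟨G.V ⊕ H.V, G.graph ⊕g H.graph⟩

open SimpleGraph in
/-- The disjoint union of `n` copies. -/
def copies (G : FinGraph) (n : ℕ) [NeZero n] : FinGraph :=
  ⟨Fin n × G.V, (⊥ : SimpleGraph (Fin n)) □ G.graph⟩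

/-- The graph with one vertex. -/
def point : FinGraph := ⟨Unit, ⊥⟩

theorem point_mem : point ∈ blockCographs := by
  refine .of fun B _ => ?_
  ext a b
  have : Subsingleton B.verts := ⟨fun x y => Subtype.ext (Subsingleton.elim (α := Unit) x.1 y.1)⟩
  simp [Subsingleton.elim a b]

theorem compl_mem {G : FinGraph} (hG : G ∈ blockCographs) : G.compl ∈ blockCographs := .compl hG

theorem sum_mem {G H : FinGraph} (hG : G ∈ blockCographs) (hH : H ∈ blockCographs) :
    G.sum H ∈ blockCographs := .sum hG hH

theorem copies_succ_mem {G : FinGraph} (hG : G ∈ blockCographs) (n : ℕ) :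
    G.copies (n + 1) ∈ blockCographs := by
  induction n with
  | zero => exact .iso (nonempty_iso_boxProd_one G.graph) hG
  | succ n ih => exact .iso (nonempty_iso_boxProd_succ G.graph (n + 1)) (sum_mem ih hG)

theorem copies_mem {G : FinGraph} (hG : G ∈ blockCographs) (n : ℕ) [NeZero n] :
    G.copies n ∈ blockCographs := by
  obtain ⟨n, rfl⟩ := Nat.exists_eq_succ_of_ne_zero (NeZero.ne n)
  exact copies_succ_mem hG n

/-- Having isomorphic automorphism groups and isomorphic quantum automorphism groups. -/
def SameAut (G H : FinGraph) : Prop := G.qu.Isomorphic H.qu ∧ Nonempty (G.Aut ≃* H.Aut)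

theorem SameAut.refl (G : FinGraph) : G.SameAut G := ⟨.refl _, ⟨MulEquiv.refl _⟩⟩

theorem SameAut.trans {G H K : FinGraph} (h : G.SameAut H) (h' : H.SameAut K) : G.SameAut K :=
  ⟨h.1.trans h'.1, ⟨h.2.some.trans h'.2.some⟩⟩

/-- Nonadjacency of distinct vertices is preserved together with adjacency, by classical and quantum
automorphisms alike. -/
theorem sameAut_compl (G : FinGraph) : G.SameAut G.compl := by
  constructor
  · have h : IsModel G.qu G.graphᶜ (fun _ => ()) (Equiv.refl G.V) :=
      { qIso := G.isModel_qu.qIso.compl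
        lift := fun B _ _ _ _ w hs hw => G.isModel_qu.lift B w hs (by
          have := hw.compl
          rwa [compl_compl] at this) }
    exact h.isomorphic (Q := G.compl.qu) G.compl.isModel_qu
  · have key : autC G.graph (fun _ => ()) = autC G.graphᶜ fun _ => () := by
      ext f
      simp only [mem_autC, SimpleGraph.compl_adj, f.injective.ne_iff]
      refine and_congr_left fun _ => forall₂_congr fun a b => ?_
      by_cases hab : a = b
      · subst hab; simp
      · simp [hab, not_iff_not]
    exact ⟨(autEquivAutC G.graph).trans ((MulEquiv.subgroupCongr key).trans
      (autEquivAutC G.graphᶜ).symm)⟩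

theorem exists_connected {G : FinGraph} (hG : G ∈ blockCographs) :
    ∃ H ∈ blockCographs, H.graph.Connected ∧ G.SameAut H := by
  rcases G.graph.connected_or_connected_compl with h | h
  · exact ⟨G, hG, h, .refl G⟩
  · exact ⟨G.compl, compl_mem hG, h, sameAut_compl G⟩

/-- Connectedness makes the summands the components, and nonisomorphic components are not mixed by
quantum automorphisms. -/
theorem sum_aut {G H : FinGraph} (hG : G ∈ blockCographs) (hH : H ∈ blockCographs)
    (hG' : G.graph.Connected) (hH' : H.graph.Connected) (hGH : IsEmpty (G.graph ≃g H.graph)) :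
    (G.sum H).qu.Isomorphic (G.qu.freeProd H.qu) ∧ Nonempty ((G.sum H).Aut ≃* G.Aut × H.Aut) := by
  have h := sumDecomp_of_preconnected hG'.preconnected hH'.preconnected
    (isGood_of_mem_blockCographs hG) (isGood_of_mem_blockCographs hH) hGH
  refine ⟨(G.sum H).isModel_qu.isomorphic (h.isModel G.isModel_qu H.isModel_qu), ⟨?_⟩⟩
  exact (autEquivAutC _).trans (h.autEquiv.symm.trans
    ((autEquivAutC _).symm.prodCongr (autEquivAutC _).symm))

theorem copies_aut {G : FinGraph} (hG' : G.graph.Connected) (n : ℕ) [NeZero n] :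
    (G.copies n).qu.Isomorphic (G.qu.freeWreath n) ∧
      Nonempty ((G.copies n).Aut ≃* WreathSym G.Aut n) := by
  have h := wreathDecomp_of_preconnected hG'.preconnected n
  refine ⟨(G.copies n).isModel_qu.isomorphic (h.isModel G.isModel_qu), ⟨?_⟩⟩
  exact (autEquivAutC _).trans (h.autEquiv.symm.trans (wreathSymCongr (autEquivAutC _).symm n))

theorem qu_of_subsingleton (G : FinGraph) [Subsingleton G.V] :
    G.qu.Isomorphic QPermGroup.trivial := by
  obtain ⟨e, he⟩ := isModel_trivial G.graph fun _ => ()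
  exact G.isModel_qu.isomorphic he

theorem subsingleton_aut (G : FinGraph) [Subsingleton G.V] : Subsingleton G.Aut :=
  ⟨fun _ _ => RelIso.ext fun _ => Subsingleton.elim _ _⟩

/-- The second factor of a product can be dropped if it comes from a graph with one vertex. -/
theorem prod_aut_of_subsingleton (G H : FinGraph) [Subsingleton H.V] :
    (G.qu.freeProd H.qu).Isomorphic G.qu ∧ Nonempty (G.Aut × H.Aut ≃* G.Aut) := by
  have := H.subsingleton_aut
  have : Unique H.Aut := ⟨⟨1⟩, fun _ => Subsingleton.elim _ _⟩
  exact ⟨QPermGroup.freeProd_of_trivial H.qu_of_subsingleton, ⟨MulEquiv.prodUnique⟩⟩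

/-- A connected graph with more than one vertex can be enlarged. -/
theorem exists_larger {G : FinGraph} (hG : G ∈ blockCographs) (hG' : G.graph.Connected)
    [Nontrivial G.V] : ∃ H ∈ blockCographs, H.graph.Connected ∧ IsEmpty (G.graph ≃g H.graph) ∧
      G.SameAut H := by
  have hp : Subsingleton point.V := inferInstanceAs (Subsingleton Unit)
  have h1 : IsEmpty (G.graph ≃g point.graph) :=
    ⟨fun e => not_subsingleton G.V e.toEquiv.subsingleton⟩
  have h2 : point.graph.Connected := ⟨fun x y => by rw [Subsingleton.elim x y]⟩
  obtain ⟨h3, ⟨h4⟩⟩ := sum_aut hG point_mem hG' h2 h1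
  obtain ⟨h5, ⟨h6⟩⟩ := prod_aut_of_subsingleton G point
  -- An isolated vertex adds only a trivial factor, since `G` is not a point; the complement
  -- restores connectedness, and the number of vertices rules out an isomorphism with `G`.
  refine ⟨(G.sum point).compl, compl_mem (sum_mem hG point_mem), ?_, ⟨fun e => ?_⟩, ?_⟩
  · exact (G.sum point).graph.connected_or_connected_compl.resolve_left
      SimpleGraph.not_connected_sum
  · have := Fintype.card_congr e.toEquiv
    have h : Fintype.card (G.V ⊕ Unit) = Fintype.card G.V + 1 := by simp
    change Fintype.card G.V = Fintype.card (G.V ⊕ Unit) at this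
    omega
  · exact SameAut.trans ⟨(h3.trans h5).symm, ⟨(h4.trans h6).symm⟩⟩ (sameAut_compl _)

/-- After passing to connected graphs, the disjoint union works unless the two are isomorphic. In
that case one of them is enlarged without changing its groups, or dropped if it has a single vertex.
-/
theorem exists_prod {G H : FinGraph} (hG : G ∈ blockCographs) (hH : H ∈ blockCographs) :
    ∃ K ∈ blockCographs, K.qu.Isomorphic (G.qu.freeProd H.qu) ∧
      Nonempty (K.Aut ≃* G.Aut × H.Aut) := by
  obtain ⟨G', hG', hGc, hGG'⟩ := exists_connected hG
  obtain ⟨H', hH', hHc, hHH'⟩ := exists_connected hH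
  suffices h : ∃ K ∈ blockCographs, K.qu.Isomorphic (G'.qu.freeProd H'.qu) ∧
      Nonempty (K.Aut ≃* G'.Aut × H'.Aut) by
    obtain ⟨K, hK, h1, ⟨h2⟩⟩ := h
    exact ⟨K, hK, h1.trans (hGG'.1.freeProd hHH'.1).symm,
      ⟨h2.trans (hGG'.2.some.prodCongr hHH'.2.some).symm⟩⟩
  rcases isEmpty_or_nonempty (G'.graph ≃g H'.graph) with h | ⟨⟨e⟩⟩
  · exact ⟨_, sum_mem hG' hH', sum_aut hG' hH' hGc hHc h⟩
  rcases subsingleton_or_nontrivial H'.V with hs | hs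
  · obtain ⟨h1, ⟨h2⟩⟩ := prod_aut_of_subsingleton G' H'
    exact ⟨G', hG', h1.symm, ⟨h2.symm⟩⟩
  · obtain ⟨L, hL, hLc, hLH, hLa⟩ := exists_larger hH' hHc
    obtain ⟨h1, ⟨h2⟩⟩ := sum_aut hG' hL hGc hLc ⟨fun e' => hLH.false (e.symm.trans e')⟩
    exact ⟨_, sum_mem hG' hL, h1.trans ((QPermGroup.Isomorphic.refl _).freeProd hLa.1).symm,
      ⟨h2.trans ((MulEquiv.refl _).prodCongr hLa.2.some).symm⟩⟩

theorem exists_wreath {G : FinGraph} (hG : G ∈ blockCographs) (n : ℕ) [NeZero n] :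
    ∃ K ∈ blockCographs, K.qu.Isomorphic (G.qu.freeWreath n) ∧
      Nonempty (K.Aut ≃* WreathSym G.Aut n) := by
  obtain ⟨G', hG', hGc, hGG'⟩ := exists_connected hG
  obtain ⟨h1, ⟨h2⟩⟩ := copies_aut hGc n
  exact ⟨_, copies_mem hG' n, h1.trans (hGG'.1.freeWreath n).symm,
    ⟨h2.trans (wreathSymCongr hGG'.2.some n).symm⟩⟩

/-! ### The main results -/

theorem autGroups_blockCographs : autGroups blockCographs = {Γ | Jor {GrpCat.of Unit} Γ} := by
  ext Γ
  constructor
  · rintro ⟨G, hG, ⟨e⟩⟩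
    exact .iso ⟨(autEquivAutC G.graph).symm.trans e⟩ ((isGood_of_mem_blockCographs hG).jor_autC _)
  · intro (h : Jor {GrpCat.of Unit} Γ)
    induction h with
    | of h =>
      obtain rfl := h
      have : Subsingleton point.V := inferInstanceAs (Subsingleton Unit)
      have := point.subsingleton_aut
      have : Unique point.Aut := ⟨⟨1⟩, fun _ => Subsingleton.elim _ _⟩
      exact ⟨point, point_mem, ⟨(MulEquiv.ofUnique : point.Aut ≃* Unit)⟩⟩
    | iso e _ ih =>
      obtain ⟨G, hG, ⟨f⟩⟩ := ih
      exact ⟨G, hG, ⟨f.trans e.some⟩⟩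
    | prod _ _ ih ih' =>
      obtain ⟨G, hG, ⟨f⟩⟩ := ih
      obtain ⟨H, hH, ⟨g⟩⟩ := ih'
      obtain ⟨K, hK, -, ⟨k⟩⟩ := exists_prod hG hH
      exact ⟨K, hK, ⟨k.trans (f.prodCongr g)⟩⟩
    | wreath n _ ih =>
      obtain ⟨G, hG, ⟨f⟩⟩ := ih
      obtain ⟨K, hK, -, ⟨k⟩⟩ := exists_wreath hG n
      exact ⟨K, hK, ⟨k.trans (wreathSymCongr f n)⟩⟩

theorem quGroups_blockCographs :
    quGroups blockCographs = {Q | JorPlus {QPermGroup.trivial} Q} := by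
  ext Q
  constructor
  · rintro ⟨G, hG, e⟩
    exact .iso e (jorPlus_qu (isGood_of_mem_blockCographs hG))
  · intro (h : JorPlus {QPermGroup.trivial} Q)
    induction h with
    | of h =>
      obtain rfl := h
      have : Subsingleton point.V := inferInstanceAs (Subsingleton Unit)
      exact ⟨point, point_mem, point.qu_of_subsingleton⟩
    | iso e _ ih =>
      obtain ⟨G, hG, f⟩ := ih
      exact ⟨G, hG, f.trans e⟩
    | freeProd _ _ ih ih' =>
      obtain ⟨G, hG, f⟩ := ih
      obtain ⟨H, hH, g⟩ := ih'
      obtain ⟨K, hK, k, -⟩ := exists_prod hG hH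
      exact ⟨K, hK, k.trans (f.freeProd g)⟩
    | freeWreath n _ ih =>
      obtain ⟨G, hG, f⟩ := ih
      obtain ⟨K, hK, k, -⟩ := exists_wreath hG n
      exact ⟨K, hK, k.trans (f.freeWreath n)⟩

theorem superrigid_blockCographs : Superrigid.{w} blockCographs := by
  rintro G hG H ⟨X, _, _, U, hU, hc⟩
  classical
  have hq : QIso (1 : X) U G.graph (fun _ => ()) H.graph fun _ => () :=
    { toQMagic := hU.qMagic
      adj := by
        refine hU.qMagic.intertwine _ _ fun x b => ?_
        have := congrFun (congrFun hc x) b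
        simp only [Matrix.mul_apply, adj] at this
        convert this
      color := fun _ _ _ => rfl }
  obtain ⟨f, hf, -⟩ := (isGood_of_mem_blockCographs hG).cIso hq one_ne_zero
  exact ⟨f, fun {a b} => hf a b⟩

end FinGraph

end

theorem mainTheorem4 :
    FinGraph.SuperrigidTractable.{w} FinGraph.blockCographs ∧
    FinGraph.autGroups FinGraph.blockCographs = {Γ | Jor {GrpCat.of Unit} Γ} ∧
    FinGraph.quGroups FinGraph.blockCographs = {Q | JorPlus {QPermGroup.trivial} Q} :=
  ⟨⟨FinGraph.schmidtAlternative_blockCographs, FinGraph.superrigid_blockCographs⟩,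
    FinGraph.autGroups_blockCographs, FinGraph.quGroups_blockCographs⟩
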